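/- **Setting.** Let $\mathcal N=\{1,\dots,N\}$. For $i\in\mathcal N$ let $z_i(t)=\phi_i(t)^\top\theta+\varepsilon_i(t)$, $t\ge 0$, where $\phi_i:[0,\infty)\to\mathbb R^n$ is smooth and bounded, $\theta\in\mathbb R^n$ is constant, $z_i$ is continuous and the noise $\varepsilon_i$ is bounded. Assume that $\phi_i$ has deficient excitation of order $q_i$, $0\le q_i\le n$: there are $T_i>0$ and positive semidefinite matrices $\Phi_{ia},\Phi_{ib}$ of rank $n-q_i$ with $\Phi_{ia}\le\int_t^{t+T_i}\phi_i\phi_i^\top d\tau\le\Phi_{ib}$ for all $t\ge0$. Let the columns of $N_{id}\in\mathbb R^{n\times(n-q_i)}$ and $N_{iu}\in\mathbb R^{n\times q_i}$ be orthonormal bases of $\mathrm{Im}\,\Phi_{ia}$ and $\mathrm{Ker}\,\Phi_{ib}$. The nodes communicate over a directed graph without self loops, with weights $a_{ij}>0$ if $(j,i)$ is an edge and $a_{ij}=0$ otherwise, and Laplacian $l_{ii}=\sum_k a_{ik}$, $l_{ij}=-a_{ij}$ ($i\ne j$). **Algorithm.** Let $\beta_i,\gamma_i,\delta_i,\kappa_i,\alpha_i,\eta_{id},\eta_{iu}>0$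 and prior estimates $\hat\theta_{i0}\in\mathbb R^n$ be given. For $t\ge0$ node $i$ runs $$\dot Q_i=-\beta_iQ_i+\phi_i\phi_i^\top,\quad \dot P_i=-\gamma_iP_i+\gamma_iI-\gamma_i^2\int_0^te^{-\gamma_i(t-\tau)}\bar N_{iu}(\tau)\bar N_{iu}(\tau)^\top d\tau,\quad Q_i(0)=P_i(0)=0,$$ where $\bar N_{iu}(\tau)=\hat N_{iu}(k\delta_i)$ for $k\delta_i\le\tau<(k+1)\delta_i$ and the columns of $\hat N_{iu}(k\delta_i)$ form an orthonormal basis of $\mathrm{Ker}\,Q_i(k\delta_i)$; further $$\dot\varphi_i=-\beta_i\varphi_i+z_i\phi_i,\ \varphi_i(0)=\alpha_i\hat\theta_{i0};\qquad \dot\Omega_i=\beta_i\Omega_i-\Omega_iR_i\Omega_i,\ \Omega_i(0)=\kappa_i^{-1}I,$$ $$R_i=P_i\phi_i\phi_i^\top P_i+\kappa_i\beta_i(I-P_i)+\dot P_iQ_iP_i+P_iQ_i\dot P_i+(\alpha_ie^{-\beta_it}-\kappa_i)\dot P_i,$$ $$\dot{\hat\theta}_{id}=-\Omega_i\bigl(R_i\hat\theta_{id}-z_iP_i\phi_i-\dot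 P_i\varphi_i\bigr),\quad \hat\theta_{id}(0)=0,$$ $$\dot{\hat\theta}_{iu}=-\eta_{id}P_i\hat\theta_{iu}-\eta_{iu}(I-P_i)\sum_{j}a_{ij}(\hat\theta_i-\hat\theta_j),\quad\hat\theta_{iu}(0)=\hat\theta_{i0},\qquad \hat\theta_i=P_i\hat\theta_{id}+(I-P_i)\hat\theta_{iu}.$$ Let $\tilde\theta_I=\mathrm{col}(\hat\theta_1-\theta,\dots,\hat\theta_N-\theta)$. **Reference system.** Let $\theta_i^*(t)$ be the minimizer over $\vartheta\in\mathbb R^n$ of $$\tfrac12\int_0^te^{-\beta_i(t-\tau)}\bigl(z_i(\tau)-\vartheta^\top\phi_i(\tau)\bigr)^2d\tau+\tfrac{\alpha_i}2e^{-\beta_it}\|\vartheta-\hat\theta_{i0}\|^2 .$$ With $N_D=\mathrm{diag}(N_{1d},\dots,N_{Nd})$, $N_U=\mathrm{diag}(N_{1u},\dots,N_{Nu})$, $H_U=\mathrm{diag}(\eta_{1u}I_{q_1},\dots,\eta_{Nu}I_{q_N})$, let $\tilde\theta_D^*=N_D^\top\mathrm{col}(\theta_1^*-\theta,\dots,\theta_N^*-\theta)$,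 let $\tilde\theta_U^*$ solve $\dot{\tilde\theta}{}_U^*=-H_UN_U^\top(\mathcal L\otimes I)(N_U\tilde\theta_U^*+N_D\tilde\theta_D^*)$, $\tilde\theta_U^*(0)=0$, and put $\tilde\theta_I^*=N_D\tilde\theta_D^*+N_U\tilde\theta_U^*$. **Theorem.** Suppose in addition that the complementary condition $\sum_{i}\Phi_{ia}>0$ holds and that the graph is strongly connected. Then: 1. For all positive gains the algorithm and the reference system have solutions on $[0,\infty)$. 2. For all positive gains there are $\rho_a,\rho_b>0$ with $\|\tilde\theta_I(t)-\tilde\theta_I^*(t)\|\le\rho_ae^{-\rho_bt}$ for all $t\ge0$. 3. The rate $\rho_b$ can be made arbitrarily large by increasing $\gamma_i$ and $\eta_{iu}$: with all other data fixed, for every $\rho_b>0$ there is $g>0$ such that, whenever $\gamma_i\ge g$ and $\eta_{iu}\ge g$ for all $i$, there is $\rho_a>0$ with $\|\tilde\theta_I(t)-\tilde\theta_I^*(t)\|\le\rho_ae^{-\rho_bt}$ for all $t\ge 0$. 4. In the noise-free case $\varepsilon_i\equiv0$ ($i\in\mathcal N$): for all positive gains there are $\rho_c,\rho_d>0$ with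 $\|\tilde\theta_I(t)\|\le\rho_ce^{-\rho_dt}$ for all $t\ge0$; and there is $g>0$ such that, whenever $\gamma_i\ge g$ and $\eta_{iu}\ge g$ for all $i$, for every $\rho_d<\min_{i}\beta_i/2$ there is $\rho_c>0$ with $\|\tilde\theta_I(t)\|\le\rho_ce^{-\rho_dt}$ for all $t\ge0$. -/

import Mathlib

open Set Matrix
open scoped ContDiff

noncomputable section

namespace DefExc

/-- Euclidean norm of a finite real vector. -/
def euclNorm {ι : Type*} [Fintype ι] (x : ι → ℝ) : ℝ := ‖WithLp.toLp 2 x‖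

/-- The windowed Gram matrix `∫_t^{t+T} φ(τ) φ(τ)ᵀ dτ`, entry by entry. -/
def windowGram {n : ℕ} (φ : ℝ → Fin n → ℝ) (t T : ℝ) : Matrix (Fin n) (Fin n) ℝ :=
  Matrix.of fun a b => ∫ τ in t..(t + T), φ τ a * φ τ b

/-- `φ` displays deficiency of excitation of order `q`, as witnessed by the window length `T` and
the positive semidefinite matrices `Φa ≤ Φb` of rank `n - q`. -/
structure IsDeficientlyExciting {n : ℕ} (φ : ℝ → Fin n → ℝ) (q : ℕ) (T : ℝ)
    (Φa Φb : Matrix (Fin n) (Fin n) ℝ) : Prop where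
  order_le : q ≤ n
  window_pos : 0 < T
  lower_posSemidef : Φa.PosSemidef
  upper_posSemidef : Φb.PosSemidef
  lower_rank : Φa.rank = n - q
  upper_rank : Φb.rank = n - q
  lower : ∀ t, 0 ≤ t → (windowGram φ t T - Φa).PosSemidef
  upper : ∀ t, 0 ≤ t → (Φb - windowGram φ t T).PosSemidef

/-- The columns of `M` form an orthonormal basis of the subspace `V` of `ℝⁿ`. -/
def ColumnsOrthonormalBasis {n r : ℕ} (M : Matrix (Fin n) (Fin r) ℝ)
    (V : Submodule ℝ (Fin n → ℝ)) : Prop :=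
  Mᵀ * M = 1 ∧ LinearMap.range M.mulVecLin = V

/-- A weighted directed graph on `N` nodes without self loops; `edge j i` is the edge from `j` to
`i`, whose weight is `a i j`. -/
structure CommGraph (N : ℕ) where
  edge : Fin N → Fin N → Prop
  a : Matrix (Fin N) (Fin N) ℝ
  weight_pos : ∀ i j, edge j i → 0 < a i j
  weight_zero : ∀ i j, ¬ edge j i → a i j = 0
  no_loop : ∀ i, a i i = 0

/-- There is a directed path from every node to every other node. -/
def CommGraph.StronglyConnected {N : ℕ} (G : CommGraph N) : Prop :=
  ∀ i j, i ≠ j → Relation.TransGen G.edge i j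

/-- The Laplacian `l i i = ∑ k, a i k`, `l i j = - a i j` for `i ≠ j`. -/
def CommGraph.laplacian {N : ℕ} (G : CommGraph N) : Matrix (Fin N) (Fin N) ℝ :=
  Matrix.of fun i j => if i = j then ∑ k, G.a i k else - G.a i j

/-- The design parameters of the algorithm other than the gains `γ i` and `ηu i`, together with the
prior estimates `θ0 i`. -/
structure Design (N n : ℕ) where
  β : Fin N → ℝ
  δ : Fin N → ℝ
  κ : Fin N → ℝ
  α : Fin N → ℝ
  ηd : Fin N → ℝ
  θ0 : Fin N → Fin n → ℝ
  β_pos : ∀ i, 0 < β i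
  δ_pos : ∀ i, 0 < δ i
  κ_pos : ∀ i, 0 < κ i
  α_pos : ∀ i, 0 < α i
  ηd_pos : ∀ i, 0 < ηd i

/-- The measurement `z(t) = φ(t)ᵀ θ + ε(t)`. -/
def measurement {n : ℕ} (φ : ℝ → Fin n → ℝ) (θ : Fin n → ℝ) (ε : ℝ → ℝ) (t : ℝ) : ℝ :=
  φ t ⬝ᵥ θ + ε t

/-- The signals that one node computes from its own measurements. `Nhat k` is the matrix of an
orthonormal basis of the kernel of `Q` at the `k`-th sampling time; `rk k` is the number of its
columns. -/
structure LocalSignals (n : ℕ) where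
  rk : ℕ → ℕ
  Nhat : (k : ℕ) → Matrix (Fin n) (Fin (rk k)) ℝ
  Q : ℝ → Matrix (Fin n) (Fin n) ℝ
  P : ℝ → Matrix (Fin n) (Fin n) ℝ
  φf : ℝ → Fin n → ℝ
  Ω : ℝ → Matrix (Fin n) (Fin n) ℝ
  θd : ℝ → Fin n → ℝ

namespace LocalSignals

variable {n : ℕ}

/-- The product of the sampled-and-held matrix with its transpose: it is `Nhat k * (Nhat k)ᵀ` for
`k δ ≤ τ < (k + 1) δ`. -/
def NbarSq (S : LocalSignals n) (δ τ : ℝ) : Matrix (Fin n) (Fin n) ℝ :=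
  S.Nhat ⌊τ / δ⌋₊ * (S.Nhat ⌊τ / δ⌋₊)ᵀ

/-- The right-hand side of the differential equation of `P`. -/
def Pdot (S : LocalSignals n) (γ δ t : ℝ) : Matrix (Fin n) (Fin n) ℝ :=
  -(γ • S.P t) + γ • (1 : Matrix (Fin n) (Fin n) ℝ) - γ ^ 2 • Matrix.of fun a b =>
    ∫ τ in (0 : ℝ)..t, Real.exp (-γ * (t - τ)) * S.NbarSq δ τ a b

/-- The matrix signal `R` of the parameter learning algorithm. -/
def R (S : LocalSignals n) (β γ δ κ α : ℝ) (φ : ℝ → Fin n → ℝ) (t : ℝ) :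
    Matrix (Fin n) (Fin n) ℝ :=
  S.P t * vecMulVec (φ t) (φ t) * S.P t + (κ * β) • (1 - S.P t)
    + S.Pdot γ δ t * S.Q t * S.P t + S.P t * S.Q t * S.Pdot γ δ t
    + (α * Real.exp (-β * t) - κ) • S.Pdot γ δ t

/-- `S` obeys the local learning algorithm for all `t ≥ 0`, with regressor `φ`, measurement `z` and
prior estimate `θ0`. Matrix differential equations are read entry by entry. -/
structure IsRun (S : LocalSignals n) (β γ δ κ α : ℝ) (θ0 : Fin n → ℝ)
    (φ : ℝ → Fin n → ℝ) (z : ℝ → ℝ) : Prop where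
  Q_zero : S.Q 0 = 0
  Q_deriv : ∀ t, 0 ≤ t → ∀ a b, HasDerivWithinAt (fun s => S.Q s a b)
    ((-(β • S.Q t) + vecMulVec (φ t) (φ t)) a b) (Ici 0) t
  Nhat_basis : ∀ k : ℕ, ColumnsOrthonormalBasis (S.Nhat k)
    (LinearMap.ker (S.Q (k * δ)).mulVecLin)
  P_zero : S.P 0 = 0
  P_deriv : ∀ t, 0 ≤ t → ∀ a b, HasDerivWithinAt (fun s => S.P s a b)
    (S.Pdot γ δ t a b) (Ici 0) t
  φf_zero : S.φf 0 = α • θ0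
  φf_deriv : ∀ t, 0 ≤ t → HasDerivWithinAt S.φf (-(β • S.φf t) + z t • φ t) (Ici 0) t
  Ω_zero : S.Ω 0 = κ⁻¹ • (1 : Matrix (Fin n) (Fin n) ℝ)
  Ω_deriv : ∀ t, 0 ≤ t → ∀ a b, HasDerivWithinAt (fun s => S.Ω s a b)
    ((β • S.Ω t - S.Ω t * S.R β γ δ κ α φ t * S.Ω t) a b) (Ici 0) t
  θd_zero : S.θd 0 = 0
  θd_deriv : ∀ t, 0 ≤ t → HasDerivWithinAt S.θd
    (-(S.Ω t *ᵥ (S.R β γ δ κ α φ t *ᵥ S.θd t - z t • (S.P t *ᵥ φ t)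
      - S.Pdot γ δ t *ᵥ S.φf t))) (Ici 0) t

end LocalSignals

/-- All signals of the distributed algorithm. -/
structure NetworkSignals (N n : ℕ) where
  loc : Fin N → LocalSignals n
  θu : Fin N → ℝ → Fin n → ℝ

/-- The estimate `P_i θd_i + (I - P_i) θu_i` of node `i`. -/
def NetworkSignals.est {N n : ℕ} (S : NetworkSignals N n) (i : Fin N) (t : ℝ) : Fin n → ℝ :=
  (S.loc i).P t *ᵥ (S.loc i).θd t + (1 - (S.loc i).P t) *ᵥ S.θu i t

/-- `S` obeys the distributed learning algorithm for all `t ≥ 0`. -/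
structure NetworkSignals.IsRun {N n : ℕ} (S : NetworkSignals N n) (G : CommGraph N)
    (D : Design N n) (γ ηu : Fin N → ℝ) (φ : Fin N → ℝ → Fin n → ℝ) (z : Fin N → ℝ → ℝ) :
    Prop where
  loc_run : ∀ i, (S.loc i).IsRun (D.β i) (γ i) (D.δ i) (D.κ i) (D.α i) (D.θ0 i) (φ i) (z i)
  θu_zero : ∀ i, S.θu i 0 = D.θ0 i
  θu_deriv : ∀ i t, 0 ≤ t → HasDerivWithinAt (S.θu i)
    (-(D.ηd i • ((S.loc i).P t *ᵥ S.θu i t))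
      - ηu i • ((1 - (S.loc i).P t) *ᵥ ∑ j, G.a i j • (S.est i t - S.est j t))) (Ici 0) t

/-- The stacked estimation error `col(est_1 - θ, …, est_N - θ)`. -/
def NetworkSignals.err {N n : ℕ} (S : NetworkSignals N n) (θ : Fin n → ℝ) (t : ℝ) :
    Fin N × Fin n → ℝ :=
  fun p => S.est p.1 t p.2 - θ p.2

/-- The least squares cost with forgetting factor at time `t`, as a function of the candidate
parameter `ϑ`. -/
def cost {n : ℕ} (β α : ℝ) (θ0 : Fin n → ℝ) (φ : ℝ → Fin n → ℝ) (z : ℝ → ℝ) (t : ℝ)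
    (ϑ : Fin n → ℝ) : ℝ :=
  1 / 2 * (∫ τ in (0 : ℝ)..t, Real.exp (-β * (t - τ)) * (z τ - ϑ ⬝ᵥ φ τ) ^ 2)
    + α / 2 * Real.exp (-β * t) * euclNorm (ϑ - θ0) ^ 2

/-- The signals of the reference system: the least squares solutions `θs i` and the state `U i` in
the coordinates of the non-identifiable subspaces. -/
structure RefSignals (N n : ℕ) (q : Fin N → ℕ) where
  θs : Fin N → ℝ → Fin n → ℝ
  U : (i : Fin N) → ℝ → Fin (q i) → ℝ

namespace RefSignals

variable {N n : ℕ} {q : Fin N → ℕ}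

/-- The `i`-th block of the identifiable part, `N_{id}ᵀ (θs_i(t) - θ)`. -/
def DPart (X : RefSignals N n q) (Nd : (i : Fin N) → Matrix (Fin n) (Fin (n - q i)) ℝ)
    (θ : Fin n → ℝ) (i : Fin N) (t : ℝ) : Fin (n - q i) → ℝ :=
  (Nd i)ᵀ *ᵥ (X.θs i t - θ)

/-- The `i`-th block of the output, `N_{id} D_i(t) + N_{iu} U_i(t)`. -/
def block (X : RefSignals N n q) (Nd : (i : Fin N) → Matrix (Fin n) (Fin (n - q i)) ℝ)
    (Nu : (i : Fin N) → Matrix (Fin n) (Fin (q i)) ℝ)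
    (θ : Fin n → ℝ) (i : Fin N) (t : ℝ) : Fin n → ℝ :=
  Nd i *ᵥ X.DPart Nd θ i t + Nu i *ᵥ X.U i t

/-- The stacked output of the reference system. -/
def out (X : RefSignals N n q) (Nd : (i : Fin N) → Matrix (Fin n) (Fin (n - q i)) ℝ)
    (Nu : (i : Fin N) → Matrix (Fin n) (Fin (q i)) ℝ)
    (θ : Fin n → ℝ) (t : ℝ) : Fin N × Fin n → ℝ :=
  fun p => X.block Nd Nu θ p.1 t p.2

/-- `X` is the trajectory of the reference system: every `θs i t` minimizes the local cost, and
`U' = - H_U N_Uᵀ (L ⊗ I) (N_U U + N_D D)` with `U(0) = 0`, written block by block. -/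
structure IsTrajectory (X : RefSignals N n q) (G : CommGraph N) (D : Design N n)
    (ηu : Fin N → ℝ) (φ : Fin N → ℝ → Fin n → ℝ) (z : Fin N → ℝ → ℝ)
    (Nd : (i : Fin N) → Matrix (Fin n) (Fin (n - q i)) ℝ)
    (Nu : (i : Fin N) → Matrix (Fin n) (Fin (q i)) ℝ) (θ : Fin n → ℝ) : Prop where
  θs_min : ∀ i t, 0 ≤ t →
    ∀ ϑ, cost (D.β i) (D.α i) (D.θ0 i) (φ i) (z i) t (X.θs i t)
      ≤ cost (D.β i) (D.α i) (D.θ0 i) (φ i) (z i) t ϑ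
  U_zero : ∀ i, X.U i 0 = 0
  U_deriv : ∀ i t, 0 ≤ t → HasDerivWithinAt (X.U i)
    (-(ηu i • ((Nu i)ᵀ *ᵥ ∑ j, G.laplacian i j • X.block Nd Nu θ j t))) (Ici 0) t

end RefSignals

end DefExc

end

/-!
The algorithm approaches its reference system because each of its layers is an exact solution of a
linear problem, up to the error `E = P - (1 - U)` of the filtered projection, where `U` projects on
the non-identifiable subspace of a node.

*Local layer.* Equality of the ranks of `Φa ≤ Φb` forces their kernels to agree, so that the regressor
is orthogonal to the range of `U` and persistently excited on its complement
(`IsDeficientlyExciting.isExcitedOff`). After one excitation window the kernel of `Q` is the range of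
`U`, hence the sampled projections become constant and `e^{γt} E(t)` becomes affine
(`LocalSignals.IsRun.P_sub_isBigO`). The equation of `Ω` says that `Ω` is the inverse of
`M = P Q P + κ (1 - P) + α e^{-βt} P`, and the equation of `θd` says that `M θd = P φf`
(`Ω_mul_info`, `info_mulVec_θd`). The minimizer of the cost solves the normal equations, whose
identifiable part has the limit of `M` as coefficient matrix, and that limit is uniformly coercive;
thus `P θd` differs from the identifiable part of the minimizer by a term of the order of `E`
(`P_mulVec_θd_sub_isBigO`). Without noise, the normal equations for the error have the right-hand side
`α e^{-βt} (θ0 - θ)`, which gives the decay at the forgetting rate.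

*Network layer.* The non-identifiable parts obey consensus dynamics
`y i' = - η i • U i ∑ j, l i j • y j` on the ranges of the projections. Let `ξ` be the positive left
null vector of the Laplacian. The function `∑ i, ξ i / η i * |y i|²` decreases at the rate of the
weighted disagreement, which by the complementary condition is a definite form on the product of these
ranges. The gains cancel in the derivative, so the decay rate is proportional to the smallest gain
(`exists_hasConsensusRate`). This is used for the boundedness of the algorithm, for the difference of
algorithm and reference system, and for the noise-free reference system.

*Existence.* `Q`, `P` and `φf` are explicit integrals, `0 ≤ P ≤ 1 - e^{-γt}` makes `M` positive
definite, and then `Ω` and `θd` are explicit. The remaining equations are linear with bounded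
coefficients (`exists_solution_of_lipschitz`).
-/

namespace DefExc

section

open Asymptotics Filter Topology

/-! ### Differential equations on the half line -/

section HalfLine

variable {E : Type*} [NormedAddCommGroup E] [NormedSpace ℝ E]

/-- Gronwall uniqueness on `[0, ∞)`, with a growth factor that is only locally bounded. -/
lemma eq_zero_of_norm_deriv_le {y y' : ℝ → E} {K : ℝ → ℝ} (hK : ContinuousOn K (Ici 0))
    (h0 : y 0 = 0) (hd : ∀ t, 0 ≤ t → HasDerivWithinAt y (y' t) (Ici 0) t)
    (hb : ∀ t, 0 ≤ t → ‖y' t‖ ≤ K t * ‖y t‖) : ∀ t, 0 ≤ t → y t = 0 := by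
  intro t ht
  obtain ⟨C, hC⟩ := (isCompact_Icc (a := (0 : ℝ)) (b := t)).exists_bound_of_continuousOn
    (hK.mono Icc_subset_Ici_self)
  have h := norm_le_gronwallBound_of_norm_deriv_right_le (f := y) (f' := y') (δ := 0) (K := C)
    (ε := 0) (a := 0) (b := t)
    (fun s hs => (hd s hs.1).continuousWithinAt.mono Icc_subset_Ici_self)
    (fun s hs => (hd s hs.1).mono (Ici_subset_Ici.2 hs.1)) (by simp [h0])
    (fun s hs => by
      have h1 := hb s hs.1
      have h2 := (le_abs_self _).trans (hC s ⟨hs.1, hs.2.le⟩)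
      nlinarith [norm_nonneg (y s)])
    t ⟨ht, le_rfl⟩
  simpa [gronwallBound_ε0_δ0] using h

lemma eq_of_deriv_eq_neg_smul_add {f g h : ℝ → E} {β : ℝ} (h0 : f 0 = g 0)
    (hf : ∀ t, 0 ≤ t → HasDerivWithinAt f (-(β • f t) + h t) (Ici 0) t)
    (hg : ∀ t, 0 ≤ t → HasDerivWithinAt g (-(β • g t) + h t) (Ici 0) t) :
    ∀ t, 0 ≤ t → f t = g t := by
  intro t ht
  have := eq_zero_of_norm_deriv_le (y := fun t => f t - g t) (K := fun _ => |β|)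
    continuousOn_const (by simp [h0]) (fun t ht => (hf t ht).sub (hg t ht))
    (fun t _ => by
      rw [show -(β • f t) + h t - (-(β • g t) + h t) = -(β • (f t - g t)) by
        rw [smul_sub]; abel, norm_neg, norm_smul, Real.norm_eq_abs]) t ht
  exact sub_eq_zero.1 this

/-- A globally Lipschitz differential equation has a solution on all of `[0, ∞)`: the Picard map is
a contraction on bounded functions once solutions are weighted by a decaying exponential. -/
theorem exists_solution_of_lipschitz [CompleteSpace E] (f : ℝ → E → E) (C : ℝ)
    (hcont : ∀ x : ℝ → E, Continuous x → ContinuousOn (fun t => f t (x t)) (Ici 0))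
    (hlip : ∀ t, 0 ≤ t → ∀ x y, ‖f t x - f t y‖ ≤ C * ‖x - y‖)
    (hbdd : ∀ t, 0 ≤ t → ‖f t 0‖ ≤ C) (x₀ : E) :
    ∃ x : ℝ → E, x 0 = x₀ ∧ ∀ t, 0 ≤ t → HasDerivWithinAt x (f t (x t)) (Ici 0) t := by
  have hC : 0 ≤ C := (norm_nonneg _).trans (hbdd 0 le_rfl)
  set l : ℝ := C + 1 with hl
  have hlpos : 0 < l := by positivity
  -- the integrand of the Picard map, extended to negative times by its value at `0`
  let F : (BoundedContinuousFunction ℝ E) → ℝ → E := fun y s =>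
    f (max s 0) (Real.exp (l * max s 0) • y (max s 0))
  have hFc : ∀ y, Continuous (F y) := by
    intro y
    have h1 := hcont (fun s => Real.exp (l * s) • y s) (by fun_prop)
    have h2 : Continuous fun s : ℝ => max s 0 := by fun_prop
    exact h1.comp_continuous h2 (fun s => mem_Ici.2 (le_max_right _ _))
  have hFi : ∀ y a b, IntervalIntegrable (F y) MeasureTheory.volume a b :=
    fun y a b => (hFc y).intervalIntegrable a b
  have hint : ∀ (c t : ℝ), 0 ≤ c → 0 ≤ t →
      Real.exp (-l * t) * ∫ s in (0 : ℝ)..t, c * Real.exp (l * s) ≤ c / l := by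
    intro c t hc ht
    have hd : ∀ s ∈ uIcc 0 t, HasDerivAt (fun s => c / l * Real.exp (l * s))
        (c * Real.exp (l * s)) s := by
      intro s _
      have := (((hasDerivAt_id s).const_mul l).exp).const_mul (c / l)
      refine this.congr_deriv ?_
      simp only [id, mul_one]
      field_simp
    rw [intervalIntegral.integral_eq_sub_of_hasDerivAt hd
      (Continuous.intervalIntegrable (by fun_prop) _ _)]
    have h1 : Real.exp (-l * t) * Real.exp (l * t) = 1 := by
      rw [← Real.exp_add]; simp
    have h2 : Real.exp (-l * t) * (c / l * Real.exp (l * t) - c / l * Real.exp (l * 0))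
        = c / l - c / l * Real.exp (-l * t) := by
      rw [mul_zero, Real.exp_zero]
      linear_combination (c / l) * h1
    rw [h2]
    have : 0 ≤ c / l * Real.exp (-l * t) := by positivity
    linarith
  have hintb : ∀ (g : ℝ → E) (c t : ℝ), 0 ≤ c → 0 ≤ t →
      (∀ s, 0 ≤ s → ‖g s‖ ≤ c * Real.exp (l * s)) →
      ‖Real.exp (-l * t) • ∫ s in (0 : ℝ)..t, g s‖ ≤ c / l := by
    intro g c t hc ht hg
    rw [norm_smul, Real.norm_eq_abs, abs_of_pos (Real.exp_pos _)]
    refine le_trans ?_ (hint c t hc ht)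
    refine mul_le_mul_of_nonneg_left ?_ (Real.exp_pos _).le
    refine intervalIntegral.norm_integral_le_of_norm_le ht ?_
      (Continuous.intervalIntegrable (by fun_prop) _ _)
    exact Eventually.of_forall fun s hs => hg s hs.1.le
  have hFb : ∀ y s, 0 ≤ s → ‖F y s‖ ≤ (C * (1 + ‖y‖)) * Real.exp (l * s) := by
    intro y s hs
    have h1 := hlip s hs (Real.exp (l * s) • y s) 0
    have h2 := hbdd s hs
    have h3 : ‖F y s‖ ≤ C * ‖Real.exp (l * s) • y s‖ + C := by
      simp only [F, max_eq_left hs]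
      calc _ ≤ ‖f s (Real.exp (l * s) • y s) - f s 0‖ + ‖f s 0‖ := norm_le_norm_sub_add _ _
        _ ≤ _ := by rw [sub_zero] at h1; linarith
    rw [norm_smul, Real.norm_eq_abs, abs_of_pos (Real.exp_pos _)] at h3
    have h4 : ‖y s‖ ≤ ‖y‖ := y.norm_coe_le_norm s
    have h5 : 1 ≤ Real.exp (l * s) := Real.one_le_exp (by positivity)
    calc _ ≤ C * (Real.exp (l * s) * ‖y s‖) + C := h3
      _ ≤ C * (Real.exp (l * s) * ‖y‖) + C * Real.exp (l * s) := by
          gcongr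
          nlinarith
      _ = _ := by ring
  let G : (BoundedContinuousFunction ℝ E) → ℝ → E := fun y t =>
    Real.exp (-l * max t 0) • (x₀ + ∫ s in (0 : ℝ)..max t 0, F y s)
  have hGc : ∀ y, Continuous (G y) := by
    intro y
    have h1 : Continuous fun t => ∫ s in (0 : ℝ)..t, F y s :=
      intervalIntegral.continuous_primitive (hFi y) 0
    have h2 : Continuous fun t : ℝ => ∫ s in (0 : ℝ)..max t 0, F y s :=
      h1.comp (by fun_prop : Continuous fun t : ℝ => max t 0)
    fun_prop
  have hGb : ∀ y t, ‖G y t‖ ≤ ‖x₀‖ + C * (1 + ‖y‖) / l := by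
    intro y t
    have ht : 0 ≤ max t 0 := le_max_right _ _
    simp only [G, smul_add]
    refine (norm_add_le _ _).trans (add_le_add ?_ ?_)
    · rw [norm_smul, Real.norm_eq_abs, abs_of_pos (Real.exp_pos _)]
      have : Real.exp (-l * max t 0) ≤ 1 := Real.exp_le_one_iff.2 (by nlinarith)
      nlinarith [norm_nonneg x₀]
    · exact hintb _ _ _ (by positivity) ht (hFb y)
  let Ψ : (BoundedContinuousFunction ℝ E) → (BoundedContinuousFunction ℝ E) := fun y =>
    BoundedContinuousFunction.ofNormedAddCommGroup (G y) (hGc y) _ (hGb y)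
  have hΨ : ContractingWith (Real.toNNReal (C / l)) Ψ := by
    refine ⟨?_, LipschitzWith.of_dist_le_mul fun y y' => ?_⟩
    · rw [← NNReal.coe_lt_coe, Real.coe_toNNReal _ (by positivity), NNReal.coe_one,
        div_lt_one hlpos]
      linarith
    · rw [Real.coe_toNNReal _ (by positivity)]
      refine (BoundedContinuousFunction.dist_le (by positivity)).2 fun t => ?_
      have ht : 0 ≤ max t 0 := le_max_right _ _
      have h1 : Ψ y t - Ψ y' t
          = Real.exp (-l * max t 0) • ∫ s in (0 : ℝ)..max t 0, (F y s - F y' s) := by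
        rw [intervalIntegral.integral_sub (hFi y _ _) (hFi y' _ _)]
        simp only [Ψ, G, BoundedContinuousFunction.coe_ofNormedAddCommGroup, ← smul_sub]
        congr 1
        abel
      rw [dist_eq_norm, h1, dist_eq_norm]
      refine (hintb _ (C * ‖y - y'‖) _ (by positivity) ht fun s hs => ?_).trans (by
        rw [div_mul_eq_mul_div])
      simp only [F, max_eq_left hs]
      refine (hlip s hs _ _).trans ?_
      rw [← smul_sub, norm_smul, Real.norm_eq_abs, abs_of_pos (Real.exp_pos _)]
      have h4 : ‖y s - y' s‖ ≤ ‖y - y'‖ := (y - y').norm_coe_le_norm s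
      calc _ ≤ C * (Real.exp (l * s) * ‖y - y'‖) := by gcongr
        _ = _ := by ring
  obtain ⟨y, hy⟩ : ∃ y, Ψ y = y := ⟨_, hΨ.fixedPoint_isFixedPt⟩
  refine ⟨fun t => x₀ + ∫ s in (0 : ℝ)..t, F y s, by simp, fun t ht => ?_⟩
  have h1 : Real.exp (l * t) • y t = x₀ + ∫ s in (0 : ℝ)..t, F y s := by
    conv_lhs => rw [← hy]
    simp only [Ψ, G, BoundedContinuousFunction.coe_ofNormedAddCommGroup, max_eq_left ht]
    rw [smul_smul, ← Real.exp_add]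
    simp
  have h2 := (((hFc y).integral_hasStrictDerivAt 0 t).hasDerivAt.const_add x₀).hasDerivWithinAt
    (s := Ici 0)
  refine h2.congr_deriv ?_
  simp only [F, max_eq_left ht, ← h1]

/-- The convolution of `g` with a decaying exponential solves `y' = -β y + g`. -/
lemma hasDerivWithinAt_expConv {β : ℝ} {g : ℝ → ℝ} (hg : ContinuousOn g (Ici 0)) {t : ℝ}
    (ht : 0 ≤ t) :
    HasDerivWithinAt (fun t => ∫ τ in (0 : ℝ)..t, Real.exp (-β * (t - τ)) * g τ)
      (-(β * ∫ τ in (0 : ℝ)..t, Real.exp (-β * (t - τ)) * g τ) + g t) (Ici 0) t := by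
  let G : ℝ → ℝ := fun t => ∫ τ in (0 : ℝ)..t, Real.exp (β * τ) * g (max τ 0)
  have hgc : Continuous fun τ : ℝ => g (max τ 0) :=
    hg.comp_continuous (by fun_prop) (fun s => mem_Ici.2 (le_max_right _ _))
  have hG : ∀ t, HasDerivAt G (Real.exp (β * t) * g (max t 0)) t := fun t =>
    (((by fun_prop : Continuous fun τ : ℝ => Real.exp (β * τ)).mul hgc).integral_hasStrictDerivAt
      0 t).hasDerivAt
  have heq : ∀ s, 0 ≤ s → ∫ τ in (0 : ℝ)..s, Real.exp (-β * (s - τ)) * g τ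
      = Real.exp (-β * s) * G s := by
    intro s hs
    rw [← intervalIntegral.integral_const_mul]
    refine intervalIntegral.integral_congr fun τ hτ => ?_
    rw [uIcc_of_le hs] at hτ
    simp only [max_eq_left hτ.1, ← mul_assoc, ← Real.exp_add]
    ring_nf
  have hE : HasDerivAt (fun s => Real.exp (-β * s)) (Real.exp (-β * t) * (-β)) t := by
    simpa using ((hasDerivAt_id t).const_mul (-β)).exp
  have h := (hE.mul (hG t)).hasDerivWithinAt (s := Ici 0)
  refine (h.congr (fun s hs => heq s hs) (heq t ht)).congr_deriv ?_
  rw [heq t ht, max_eq_left ht]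
  have : Real.exp (-β * t) * Real.exp (β * t) = 1 := by rw [← Real.exp_add]; simp
  linear_combination g t * this

end HalfLine

/-- A bound with forcing that decays strictly slower than the homogeneous part. -/
lemma isBigO_exp_of_deriv_le {V V' : ℝ → ℝ} {μ ρ C : ℝ} (hρμ : ρ < μ) (hV : ∀ t, 0 ≤ V t)
    (hC : 0 ≤ C) (hd : ∀ t, 0 ≤ t → HasDerivWithinAt V (V' t) (Ici 0) t)
    (hle : ∀ᶠ t in atTop, V' t ≤ -(2 * μ) * V t + C * Real.exp (-(2 * ρ) * t)) :
    V =O[atTop] fun t => Real.exp (-(2 * ρ) * t) := by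
  obtain ⟨t₁, ht₁⟩ := eventually_atTop.1 (hle.and (eventually_ge_atTop 0))
  have ht0 : 0 ≤ t₁ := (ht₁ t₁ le_rfl).2
  set c := C / (2 * μ - 2 * ρ) with hc
  have hpos : 0 < 2 * μ - 2 * ρ := by linarith
  have hc0 : 0 ≤ c := by positivity
  have hcC : c * (2 * μ - 2 * ρ) = C := div_mul_cancel₀ _ hpos.ne'
  -- `Z` is antitone, which is the integrated form of the differential inequality
  let Z : ℝ → ℝ := fun t => Real.exp (2 * μ * t) * V t - c * Real.exp ((2 * μ - 2 * ρ) * t)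
  have hexp : ∀ (a t : ℝ), HasDerivAt (fun s => Real.exp (a * s)) (Real.exp (a * t) * a) t := by
    intro a t
    simpa using ((hasDerivAt_id t).const_mul a).exp
  have hZ : ∀ t, 0 ≤ t → HasDerivWithinAt Z (Real.exp (2 * μ * t) * (2 * μ) * V t
      + Real.exp (2 * μ * t) * V' t
      - c * (Real.exp ((2 * μ - 2 * ρ) * t) * (2 * μ - 2 * ρ))) (Ici 0) t := fun t ht =>
    ((hexp _ t).hasDerivWithinAt.mul (hd t ht)).sub ((hexp _ t).hasDerivWithinAt.const_mul c)
  have hsub : Ici t₁ ⊆ Ici (0 : ℝ) := Ici_subset_Ici.2 ht0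
  have hanti : AntitoneOn Z (Ici t₁) := by
    have hder : ∀ t ∈ interior (Ici t₁), HasDerivAt Z _ t := fun t ht => by
      rw [interior_Ici] at ht
      exact (hZ t (ht0.trans ht.le)).hasDerivAt (Ici_mem_nhds (ht0.trans_lt ht))
    refine antitoneOn_of_deriv_nonpos (convex_Ici t₁)
      (fun t ht => (hZ t (hsub ht)).continuousWithinAt.mono hsub)
      (fun t ht => (hder t ht).differentiableAt.differentiableWithinAt) fun t ht => ?_
    rw [(hder t ht).deriv]
    rw [interior_Ici] at ht
    have h1 := (ht₁ t ht.le).1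
    have h2 : Real.exp ((2 * μ - 2 * ρ) * t)
        = Real.exp (2 * μ * t) * Real.exp (-(2 * ρ) * t) := by
      rw [← Real.exp_add]; ring_nf
    have h3 := mul_le_mul_of_nonneg_left h1 (Real.exp_pos (2 * μ * t)).le
    rw [h2]
    have h4 : c * (Real.exp (2 * μ * t) * Real.exp (-(2 * ρ) * t) * (2 * μ - 2 * ρ))
        = C * (Real.exp (2 * μ * t) * Real.exp (-(2 * ρ) * t)) := by
      rw [← hcC]; ring
    rw [h4]
    nlinarith
  refine IsBigO.of_bound (|Z t₁| + c) ?_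
  filter_upwards [eventually_ge_atTop t₁] with t ht
  have h1 : Z t ≤ |Z t₁| := (hanti (self_mem_Ici) ht ht).trans (le_abs_self _)
  have h0 : 0 ≤ t := ht0.trans ht
  rw [Real.norm_eq_abs, Real.norm_eq_abs, abs_of_nonneg (hV t), abs_of_pos (Real.exp_pos _)]
  have e1 : Real.exp (-(2 * μ) * t) * Real.exp (2 * μ * t) = 1 := by
    rw [← Real.exp_add]; simp
  have e2 : Real.exp (-(2 * μ) * t) * Real.exp ((2 * μ - 2 * ρ) * t)
      = Real.exp (-(2 * ρ) * t) := by
    rw [← Real.exp_add]; ring_nf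
  have e3 : Real.exp (-(2 * μ) * t) ≤ Real.exp (-(2 * ρ) * t) :=
    Real.exp_le_exp.2 (by nlinarith)
  have h2 := mul_le_mul_of_nonneg_left h1 (Real.exp_pos (-(2 * μ) * t)).le
  have h3 : Real.exp (-(2 * μ) * t) * Z t = V t - c * Real.exp (-(2 * ρ) * t) := by
    simp only [Z, mul_sub]
    rw [← e2]
    linear_combination V t * e1
  rw [h3] at h2
  have h4 := mul_le_mul_of_nonneg_right e3 (abs_nonneg (Z t₁))
  nlinarith

/-! ### Entrywise calculus of matrix signals -/

section EntryDeriv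

variable {l m n : Type*} [Fintype m]

lemma hasDerivWithinAt_mul_entry {A : ℝ → Matrix l m ℝ} {A' : Matrix l m ℝ}
    {B : ℝ → Matrix m n ℝ} {B' : Matrix m n ℝ} {s : Set ℝ} {t : ℝ}
    (hA : ∀ a b, HasDerivWithinAt (fun τ => A τ a b) (A' a b) s t)
    (hB : ∀ a b, HasDerivWithinAt (fun τ => B τ a b) (B' a b) s t) (a : l) (b : n) :
    HasDerivWithinAt (fun τ => (A τ * B τ) a b) ((A' * B t + A t * B') a b) s t := by
  simp only [Matrix.mul_apply, Matrix.add_apply, ← Finset.sum_add_distrib]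
  exact HasDerivWithinAt.fun_sum fun c _ => (hA a c).mul (hB c b)

lemma hasDerivWithinAt_mulVec {A : ℝ → Matrix l m ℝ} [Fintype l] {A' : Matrix l m ℝ}
    {v : ℝ → m → ℝ} {v' : m → ℝ} {s : Set ℝ} {t : ℝ}
    (hA : ∀ a b, HasDerivWithinAt (fun τ => A τ a b) (A' a b) s t)
    (hv : HasDerivWithinAt v v' s t) :
    HasDerivWithinAt (fun τ => A τ *ᵥ v τ) (A' *ᵥ v t + A t *ᵥ v') s t := by
  rw [hasDerivWithinAt_pi] at hv ⊢
  intro a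
  simp only [Matrix.mulVec, dotProduct, Pi.add_apply, ← Finset.sum_add_distrib]
  exact HasDerivWithinAt.fun_sum fun c _ => (hA a c).mul (hv c)

lemma hasDerivWithinAt_const_mulVec [Fintype l] (A : Matrix l m ℝ)
    {v : ℝ → m → ℝ} {v' : m → ℝ} {s : Set ℝ} {t : ℝ} (hv : HasDerivWithinAt v v' s t) :
    HasDerivWithinAt (fun τ => A *ᵥ v τ) (A *ᵥ v') s t := by
  refine (hasDerivWithinAt_mulVec (A := fun _ => A) (A' := 0)
    (fun a b => hasDerivWithinAt_const t s (A a b)) hv).congr_deriv ?_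
  simp

end EntryDeriv

/-! ### Orthogonal projections and coercive quadratic forms -/

lemma dotProduct_self_nonneg {ι : Type*} [Fintype ι] (x : ι → ℝ) : 0 ≤ x ⬝ᵥ x :=
  Finset.sum_nonneg fun _ _ => mul_self_nonneg _

/-- `U` is the matrix of an orthogonal projection of `ℝⁿ`. -/
structure IsOrthProj {n : ℕ} (U : Matrix (Fin n) (Fin n) ℝ) : Prop where
  transpose_eq : Uᵀ = U
  mul_self : U * U = U

section Proj

variable {n : ℕ} {U : Matrix (Fin n) (Fin n) ℝ}

lemma isOrthProj_of_columns {r : ℕ} {M : Matrix (Fin n) (Fin r) ℝ} (hM : Mᵀ * M = 1) :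
    IsOrthProj (M * Mᵀ) := by
  refine ⟨by simp, ?_⟩
  rw [Matrix.mul_assoc, ← Matrix.mul_assoc Mᵀ, hM, Matrix.one_mul]

namespace IsOrthProj

lemma compl (hU : IsOrthProj U) : IsOrthProj (1 - U) :=
  ⟨by simp [hU.transpose_eq], by
    rw [Matrix.sub_mul, Matrix.mul_sub, Matrix.mul_sub, hU.mul_self]; simp⟩

lemma dotProduct_mulVec (hU : IsOrthProj U) (x y : Fin n → ℝ) :
    (U *ᵥ x) ⬝ᵥ y = x ⬝ᵥ (U *ᵥ y) := by
  rw [Matrix.dotProduct_mulVec, ← Matrix.mulVec_transpose, hU.transpose_eq]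

lemma mulVec_mulVec (hU : IsOrthProj U) (x : Fin n → ℝ) : U *ᵥ (U *ᵥ x) = U *ᵥ x := by
  rw [Matrix.mulVec_mulVec, hU.mul_self]

lemma compl_mulVec (hU : IsOrthProj U) (x : Fin n → ℝ) : (1 - U) *ᵥ (U *ᵥ x) = 0 := by
  rw [Matrix.mulVec_mulVec, Matrix.sub_mul, hU.mul_self]; simp

lemma mulVec_compl (hU : IsOrthProj U) (x : Fin n → ℝ) : U *ᵥ ((1 - U) *ᵥ x) = 0 := by
  rw [Matrix.mulVec_mulVec, Matrix.mul_sub, hU.mul_self]; simp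

lemma dotProduct_self (hU : IsOrthProj U) (x : Fin n → ℝ) :
    x ⬝ᵥ (U *ᵥ x) = (U *ᵥ x) ⬝ᵥ (U *ᵥ x) := by
  rw [hU.dotProduct_mulVec, hU.mulVec_mulVec]

lemma pythagoras (hU : IsOrthProj U) (x : Fin n → ℝ) :
    x ⬝ᵥ x = (U *ᵥ x) ⬝ᵥ (U *ᵥ x) + ((1 - U) *ᵥ x) ⬝ᵥ ((1 - U) *ᵥ x) := by
  rw [← hU.dotProduct_self, ← hU.compl.dotProduct_self, ← dotProduct_add, ← Matrix.add_mulVec]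
  simp

lemma quad_nonneg (hU : IsOrthProj U) (x : Fin n → ℝ) : 0 ≤ x ⬝ᵥ (U *ᵥ x) := by
  rw [hU.dotProduct_self]; exact dotProduct_self_nonneg _

lemma quad_le (hU : IsOrthProj U) (x : Fin n → ℝ) : x ⬝ᵥ (U *ᵥ x) ≤ x ⬝ᵥ x := by
  rw [hU.dotProduct_self, hU.pythagoras x]
  have : 0 ≤ ((1 - U) *ᵥ x) ⬝ᵥ ((1 - U) *ᵥ x) := dotProduct_self_nonneg _
  linarith

end IsOrthProj

lemma sq_norm_le_dotProduct_self (x : Fin n → ℝ) : ‖x‖ ^ 2 ≤ x ⬝ᵥ x := by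
  have h : ‖x‖ ≤ Real.sqrt (x ⬝ᵥ x) := by
    refine (pi_norm_le_iff_of_nonneg (Real.sqrt_nonneg _)).2 fun i => ?_
    rw [Real.norm_eq_abs]
    refine Real.abs_le_sqrt ?_
    rw [pow_two]
    exact Finset.single_le_sum (f := fun i => x i * x i) (fun j _ => mul_self_nonneg _)
      (Finset.mem_univ i)
  calc ‖x‖ ^ 2 ≤ Real.sqrt (x ⬝ᵥ x) ^ 2 := by gcongr
    _ = _ := Real.sq_sqrt (dotProduct_self_nonneg x)

lemma abs_dotProduct_le (x y : Fin n → ℝ) : |x ⬝ᵥ y| ≤ n * (‖x‖ * ‖y‖) := by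
  refine (Finset.abs_sum_le_sum_abs _ _).trans ?_
  calc ∑ i, |x i * y i| ≤ ∑ _i : Fin n, ‖x‖ * ‖y‖ := by
        refine Finset.sum_le_sum fun i _ => ?_
        rw [abs_mul]
        exact mul_le_mul (norm_le_pi_norm x i) (norm_le_pi_norm y i) (abs_nonneg _)
          (norm_nonneg _)
    _ = _ := by simp

end Proj

/-- A quadratic form that is positive on a subspace is coercive on it, by compactness of the unit
sphere. -/
lemma exists_coercive {E : Type*} [NormedAddCommGroup E] [NormedSpace ℝ E]
    [FiniteDimensional ℝ E] (f : E → ℝ) (hf : Continuous f)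
    (hom : ∀ (s : ℝ) x, f (s • x) = s ^ 2 * f x) (W : Submodule ℝ E)
    (hpos : ∀ x ∈ W, x ≠ 0 → 0 < f x) : ∃ c > 0, ∀ x ∈ W, c * ‖x‖ ^ 2 ≤ f x := by
  have hf0 : f 0 = 0 := by simpa using hom 0 0
  have hcpt : IsCompact (Metric.sphere (0 : E) 1 ∩ W) :=
    (isCompact_sphere 0 1).inter_right W.closed_of_finiteDimensional
  have hnorm : ∀ x ∈ W, x ≠ 0 → ‖x‖⁻¹ • x ∈ Metric.sphere (0 : E) 1 ∩ W := fun x hx h0 =>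
    ⟨by simp [norm_smul, inv_mul_cancel₀ (norm_ne_zero_iff.2 h0)], W.smul_mem _ hx⟩
  rcases (Metric.sphere (0 : E) 1 ∩ W).eq_empty_or_nonempty with he | hne
  · refine ⟨1, one_pos, fun x hx => ?_⟩
    have : x = 0 := by
      by_contra h0
      have := hnorm x hx h0
      rw [he] at this
      exact this
    simp [this, hf0]
  · obtain ⟨x₀, hx₀, hmin⟩ := hcpt.exists_isMinOn hne hf.continuousOn
    have h0 : x₀ ≠ 0 := by
      rintro rfl
      simpa using hx₀.1
    refine ⟨f x₀, hpos _ hx₀.2 h0, fun x hx => ?_⟩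
    rcases eq_or_ne x 0 with rfl | hx0
    · simp [hf0]
    · have h1 : f x₀ ≤ f (‖x‖⁻¹ • x) := hmin (hnorm x hx hx0)
      rw [hom] at h1
      have h2 : 0 < ‖x‖ := norm_pos_iff.2 hx0
      calc f x₀ * ‖x‖ ^ 2 ≤ (‖x‖⁻¹ ^ 2 * f x) * ‖x‖ ^ 2 := by gcongr
        _ = f x := by field_simp

/-! ### The Laplacian of a strongly connected graph -/

namespace CommGraph

variable {N : ℕ} (G : CommGraph N)

lemma weight_nonneg (i j : Fin N) : 0 ≤ G.a i j := by
  by_cases h : G.edge j i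
  · exact (G.weight_pos i j h).le
  · exact (G.weight_zero i j h).ge

lemma sum_laplacian_smul {M : Type*} [AddCommGroup M] [Module ℝ M] (v : Fin N → M) (i : Fin N) :
    ∑ j, G.laplacian i j • v j = ∑ j, G.a i j • (v i - v j) := by
  have h : ∀ j, G.laplacian i j • v j
      = (if j = i then (∑ k, G.a i k) • v i else 0) - G.a i j • v j := by
    intro j
    simp only [laplacian, Matrix.of_apply]
    rcases eq_or_ne i j with rfl | hij
    · simp [G.no_loop]
    · simp [hij, hij.symm]
  simp only [h, Finset.sum_sub_distrib, smul_sub]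
  simp [Finset.sum_smul]

variable {G}

/-- A strongly connected graph has a positive left null vector of its Laplacian. The absolute value
of any left null vector is again one, and its zeros propagate against the edges. -/
lemma StronglyConnected.exists_left_null (hG : G.StronglyConnected) :
    ∃ ξ : Fin N → ℝ, (∀ i, 0 < ξ i) ∧ (∀ i, ξ i ≤ 1) ∧
      ∀ j, ∑ i, ξ i * G.a i j = ξ j * ∑ k, G.a j k := by
  rcases isEmpty_or_nonempty (Fin N) with hN | hN
  · exact ⟨fun _ => 1, fun i => isEmptyElim i, fun i => isEmptyElim i, fun i => isEmptyElim i⟩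
  have hker : ∃ v, v ≠ 0 ∧ G.laplacian *ᵥ v = 0 := by
    refine ⟨fun _ => 1, ?_, ?_⟩
    · exact fun h => one_ne_zero (congrFun h (Classical.arbitrary _))
    · ext i
      have := G.sum_laplacian_smul (fun _ => (1 : ℝ)) i
      simpa [Matrix.mulVec, dotProduct] using this
  obtain ⟨v, hv0, hv⟩ := Matrix.exists_vecMul_eq_zero_iff.2
    (Matrix.exists_mulVec_eq_zero_iff.1 hker)
  have hvn : ∀ j, ∑ i, v i * G.a i j = v j * ∑ k, G.a j k := by
    intro j
    have h1 := congrFun hv j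
    have h : ∀ i, v i * G.laplacian i j
        = (if i = j then v j * (∑ k, G.a j k) else 0) - v i * G.a i j := by
      intro i
      simp only [laplacian, Matrix.of_apply]
      rcases eq_or_ne i j with rfl | hij
      · simp [G.no_loop]
      · simp [hij]
    simp only [Matrix.vecMul, dotProduct, h, Finset.sum_sub_distrib] at h1
    simp at h1
    linarith
  have hle : ∀ j ∈ Finset.univ, |v j| * ∑ k, G.a j k ≤ ∑ i, |v i| * G.a i j := by
    intro j _
    have hd : 0 ≤ ∑ k, G.a j k := Finset.sum_nonneg fun k _ => G.weight_nonneg j k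
    calc |v j| * ∑ k, G.a j k = |∑ i, v i * G.a i j| := by
          rw [hvn, abs_mul, abs_of_nonneg hd]
      _ ≤ ∑ i, |v i * G.a i j| := Finset.abs_sum_le_sum_abs _ _
      _ = _ := by simp only [abs_mul, abs_of_nonneg (G.weight_nonneg _ _)]
  have hsum : ∑ j, |v j| * ∑ k, G.a j k = ∑ j, ∑ i, |v i| * G.a i j := by
    rw [Finset.sum_comm]
    simp only [Finset.mul_sum]
  have heq : ∀ j, |v j| * ∑ k, G.a j k = ∑ i, |v i| * G.a i j := fun j =>
    (Finset.sum_eq_sum_iff_of_le hle).1 hsum j (Finset.mem_univ j)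
  have hstep : ∀ i j, G.edge i j → v i = 0 → v j = 0 := by
    intro i j hij hi
    have h1 := heq i
    rw [hi, abs_zero, zero_mul] at h1
    have h2 := (Finset.sum_eq_zero_iff_of_nonneg fun k _ =>
      mul_nonneg (abs_nonneg (v k)) (G.weight_nonneg k i)).1 h1.symm j (Finset.mem_univ j)
    rcases mul_eq_zero.1 h2 with h3 | h3
    · exact abs_eq_zero.1 h3
    · exact absurd h3 (G.weight_pos j i hij).ne'
  have hne : ∀ i, v i ≠ 0 := by
    intro i hi
    refine hv0 (funext fun j => ?_)
    rcases eq_or_ne i j with rfl | hij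
    · exact hi
    · have h := hG i j hij
      induction h with
      | single h => exact hstep _ _ h hi
      | @tail b c hb h ih =>
        by_cases hib : i = b
        · exact hstep _ _ h (hib ▸ hi)
        · exact hstep _ _ h (ih hib)
  have hpos : ∀ i, 0 < |v i| := fun i => abs_pos.2 (hne i)
  have hs : 0 < ∑ i, |v i| := Finset.sum_pos (fun i _ => hpos i) Finset.univ_nonempty
  refine ⟨fun i => |v i| / ∑ i, |v i|, fun i => div_pos (hpos i) hs, fun i => ?_, fun j => ?_⟩
  · rw [div_le_one hs]
    exact Finset.single_le_sum (f := fun i => |v i|) (fun j _ => abs_nonneg _) (Finset.mem_univ i)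
  · simp only [div_mul_eq_mul_div, ← Finset.sum_div]
    rw [heq]

/-- The weighted disagreement identity. -/
lemma weighted_laplacian_quad {n : ℕ} {ξ : Fin N → ℝ}
    (hξ : ∀ j, ∑ i, ξ i * G.a i j = ξ j * ∑ k, G.a j k) (y : Fin N → Fin n → ℝ) :
    ∑ i, ξ i * (y i ⬝ᵥ ∑ j, G.laplacian i j • y j)
      = 1 / 2 * ∑ i, ∑ j, ξ i * G.a i j * ((y i - y j) ⬝ᵥ (y i - y j)) := by
  have h1 : ∑ i, ∑ j, ξ i * G.a i j * (y j ⬝ᵥ y j) = ∑ i, ∑ j, ξ i * G.a i j * (y i ⬝ᵥ y i) := by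
    rw [Finset.sum_comm]
    refine Finset.sum_congr rfl fun j _ => ?_
    rw [← Finset.sum_mul, hξ, Finset.mul_sum, Finset.sum_mul]
  have h2 : ∀ i j, ξ i * G.a i j * ((y i - y j) ⬝ᵥ (y i - y j))
      = 2 * (ξ i * (G.a i j * (y i ⬝ᵥ (y i - y j)))) + (ξ i * G.a i j * (y j ⬝ᵥ y j)
        - ξ i * G.a i j * (y i ⬝ᵥ y i)) := by
    intro i j
    simp only [dotProduct_sub, sub_dotProduct, dotProduct_comm (y j) (y i)]
    ring
  simp only [h2, Finset.sum_add_distrib, Finset.sum_sub_distrib, h1, sub_self, add_zero,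
    G.sum_laplacian_smul, dotProduct_sum, dotProduct_smul, smul_eq_mul, Finset.mul_sum]
  refine Finset.sum_congr rfl fun i _ => Finset.sum_congr rfl fun j _ => ?_
  ring

/-- Disagreement dominates the states that stay in the ranges of the projections `U i`, as soon as
these ranges have no common nonzero vector. -/
lemma StronglyConnected.exists_laplacian_coercive (hG : G.StronglyConnected) {n : ℕ}
    {U : Fin N → Matrix (Fin n) (Fin n) ℝ} (hU : ∀ x, (∀ i, U i *ᵥ x = x) → x = 0) :
    ∃ k > 0, ∃ ξ : Fin N → ℝ, (∀ i, 0 < ξ i) ∧ ∀ y : Fin N → Fin n → ℝ,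
      (∀ i, U i *ᵥ y i = y i) →
        k * ∑ i, ξ i * (y i ⬝ᵥ y i) ≤ ∑ i, ξ i * (y i ⬝ᵥ ∑ j, G.laplacian i j • y j) := by
  obtain ⟨ξ, hξ, hξ1, hnull⟩ := hG.exists_left_null
  let W : Submodule ℝ (Fin N → Fin n → ℝ) :=
    { carrier := {y | ∀ i, U i *ᵥ y i = y i}
      add_mem' := fun {x y} hx hy i => by simp [Matrix.mulVec_add, hx i, hy i]
      zero_mem' := fun i => by simp
      smul_mem' := fun c x hx i => by simp [Matrix.mulVec_smul, hx i] }
  obtain ⟨c, hc, hcW⟩ := exists_coercive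
    (fun y : Fin N → Fin n → ℝ => ∑ i, ξ i * (y i ⬝ᵥ ∑ j, G.laplacian i j • y j))
    (by simp only [dotProduct]; fun_prop)
    (fun s x => by
      simp only [Pi.smul_apply, smul_comm _ s, ← Finset.smul_sum, smul_dotProduct,
        dotProduct_smul, smul_eq_mul, Finset.mul_sum]
      exact Finset.sum_congr rfl fun i _ => by ring)
    W (fun y hy h0 => by
      rw [weighted_laplacian_quad hnull]
      have hnn : ∀ i j, 0 ≤ ξ i * G.a i j * ((y i - y j) ⬝ᵥ (y i - y j)) := fun i j =>
        mul_nonneg (mul_nonneg (hξ i).le (G.weight_nonneg i j)) (dotProduct_self_nonneg _)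
      have hge : 0 ≤ ∑ i, ∑ j, ξ i * G.a i j * ((y i - y j) ⬝ᵥ (y i - y j)) :=
        Finset.sum_nonneg fun i _ => Finset.sum_nonneg fun j _ => hnn i j
      refine (mul_pos one_half_pos (lt_of_le_of_ne hge fun hz => h0 ?_))
      have h1 : ∀ i j, ξ i * G.a i j * ((y i - y j) ⬝ᵥ (y i - y j)) = 0 := fun i j =>
        (Finset.sum_eq_zero_iff_of_nonneg fun j _ => hnn i j).1
          ((Finset.sum_eq_zero_iff_of_nonneg fun i _ => Finset.sum_nonneg fun j _ => hnn i j).1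
            hz.symm i (Finset.mem_univ i)) j (Finset.mem_univ j)
      have hedge : ∀ i j, G.edge i j → y i = y j := by
        intro i j hij
        rcases mul_eq_zero.1 (h1 j i) with h2 | h2
        · exact absurd h2 (mul_pos (hξ j) (G.weight_pos j i hij)).ne'
        · exact (sub_eq_zero.1 (dotProduct_self_eq_zero.1 h2)).symm
      have hall : ∀ i j, y i = y j := by
        intro i j
        rcases eq_or_ne i j with rfl | hij
        · rfl
        · have h := hG i j hij
          clear hij
          induction h with
          | single h => exact hedge _ _ h
          | tail _ h ih => exact ih.trans (hedge _ _ h)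
      exact funext fun i => hU (y i) fun j => by
        have := hy j
        rwa [hall j i] at this)
  refine ⟨c / (N * n + 1), by positivity, ξ, hξ, fun y hy => le_trans ?_ (hcW y hy)⟩
  have h1 : ∀ i, ξ i * (y i ⬝ᵥ y i) ≤ n * ‖y‖ ^ 2 := by
    intro i
    have h2 := (le_abs_self _).trans (abs_dotProduct_le (y i) (y i))
    have h3 : ‖y i‖ * ‖y i‖ ≤ ‖y‖ ^ 2 := by
      rw [pow_two]
      exact mul_self_le_mul_self (norm_nonneg _) (norm_le_pi_norm y i)
    have h4 : (0 : ℝ) ≤ y i ⬝ᵥ y i := dotProduct_self_nonneg _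
    calc ξ i * (y i ⬝ᵥ y i) ≤ 1 * (y i ⬝ᵥ y i) := by gcongr; exact hξ1 i
      _ ≤ n * (‖y i‖ * ‖y i‖) := by rw [one_mul]; exact h2
      _ ≤ _ := by gcongr
  have h5 : ∑ i, ξ i * (y i ⬝ᵥ y i) ≤ N * (n * ‖y‖ ^ 2) := by
    refine (Finset.sum_le_sum fun i _ => h1 i).trans ?_
    simp
  calc c / (N * n + 1) * ∑ i, ξ i * (y i ⬝ᵥ y i)
      ≤ c / (N * n + 1) * ((N * n + 1) * ‖y‖ ^ 2) := by
        gcongr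
        nlinarith [sq_nonneg ‖y‖]
    _ = c * ‖y‖ ^ 2 := by field_simp

end CommGraph

-- Vectors carry the sup norm, and square matrices the corresponding operator norm.
attribute [local instance] Matrix.linftyOpNormedRing Matrix.linftyOpNormedAlgebra

/-! ### Exponential stability of the consensus dynamics -/

lemma norm_mulVec_le {n : ℕ} (A : Matrix (Fin n) (Fin n) ℝ) (v : Fin n → ℝ) :
    ‖A *ᵥ v‖ ≤ ‖A‖ * ‖v‖ := Matrix.linfty_opNorm_mulVec A v

lemma exists_gt_forall_lt {N : ℕ} {ρ : ℝ} {f : Fin N → ℝ} (h : ∀ i, ρ < f i) :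
    ∃ μ > ρ, ∀ i, μ < f i := by
  have h1 : ∀ᶠ μ in 𝓝[>] ρ, ∀ i, μ < f i :=
    eventually_all.2 fun i => nhdsWithin_le_nhds (eventually_lt_nhds (h i))
  obtain ⟨μ, hμ, hμ'⟩ := (h1.and self_mem_nhdsWithin).exists
  exact ⟨μ, hμ', hμ⟩

lemma hasDerivWithinAt_dotProduct_self {n : ℕ} {w : ℝ → Fin n → ℝ} {w' : Fin n → ℝ} {s : Set ℝ}
    {t : ℝ} (hw : HasDerivWithinAt w w' s t) :
    HasDerivWithinAt (fun τ => w τ ⬝ᵥ w τ) (2 * (w t ⬝ᵥ w')) s t := by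
  rw [hasDerivWithinAt_pi] at hw
  simp only [dotProduct, Finset.mul_sum]
  refine HasDerivWithinAt.fun_sum fun c _ => ((hw c).mul (hw c)).congr_deriv ?_
  ring

section Lyapunov

variable {N n : ℕ} {G : CommGraph N} {U : Fin N → Matrix (Fin n) (Fin n) ℝ}

/-- Consensus dynamics with gains `η` on the ranges of the projections `U i`, damped with factors `d`
on their complements, decay at every rate below `d i` and `k * η i`. A forcing `r₁` that decays at
that rate and a perturbation `r₂` of smaller order than the state do no harm. -/
def HasConsensusRate (G : CommGraph N) (U : Fin N → Matrix (Fin n) (Fin n) ℝ) (k : ℝ) : Prop :=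
  ∀ (η d : Fin N → ℝ) (ρ : ℝ), (∀ i, 0 < η i) → (∀ i, ρ < k * η i) → (∀ i, ρ < d i) →
    ∀ x r₁ r₂ : ℝ → Fin N → Fin n → ℝ,
      (∀ i t, 0 ≤ t → HasDerivWithinAt (fun s => x s i)
        (-(d i • ((1 - U i) *ᵥ x t i))
          - η i • (U i *ᵥ ∑ j, G.laplacian i j • (U j *ᵥ x t j)) + (r₁ t i + r₂ t i))
        (Ici 0) t) →
      (r₁ =O[atTop] fun t => Real.exp (-ρ * t)) → (r₂ =o[atTop] x) →
      x =O[atTop] fun t => Real.exp (-ρ * t)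

/-- The Lyapunov function weighs the range components by `ξ i / η i`, where `ξ` is the positive left
null vector of the Laplacian, so that the gains cancel in its derivative; this makes the rate
proportional to the gains. -/
theorem CommGraph.StronglyConnected.exists_hasConsensusRate (hG : G.StronglyConnected)
    (hUp : ∀ i, IsOrthProj (U i)) (hU : ∀ x, (∀ i, U i *ᵥ x = x) → x = 0) :
    ∃ k > 0, HasConsensusRate G U k := by
  obtain ⟨k, hk, ξ, hξ, hcoer⟩ := hG.exists_laplacian_coercive hU
  refine ⟨k, hk, fun η d ρ hη hρη hρd x r₁ r₂ hx hr₁ hr₂ => ?_⟩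
  obtain ⟨μ', hρμ', hμ'⟩ := exists_gt_forall_lt (f := fun i => min (k * η i) (d i))
    (fun i => lt_min (hρη i) (hρd i))
  set c : Fin N → ℝ := fun i => ξ i / η i with hcdef
  have hc : ∀ i, 0 < c i := fun i => div_pos (hξ i) (hη i)
  obtain ⟨m, hm, hmc⟩ := exists_gt_forall_lt (f := fun i => min (c i) 1)
    (fun i => lt_min (hc i) one_pos)
  let w : ℝ → Fin N → Fin n → ℝ := fun t i => (1 - U i) *ᵥ x t i
  let y : ℝ → Fin N → Fin n → ℝ := fun t i => U i *ᵥ x t i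
  let V : ℝ → ℝ := fun t => ∑ i, (w t i ⬝ᵥ w t i + c i * (y t i ⬝ᵥ y t i))
  have hVx : ∀ t, m * ‖x t‖ ^ 2 ≤ V t := by
    intro t
    have h1 : ∀ i, m * (x t i ⬝ᵥ x t i) ≤ w t i ⬝ᵥ w t i + c i * (y t i ⬝ᵥ y t i) := by
      intro i
      rw [(hUp i).pythagoras (x t i)]
      have h2 := lt_min_iff.1 (hmc i)
      have h3 : 0 ≤ w t i ⬝ᵥ w t i := dotProduct_self_nonneg _
      have h4 : 0 ≤ y t i ⬝ᵥ y t i := dotProduct_self_nonneg _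
      change m * (y t i ⬝ᵥ y t i + w t i ⬝ᵥ w t i) ≤ _
      nlinarith [h2.1, h2.2]
    have h0 : 0 ≤ V t / m := div_nonneg (Finset.sum_nonneg fun i _ =>
      (mul_nonneg hm.le (dotProduct_self_nonneg _)).trans (h1 i)) hm.le
    have h5 : ‖x t‖ ≤ Real.sqrt (V t / m) := by
      refine (pi_norm_le_iff_of_nonneg (Real.sqrt_nonneg _)).2 fun i => ?_
      refine Real.le_sqrt_of_sq_le ?_
      rw [le_div_iff₀ hm, mul_comm]
      calc m * ‖x t i‖ ^ 2 ≤ m * (x t i ⬝ᵥ x t i) := by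
            gcongr; exact sq_norm_le_dotProduct_self _
        _ ≤ _ := h1 i
        _ ≤ V t := Finset.single_le_sum (f := fun i => w t i ⬝ᵥ w t i + c i * (y t i ⬝ᵥ y t i))
            (fun j _ => (mul_nonneg hm.le (dotProduct_self_nonneg _)).trans (h1 j))
            (Finset.mem_univ i)
    have h6 : ‖x t‖ ^ 2 ≤ V t / m := by
      calc _ ≤ Real.sqrt (V t / m) ^ 2 := by gcongr
        _ = _ := Real.sq_sqrt h0
    rw [le_div_iff₀ hm] at h6
    linarith
  have hV0 : ∀ t, 0 ≤ V t := fun t => (by positivity : 0 ≤ m * ‖x t‖ ^ 2).trans (hVx t)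
  let r : ℝ → Fin N → Fin n → ℝ := fun t i => r₁ t i + r₂ t i
  let V' : ℝ → ℝ := fun t => ∑ i, (2 * (w t i ⬝ᵥ (-(d i • w t i) + (1 - U i) *ᵥ r t i))
    + c i * (2 * (y t i ⬝ᵥ (-(η i • (U i *ᵥ ∑ j, G.laplacian i j • y t j)) + U i *ᵥ r t i))))
  have hVd : ∀ t, 0 ≤ t → HasDerivWithinAt V (V' t) (Ici 0) t := by
    intro t ht
    refine HasDerivWithinAt.fun_sum fun i _ => ?_
    have hw := hasDerivWithinAt_const_mulVec (1 - U i) (hx i t ht)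
    have hy := hasDerivWithinAt_const_mulVec (U i) (hx i t ht)
    rw [Matrix.mulVec_add, Matrix.mulVec_sub, Matrix.mulVec_neg, Matrix.mulVec_smul,
      Matrix.mulVec_smul, (hUp i).compl.mulVec_mulVec, (hUp i).compl_mulVec, smul_zero,
      sub_zero] at hw
    rw [Matrix.mulVec_add, Matrix.mulVec_sub, Matrix.mulVec_neg, Matrix.mulVec_smul,
      Matrix.mulVec_smul, (hUp i).mulVec_compl, (hUp i).mulVec_mulVec, smul_zero, neg_zero,
      zero_sub] at hy
    exact (hasDerivWithinAt_dotProduct_self hw).add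
      ((hasDerivWithinAt_dotProduct_self hy).const_mul (c i))
  set B : ℝ := ∑ i, 2 * n * (‖1 - U i‖ * ‖1 - U i‖ + c i * (‖U i‖ * ‖U i‖)) with hB
  have hB0 : 0 ≤ B := Finset.sum_nonneg fun i _ => by have := hc i; positivity
  have hV'le : ∀ t, V' t ≤ -(2 * μ') * V t + B * (‖x t‖ * ‖r t‖) := by
    intro t
    have hyy : ∀ i, U i *ᵥ y t i = y t i := fun i => (hUp i).mulVec_mulVec _
    have h1 : V' t = -2 * ∑ i, d i * (w t i ⬝ᵥ w t i)
        - 2 * ∑ i, ξ i * (y t i ⬝ᵥ ∑ j, G.laplacian i j • y t j)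
        + ∑ i, (2 * (w t i ⬝ᵥ ((1 - U i) *ᵥ r t i)) + c i * (2 * (y t i ⬝ᵥ (U i *ᵥ r t i)))) := by
      rw [Finset.mul_sum, Finset.mul_sum, ← Finset.sum_sub_distrib, ← Finset.sum_add_distrib]
      refine Finset.sum_congr rfl fun i _ => ?_
      have h2 : c i * η i = ξ i := div_mul_cancel₀ _ (hη i).ne'
      rw [dotProduct_add, dotProduct_add, dotProduct_neg, dotProduct_neg, dotProduct_smul,
        dotProduct_smul, ← (hUp i).dotProduct_mulVec (y t i) (∑ j, _), hyy, ← h2, smul_eq_mul,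
        smul_eq_mul]
      ring
    have h2 := hcoer (y t) hyy
    have h3 : μ' * V t ≤ ∑ i, d i * (w t i ⬝ᵥ w t i) + k * ∑ i, ξ i * (y t i ⬝ᵥ y t i) := by
      rw [Finset.mul_sum, Finset.mul_sum, ← Finset.sum_add_distrib]
      refine Finset.sum_le_sum fun i _ => ?_
      have h4 := lt_min_iff.1 (hμ' i)
      have h5 : 0 ≤ w t i ⬝ᵥ w t i := dotProduct_self_nonneg _
      have h6 : 0 ≤ y t i ⬝ᵥ y t i := dotProduct_self_nonneg _
      have h7 : c i * η i = ξ i := div_mul_cancel₀ _ (hη i).ne'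
      have h8 : μ' * c i ≤ k * ξ i := by
        rw [← h7]; nlinarith [hc i, h4.1]
      nlinarith [h4.2]
    have hbd : ∀ (A : Matrix (Fin n) (Fin n) ℝ) i,
        (A *ᵥ x t i) ⬝ᵥ (A *ᵥ r t i) ≤ n * (‖A‖ * ‖A‖) * (‖x t‖ * ‖r t‖) := by
      intro A i
      refine (le_abs_self _).trans ((abs_dotProduct_le _ _).trans ?_)
      have e1 : ‖A *ᵥ x t i‖ ≤ ‖A‖ * ‖x t‖ := (norm_mulVec_le _ _).trans (by
        gcongr; exact norm_le_pi_norm _ i)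
      have e2 : ‖A *ᵥ r t i‖ ≤ ‖A‖ * ‖r t‖ := (norm_mulVec_le _ _).trans (by
        gcongr; exact norm_le_pi_norm _ i)
      calc _ ≤ (n : ℝ) * ((‖A‖ * ‖x t‖) * (‖A‖ * ‖r t‖)) := by gcongr
        _ = _ := by ring
    have h9 : ∑ i, (2 * (w t i ⬝ᵥ ((1 - U i) *ᵥ r t i)) + c i * (2 * (y t i ⬝ᵥ (U i *ᵥ r t i))))
        ≤ B * (‖x t‖ * ‖r t‖) := by
      rw [hB, Finset.sum_mul]
      refine Finset.sum_le_sum fun i _ => ?_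
      have e1 := hbd (1 - U i) i
      have e2 := mul_le_mul_of_nonneg_left (hbd (U i) i) (hc i).le
      simp only [w, y]
      linarith
    rw [h1]
    linarith
  obtain ⟨C₁, hC₁, hr₁b⟩ := hr₁.exists_pos
  set δ := (μ' - ρ) / 2 with hδ
  have hδ0 : 0 < δ := by rw [hδ]; linarith [hρμ']
  have hr₂b := hr₂.def (show 0 < δ * m / (B + 1) by positivity)
  have hmain : V =O[atTop] fun t => Real.exp (-(2 * ρ) * t) := by
    refine isBigO_exp_of_deriv_le (μ := ρ + δ) (C := (B * C₁) ^ 2 / (4 * (δ * m)))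
      (by linarith) hV0 (by positivity) hVd ?_
    filter_upwards [hr₁b.bound, hr₂b] with t h1 h2
    have hrt : ‖r t‖ ≤ C₁ * Real.exp (-ρ * t) + δ * m / (B + 1) * ‖x t‖ := by
      rw [Real.norm_eq_abs, abs_of_pos (Real.exp_pos _)] at h1
      exact (norm_add_le (r₁ t) (r₂ t)).trans (add_le_add h1 h2)
    have he : Real.exp (-(2 * ρ) * t) = Real.exp (-ρ * t) ^ 2 := by
      rw [← Real.exp_nat_mul]; congr 1; push_cast; ring
    set e := Real.exp (-ρ * t)
    have h3 : B * (‖x t‖ * ‖r t‖) ≤ B * C₁ * e * ‖x t‖ + δ * m * ‖x t‖ ^ 2 := by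
      have h4 : B * (δ * m / (B + 1)) ≤ δ * m := by
        rw [mul_div_assoc', div_le_iff₀ (by positivity)]
        nlinarith [mul_pos hδ0 hm]
      calc B * (‖x t‖ * ‖r t‖)
          ≤ B * (‖x t‖ * (C₁ * e + δ * m / (B + 1) * ‖x t‖)) := by gcongr
        _ = B * C₁ * e * ‖x t‖ + (B * (δ * m / (B + 1))) * ‖x t‖ ^ 2 := by ring
        _ ≤ _ := by gcongr
    -- absorb the cross term by completing the square
    have h5 : B * C₁ * e * ‖x t‖ ≤ δ * m * ‖x t‖ ^ 2 + (B * C₁) ^ 2 / (4 * (δ * m)) * e ^ 2 := by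
      have h6 : 0 < 4 * (δ * m) := by positivity
      have h7 : 0 ≤ (2 * (δ * m) * ‖x t‖ - B * C₁ * e) ^ 2 / (4 * (δ * m)) := by positivity
      have h8 : (2 * (δ * m) * ‖x t‖ - B * C₁ * e) ^ 2 / (4 * (δ * m))
          = δ * m * ‖x t‖ ^ 2 - B * C₁ * e * ‖x t‖ + (B * C₁) ^ 2 / (4 * (δ * m)) * e ^ 2 := by
        field_simp
        ring
      linarith
    have h9 := hV'le t
    have h10 := hVx t
    have h11 : μ' = ρ + 2 * δ := by rw [hδ]; ring
    rw [he]
    rw [h11] at h9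
    nlinarith
  obtain ⟨C₂, hC₂, hVb⟩ := hmain.exists_pos
  refine IsBigO.of_bound (Real.sqrt (C₂ / m)) ?_
  filter_upwards [hVb.bound] with t ht
  rw [Real.norm_eq_abs, Real.norm_eq_abs, abs_of_nonneg (hV0 t), abs_of_pos (Real.exp_pos _)] at ht
  have he : Real.exp (-(2 * ρ) * t) = Real.exp (-ρ * t) ^ 2 := by
    rw [← Real.exp_nat_mul]; congr 1; push_cast; ring
  rw [he] at ht
  rw [Real.norm_eq_abs, abs_of_pos (Real.exp_pos _)]
  refine (pow_le_pow_iff_left₀ (norm_nonneg _) (by positivity) two_ne_zero).1 ?_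
  rw [mul_pow, Real.sq_sqrt (by positivity), div_mul_eq_mul_div, le_div_iff₀ hm]
  linarith [hVx t]

end Lyapunov

/-! ### Weighted Gram matrices and excitation -/

lemma integral_exp_conv {β : ℝ} (hβ : 0 < β) (t : ℝ) :
    ∫ τ in (0 : ℝ)..t, Real.exp (-β * (t - τ)) = (1 - Real.exp (-β * t)) / β := by
  have hd : ∀ s ∈ uIcc 0 t, HasDerivAt (fun s => Real.exp (-β * (t - s)) / β)
      (Real.exp (-β * (t - s))) s := by
    intro s _
    have := ((((hasDerivAt_id s).const_sub t).const_mul (-β)).exp).div_const β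
    refine this.congr_deriv ?_
    simp only [id]
    field_simp
  rw [intervalIntegral.integral_eq_sub_of_hasDerivAt hd
    (Continuous.intervalIntegrable (by fun_prop) _ _)]
  simp
  ring

lemma abs_integral_exp_conv_le {β C t : ℝ} (hβ : 0 < β) (ht : 0 ≤ t) {g : ℝ → ℝ}
    (hg : ∀ τ, 0 ≤ τ → |g τ| ≤ C) :
    |∫ τ in (0 : ℝ)..t, Real.exp (-β * (t - τ)) * g τ| ≤ C / β := by
  have hC : 0 ≤ C := (abs_nonneg _).trans (hg 0 le_rfl)
  have h1 : ‖∫ τ in (0 : ℝ)..t, Real.exp (-β * (t - τ)) * g τ‖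
      ≤ ∫ τ in (0 : ℝ)..t, Real.exp (-β * (t - τ)) * C := by
    refine intervalIntegral.norm_integral_le_of_norm_le ht ?_
      (Continuous.intervalIntegrable (by fun_prop) _ _)
    refine Eventually.of_forall fun τ hτ => ?_
    rw [norm_mul, Real.norm_eq_abs, Real.norm_eq_abs, abs_of_pos (Real.exp_pos _)]
    gcongr
    exact hg τ hτ.1.le
  rw [intervalIntegral.integral_mul_const, integral_exp_conv hβ] at h1
  refine h1.trans ?_
  rw [div_mul_eq_mul_div]
  gcongr
  nlinarith [Real.exp_pos (-β * t)]

variable {n : ℕ}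

/-- The Gram matrix of the regressor with exponential forgetting. -/
noncomputable def forgetGram (β : ℝ) (φ : ℝ → Fin n → ℝ) (t : ℝ) : Matrix (Fin n) (Fin n) ℝ :=
  Matrix.of fun a b => ∫ τ in (0 : ℝ)..t, Real.exp (-β * (t - τ)) * (φ τ a * φ τ b)

/-- The correlation of measurement and regressor with exponential forgetting, plus the contribution
`α e^{-βt} θ0` of the prior. -/
noncomputable def forgetCorr (β α : ℝ) (θ0 : Fin n → ℝ) (φ : ℝ → Fin n → ℝ) (z : ℝ → ℝ)
    (t : ℝ) : Fin n → ℝ :=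
  fun a => (∫ τ in (0 : ℝ)..t, Real.exp (-β * (t - τ)) * (z τ * φ τ a))
    + α * Real.exp (-β * t) * θ0 a

/-- The regressor is persistently excited on the range of `1 - U` over windows of length `T`, and it
is orthogonal to the range of the orthogonal projection `U`. -/
structure IsExcitedOff (φ : ℝ → Fin n → ℝ) (U : Matrix (Fin n) (Fin n) ℝ) (T : ℝ) : Prop where
  proj : IsOrthProj U
  window_pos : 0 < T
  annihilates : ∀ t, 0 ≤ t → U *ᵥ φ t = 0
  lower : ∃ c > 0, ∀ t, 0 ≤ t → ∀ x,
    c * (((1 - U) *ᵥ x) ⬝ᵥ ((1 - U) *ᵥ x)) ≤ x ⬝ᵥ (windowGram φ t T *ᵥ x)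

section Gram

variable {φ : ℝ → Fin n → ℝ}

lemma dotProduct_integral_mulVec {A : ℝ → Matrix (Fin n) (Fin n) ℝ} {s t : ℝ}
    (hA : ∀ a b, IntervalIntegrable (fun τ => A τ a b) MeasureTheory.volume s t)
    (x y : Fin n → ℝ) :
    x ⬝ᵥ ((Matrix.of fun a b => ∫ τ in s..t, A τ a b) *ᵥ y)
      = ∫ τ in s..t, x ⬝ᵥ (A τ *ᵥ y) := by
  have hi : ∀ a b, IntervalIntegrable (fun τ => x a * (A τ a b * y b))
      MeasureTheory.volume s t := fun a b => ((hA a b).mul_const (y b)).const_mul (x a)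
  have hi' : ∀ a, IntervalIntegrable (fun τ => ∑ b, x a * (A τ a b * y b))
      MeasureTheory.volume s t := fun a => by
    simpa only [Finset.sum_fn] using IntervalIntegrable.sum Finset.univ fun b _ => hi a b
  simp only [dotProduct, Matrix.mulVec, Matrix.of_apply, Finset.mul_sum]
  rw [intervalIntegral.integral_finsetSum fun a _ => hi' a]
  refine Finset.sum_congr rfl fun a _ => ?_
  rw [intervalIntegral.integral_finsetSum fun b _ => hi a b]
  refine Finset.sum_congr rfl fun b _ => ?_
  rw [intervalIntegral.integral_const_mul, intervalIntegral.integral_mul_const]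

lemma dotProduct_weightedGram (hφ : ContinuousOn φ (Ici 0)) {w : ℝ → ℝ} (hw : Continuous w)
    {s t : ℝ} (hs : 0 ≤ s) (ht : 0 ≤ t) (x y : Fin n → ℝ) :
    x ⬝ᵥ ((Matrix.of fun a b => ∫ τ in s..t, w τ * (φ τ a * φ τ b)) *ᵥ y)
      = ∫ τ in s..t, w τ * ((φ τ ⬝ᵥ x) * (φ τ ⬝ᵥ y)) := by
  have hsub : uIcc s t ⊆ Ici 0 := fun u hu => (le_min hs ht).trans hu.1
  have hφa : ∀ a, ContinuousOn (fun τ => φ τ a) (uIcc s t) := fun a =>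
    (continuousOn_pi.1 hφ a).mono hsub
  have h1 := dotProduct_integral_mulVec
    (A := fun τ => w τ • vecMulVec (φ τ) (φ τ)) (s := s) (t := t)
    (fun a b => (hw.continuousOn.mul ((hφa a).mul (hφa b))).intervalIntegrable) x y
  refine h1.trans (intervalIntegral.integral_congr fun τ _ => ?_)
  simp only [Matrix.smul_mulVec, dotProduct_smul, smul_eq_mul, Matrix.vecMulVec_mulVec,
    op_smul_eq_smul, dotProduct_comm x (φ τ)]
  ring

lemma continuousOn_dotProduct_const {s : Set ℝ} (hφ : ContinuousOn φ s) (x : Fin n → ℝ) :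
    ContinuousOn (fun τ => φ τ ⬝ᵥ x) s := by
  simp only [dotProduct]
  exact continuousOn_finsetSum _ fun a _ => (continuousOn_pi.1 hφ a).mul continuousOn_const

lemma dotProduct_windowGram (hφ : ContinuousOn φ (Ici 0)) {t T : ℝ} (ht : 0 ≤ t) (hT : 0 ≤ T)
    (x : Fin n → ℝ) :
    x ⬝ᵥ (windowGram φ t T *ᵥ x) = ∫ τ in t..(t + T), (φ τ ⬝ᵥ x) ^ 2 := by
  have := dotProduct_weightedGram hφ (w := fun _ => 1) continuous_const ht (add_nonneg ht hT) x x
  simp only [one_mul] at this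
  simp only [pow_two]
  exact this

lemma dotProduct_forgetGram (hφ : ContinuousOn φ (Ici 0)) {β t : ℝ} (ht : 0 ≤ t)
    (x y : Fin n → ℝ) :
    x ⬝ᵥ (forgetGram β φ t *ᵥ y)
      = ∫ τ in (0 : ℝ)..t, Real.exp (-β * (t - τ)) * ((φ τ ⬝ᵥ x) * (φ τ ⬝ᵥ y)) :=
  dotProduct_weightedGram hφ (by fun_prop) le_rfl ht x y

lemma forgetGram_transpose (β : ℝ) (φ : ℝ → Fin n → ℝ) (t : ℝ) :
    (forgetGram β φ t)ᵀ = forgetGram β φ t := by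
  ext a b
  simp only [forgetGram, Matrix.transpose_apply, Matrix.of_apply, mul_comm (φ _ b)]

lemma forgetGram_quad_nonneg (hφ : ContinuousOn φ (Ici 0)) {β t : ℝ} (ht : 0 ≤ t)
    (x : Fin n → ℝ) : 0 ≤ x ⬝ᵥ (forgetGram β φ t *ᵥ x) := by
  rw [dotProduct_forgetGram hφ ht]
  exact intervalIntegral.integral_nonneg ht fun τ _ =>
    mul_nonneg (Real.exp_pos _).le (mul_self_nonneg _)

/-- The forgetting Gram matrix dominates the last window, discounted. -/
lemma windowGram_le_forgetGram (hφ : ContinuousOn φ (Ici 0)) {β t T : ℝ} (hβ : 0 < β)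
    (hT : 0 < T) (ht : T ≤ t) (x : Fin n → ℝ) :
    Real.exp (-β * T) * (x ⬝ᵥ (windowGram φ (t - T) T *ᵥ x)) ≤ x ⬝ᵥ (forgetGram β φ t *ᵥ x) := by
  have ht0 : 0 ≤ t := hT.le.trans ht
  rw [dotProduct_windowGram hφ (sub_nonneg.2 ht) hT.le, dotProduct_forgetGram hφ ht0,
    sub_add_cancel, ← intervalIntegral.integral_const_mul]
  have hc : ContinuousOn (fun τ => φ τ ⬝ᵥ x) (Ici 0) := continuousOn_dotProduct_const hφ x
  have hci : ∀ a b, 0 ≤ a → 0 ≤ b → IntervalIntegrable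
      (fun τ => Real.exp (-β * (t - τ)) * ((φ τ ⬝ᵥ x) * (φ τ ⬝ᵥ x))) MeasureTheory.volume a b :=
    fun a b ha hb => ContinuousOn.intervalIntegrable
      (((by fun_prop : Continuous fun τ => Real.exp (-β * (t - τ))).continuousOn.mul
        (hc.mul hc)).mono fun u hu => (le_min ha hb).trans hu.1)
  rw [← intervalIntegral.integral_add_adjacent_intervals (hci 0 (t - T) le_rfl (sub_nonneg.2 ht))
    (hci (t - T) t (sub_nonneg.2 ht) ht0)]
  have h1 : 0 ≤ ∫ τ in (0 : ℝ)..(t - T), Real.exp (-β * (t - τ)) * ((φ τ ⬝ᵥ x) * (φ τ ⬝ᵥ x)) :=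
    intervalIntegral.integral_nonneg (sub_nonneg.2 ht) fun τ _ =>
      mul_nonneg (Real.exp_pos _).le (mul_self_nonneg _)
  have h2 : ∫ τ in (t - T)..t, Real.exp (-β * T) * (φ τ ⬝ᵥ x) ^ 2
      ≤ ∫ τ in (t - T)..t, Real.exp (-β * (t - τ)) * ((φ τ ⬝ᵥ x) * (φ τ ⬝ᵥ x)) := by
    refine intervalIntegral.integral_mono_on (by linarith) ?_ (hci _ _ (sub_nonneg.2 ht) ht0) ?_
    · exact ContinuousOn.intervalIntegrable ((continuousOn_const.mul (hc.pow 2)).mono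
        fun u hu => (le_min (sub_nonneg.2 ht) ht0).trans hu.1)
    · intro τ hτ
      rw [pow_two]
      refine mul_le_mul_of_nonneg_right (Real.exp_le_exp.2 ?_) (mul_self_nonneg _)
      nlinarith [hτ.1]
  linarith

end Gram

namespace IsDeficientlyExciting

variable {φ : ℝ → Fin n → ℝ} {q : ℕ} {T : ℝ} {Φa Φb : Matrix (Fin n) (Fin n) ℝ}

lemma windowGram_quad_le (h : IsDeficientlyExciting φ q T Φa Φb) {t : ℝ} (ht : 0 ≤ t)
    (x : Fin n → ℝ) : x ⬝ᵥ (windowGram φ t T *ᵥ x) ≤ x ⬝ᵥ (Φb *ᵥ x) := by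
  have := (h.upper t ht).dotProduct_mulVec_nonneg x
  rw [star_trivial, Matrix.sub_mulVec, dotProduct_sub] at this
  linarith

lemma le_windowGram_quad (h : IsDeficientlyExciting φ q T Φa Φb) {t : ℝ} (ht : 0 ≤ t)
    (x : Fin n → ℝ) : x ⬝ᵥ (Φa *ᵥ x) ≤ x ⬝ᵥ (windowGram φ t T *ᵥ x) := by
  have := (h.lower t ht).dotProduct_mulVec_nonneg x
  rw [star_trivial, Matrix.sub_mulVec, dotProduct_sub] at this
  linarith

/-- One kernel contains the other, and the ranks agree. -/
lemma ker_eq (h : IsDeficientlyExciting φ q T Φa Φb) :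
    LinearMap.ker Φb.mulVecLin = LinearMap.ker Φa.mulVecLin := by
  have hle : LinearMap.ker Φb.mulVecLin ≤ LinearMap.ker Φa.mulVecLin := by
    intro x hx
    rw [LinearMap.mem_ker, Matrix.mulVecLin_apply] at hx ⊢
    have h1 := h.windowGram_quad_le le_rfl x
    have h2 := h.le_windowGram_quad le_rfl x
    have h3 := h.lower_posSemidef.dotProduct_mulVec_nonneg x
    rw [hx, dotProduct_zero] at h1
    rw [star_trivial] at h3
    refine (h.lower_posSemidef.dotProduct_mulVec_zero_iff x).1 ?_
    rw [star_trivial]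
    linarith
  refine Submodule.eq_of_le_of_finrank_eq hle ?_
  have h1 := Φa.mulVecLin.finrank_range_add_finrank_ker
  have h2 := Φb.mulVecLin.finrank_range_add_finrank_ker
  have h3 : Module.finrank ℝ (LinearMap.range Φa.mulVecLin) = n - q := h.lower_rank
  have h4 : Module.finrank ℝ (LinearMap.range Φb.mulVecLin) = n - q := h.upper_rank
  omega

lemma dotProduct_eq_zero (h : IsDeficientlyExciting φ q T Φa Φb) (hφ : ContinuousOn φ (Ici 0))
    {x : Fin n → ℝ} (hx : Φb *ᵥ x = 0) {t : ℝ} (ht : 0 ≤ t) : φ t ⬝ᵥ x = 0 := by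
  by_contra hne
  have h1 := h.windowGram_quad_le ht x
  rw [hx, dotProduct_zero, dotProduct_windowGram hφ ht h.window_pos.le] at h1
  refine absurd h1 (not_le.2 ?_)
  refine intervalIntegral.integral_pos (by linarith [h.window_pos]) ?_ (fun τ _ => sq_nonneg _)
    ⟨t, left_mem_Icc.2 (by linarith [h.window_pos]), by positivity⟩
  exact ((continuousOn_dotProduct_const hφ x).pow 2).mono
    fun u hu => ht.trans hu.1

variable {Nd : Matrix (Fin n) (Fin (n - q)) ℝ} {Nu : Matrix (Fin n) (Fin q) ℝ}

lemma proj_fixed_iff (h : IsDeficientlyExciting φ q T Φa Φb)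
    (hNu : ColumnsOrthonormalBasis Nu (LinearMap.ker Φb.mulVecLin)) (x : Fin n → ℝ) :
    (Nu * Nuᵀ) *ᵥ x = x ↔ Φa *ᵥ x = 0 := by
  have hmem : Φa *ᵥ x = 0 ↔ x ∈ LinearMap.range Nu.mulVecLin := by
    rw [hNu.2, h.ker_eq, LinearMap.mem_ker, Matrix.mulVecLin_apply]
  rw [hmem]
  constructor
  · intro hx
    exact ⟨Nuᵀ *ᵥ x, by rw [Matrix.mulVecLin_apply, Matrix.mulVec_mulVec, hx]⟩
  · rintro ⟨u, rfl⟩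
    rw [Matrix.mulVecLin_apply, Matrix.mulVec_mulVec, Matrix.mul_assoc, hNu.1, Matrix.mul_one]

/-- The identifiable and the non-identifiable subspace are orthogonal complements. -/
lemma identifiable_proj_eq (h : IsDeficientlyExciting φ q T Φa Φb)
    (hNd : ColumnsOrthonormalBasis Nd (LinearMap.range Φa.mulVecLin))
    (hNu : ColumnsOrthonormalBasis Nu (LinearMap.ker Φb.mulVecLin)) :
    Nd * Ndᵀ = 1 - Nu * Nuᵀ := by
  have hΦ : Φaᵀ = Φa := by
    simpa using h.lower_posSemidef.isHermitian.eq
  have hΦU : Φa * (Nu * Nuᵀ) = 0 := by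
    refine Matrix.ext_of_mulVec_single fun i => ?_
    rw [← Matrix.mulVec_mulVec, Matrix.zero_mulVec, ← h.proj_fixed_iff hNu,
      (isOrthProj_of_columns hNu.1).mulVec_mulVec]
  have hUD : (Nu * Nuᵀ) * Nd = 0 := by
    refine Matrix.ext_of_mulVec_single fun i => ?_
    have hr : Nd.mulVecLin (Pi.single i 1) ∈ LinearMap.range Φa.mulVecLin := by
      rw [← hNd.2]; exact LinearMap.mem_range_self _ _
    obtain ⟨w, hw⟩ := hr
    rw [Matrix.mulVecLin_apply, Matrix.mulVecLin_apply] at hw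
    have h1 : (Nu * Nuᵀ) * Φa = 0 := by
      have := congrArg Matrix.transpose hΦU
      rwa [Matrix.transpose_mul, hΦ, (isOrthProj_of_columns hNu.1).transpose_eq,
        Matrix.transpose_zero] at this
    rw [← Matrix.mulVec_mulVec, ← hw, Matrix.mulVec_mulVec, h1, Matrix.zero_mulVec,
      Matrix.zero_mulVec]
  have hDΦ : Nd * Ndᵀ * Φa = Φa := by
    refine Matrix.ext_of_mulVec_single fun i => ?_
    have hr : Φa.mulVecLin (Pi.single i 1) ∈ LinearMap.range Nd.mulVecLin := by
      rw [hNd.2]; exact LinearMap.mem_range_self _ _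
    obtain ⟨w, hw⟩ := hr
    rw [Matrix.mulVecLin_apply, Matrix.mulVecLin_apply] at hw
    rw [← Matrix.mulVec_mulVec, ← hw, Matrix.mulVec_mulVec, Matrix.mul_assoc, hNd.1,
      Matrix.mul_one]
  have hΦD : Φa * (Nd * Ndᵀ) = Φa := by
    have := congrArg Matrix.transpose hDΦ
    rwa [Matrix.transpose_mul, hΦ, (isOrthProj_of_columns hNd.1).transpose_eq] at this
  have hkey : (Nu * Nuᵀ) * (1 - Nd * Ndᵀ) = 1 - Nd * Ndᵀ := by
    refine Matrix.ext_of_mulVec_single fun i => ?_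
    rw [← Matrix.mulVec_mulVec, h.proj_fixed_iff hNu, Matrix.mulVec_mulVec, Matrix.mul_sub, hΦD,
      Matrix.mul_one, sub_self, Matrix.zero_mulVec]
  rw [Matrix.mul_sub, Matrix.mul_one, ← Matrix.mul_assoc, hUD, Matrix.zero_mul, sub_zero] at hkey
  rw [hkey]
  abel

theorem isExcitedOff (h : IsDeficientlyExciting φ q T Φa Φb) (hφ : ContinuousOn φ (Ici 0))
    (hNu : ColumnsOrthonormalBasis Nu (LinearMap.ker Φb.mulVecLin)) :
    IsExcitedOff φ (Nu * Nuᵀ) T := by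
  have hU := isOrthProj_of_columns hNu.1
  have hfix : ∀ x, Φa *ᵥ ((Nu * Nuᵀ) *ᵥ x) = 0 := fun x => by
    rw [← h.proj_fixed_iff hNu, hU.mulVec_mulVec]
  refine ⟨hU, h.window_pos, fun t ht => ?_, ?_⟩
  · refine dotProduct_self_eq_zero.1 ?_
    rw [hU.dotProduct_mulVec, hU.mulVec_mulVec]
    refine h.dotProduct_eq_zero hφ ?_ ht
    have h1 := hfix (φ t)
    rwa [← Matrix.mulVecLin_apply, ← LinearMap.mem_ker, ← h.ker_eq] at h1
  · obtain ⟨c, hc, hcW⟩ := exists_coercive (fun x : Fin n → ℝ => x ⬝ᵥ (Φa *ᵥ x))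
      (by simp only [dotProduct, Matrix.mulVec]; fun_prop)
      (fun s x => by
        rw [Matrix.mulVec_smul, smul_dotProduct, dotProduct_smul, smul_eq_mul, smul_eq_mul]; ring)
      (LinearMap.range (1 - Nu * Nuᵀ).mulVecLin) (by
        rintro x ⟨y, rfl⟩ hne
        rw [Matrix.mulVecLin_apply] at hne ⊢
        have h0 := h.lower_posSemidef.dotProduct_mulVec_nonneg ((1 - Nu * Nuᵀ) *ᵥ y)
        rw [star_trivial] at h0
        refine lt_of_le_of_ne h0 fun hz => hne ?_
        have h1 := (h.lower_posSemidef.dotProduct_mulVec_zero_iff _).1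
          (by rw [star_trivial]; exact hz.symm)
        rw [← h.proj_fixed_iff hNu, hU.mulVec_compl] at h1
        exact h1.symm)
    refine ⟨c / (n + 1), by positivity, fun t ht x => le_trans ?_ (h.le_windowGram_quad ht x)⟩
    have h1 := hcW _ (LinearMap.mem_range_self (1 - Nu * Nuᵀ).mulVecLin x)
    rw [Matrix.mulVecLin_apply] at h1
    have hΦ : Φaᵀ = Φa := by simpa using h.lower_posSemidef.isHermitian.eq
    have h2 : x ⬝ᵥ (Φa *ᵥ x)
        = ((1 - Nu * Nuᵀ) *ᵥ x) ⬝ᵥ (Φa *ᵥ ((1 - Nu * Nuᵀ) *ᵥ x)) := by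
      rw [Matrix.sub_mulVec, Matrix.one_mulVec, Matrix.mulVec_sub, hfix, sub_zero, sub_dotProduct,
        Matrix.dotProduct_mulVec ((Nu * Nuᵀ) *ᵥ x), ← Matrix.mulVec_transpose, hΦ, hfix,
        zero_dotProduct, sub_zero]
    rw [h2]
    have h3 := (le_abs_self _).trans (abs_dotProduct_le ((1 - Nu * Nuᵀ) *ᵥ x)
      ((1 - Nu * Nuᵀ) *ᵥ x))
    refine le_trans ?_ h1
    rw [div_mul_eq_mul_div, div_le_iff₀ (by positivity)]
    nlinarith [sq_nonneg ‖(1 - Nu * Nuᵀ) *ᵥ x‖]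

end IsDeficientlyExciting

namespace IsExcitedOff

variable {φ : ℝ → Fin n → ℝ} {U : Matrix (Fin n) (Fin n) ℝ} {T : ℝ}

lemma dotProduct_proj (h : IsExcitedOff φ U T) {t : ℝ} (ht : 0 ≤ t) (x : Fin n → ℝ) :
    φ t ⬝ᵥ (U *ᵥ x) = 0 := by
  rw [← h.proj.dotProduct_mulVec, h.annihilates t ht, zero_dotProduct]

lemma forgetGram_mul_proj (h : IsExcitedOff φ U T) (hφ : ContinuousOn φ (Ici 0)) {β t : ℝ}
    (ht : 0 ≤ t) : forgetGram β φ t * U = 0 := by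
  refine Matrix.ext_of_mulVec_single fun i => ?_
  rw [← Matrix.mulVec_mulVec, Matrix.zero_mulVec]
  refine dotProduct_self_eq_zero.1 ?_
  rw [dotProduct_forgetGram hφ ht]
  refine intervalIntegral.integral_zero_ae (Eventually.of_forall fun τ hτ => ?_)
  rw [uIoc_of_le ht] at hτ
  rw [h.dotProduct_proj hτ.1.le]
  simp

lemma proj_mul_forgetGram (h : IsExcitedOff φ U T) (hφ : ContinuousOn φ (Ici 0)) {β t : ℝ}
    (ht : 0 ≤ t) : U * forgetGram β φ t = 0 := by
  have := congrArg Matrix.transpose (h.forgetGram_mul_proj (β := β) hφ ht)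
  rwa [Matrix.transpose_mul, forgetGram_transpose, h.proj.transpose_eq,
    Matrix.transpose_zero] at this

lemma exists_forgetGram_lower (h : IsExcitedOff φ U T) (hφ : ContinuousOn φ (Ici 0)) {β : ℝ}
    (hβ : 0 < β) : ∃ c > 0, ∀ t, T ≤ t → ∀ x,
      c * (((1 - U) *ᵥ x) ⬝ᵥ ((1 - U) *ᵥ x)) ≤ x ⬝ᵥ (forgetGram β φ t *ᵥ x) := by
  obtain ⟨c, hc, hl⟩ := h.lower
  refine ⟨Real.exp (-β * T) * c, by positivity, fun t ht x =>
    le_trans ?_ (windowGram_le_forgetGram hφ hβ h.window_pos ht x)⟩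
  rw [mul_assoc]
  exact mul_le_mul_of_nonneg_left (hl _ (sub_nonneg.2 ht) x) (Real.exp_pos _).le

/-- After one excitation window, the kernel of the forgetting Gram matrix is the non-identifiable
subspace, so that every orthonormal basis of it yields the projection `U`. -/
lemma columns_proj_eq (h : IsExcitedOff φ U T) (hφ : ContinuousOn φ (Ici 0)) {β t : ℝ}
    (hβ : 0 < β) (ht : T ≤ t) {r : ℕ} {M : Matrix (Fin n) (Fin r) ℝ}
    (hM : ColumnsOrthonormalBasis M (LinearMap.ker (forgetGram β φ t).mulVecLin)) :
    M * Mᵀ = U := by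
  have ht0 : 0 ≤ t := h.window_pos.le.trans ht
  obtain ⟨c, hc, hl⟩ := h.exists_forgetGram_lower hφ hβ
  have h1 : U * M = M := by
    refine Matrix.ext_of_mulVec_single fun i => ?_
    have hmem : M *ᵥ Pi.single i 1 ∈ LinearMap.ker (forgetGram β φ t).mulVecLin := by
      rw [← hM.2]; exact LinearMap.mem_range_self M.mulVecLin _
    rw [LinearMap.mem_ker, Matrix.mulVecLin_apply] at hmem
    have h2 := hl t ht (M *ᵥ Pi.single i 1)
    rw [hmem, dotProduct_zero] at h2
    have h3 : ((1 - U) *ᵥ (M *ᵥ Pi.single i 1)) ⬝ᵥ ((1 - U) *ᵥ (M *ᵥ Pi.single i 1)) = 0 :=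
      le_antisymm (by nlinarith [dotProduct_self_nonneg ((1 - U) *ᵥ (M *ᵥ Pi.single i 1))])
        (dotProduct_self_nonneg _)
    have h4 := dotProduct_self_eq_zero.1 h3
    rw [Matrix.sub_mulVec, Matrix.one_mulVec, sub_eq_zero] at h4
    rw [← Matrix.mulVec_mulVec, ← h4]
  have h2 : M * Mᵀ * U = U := by
    refine Matrix.ext_of_mulVec_single fun i => ?_
    have hmem : U *ᵥ Pi.single i 1 ∈ LinearMap.range M.mulVecLin := by
      rw [hM.2, LinearMap.mem_ker, Matrix.mulVecLin_apply, Matrix.mulVec_mulVec,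
        h.forgetGram_mul_proj hφ ht0, Matrix.zero_mulVec]
    obtain ⟨w, hw⟩ := hmem
    rw [Matrix.mulVecLin_apply] at hw
    rw [← Matrix.mulVec_mulVec, ← hw, Matrix.mulVec_mulVec, Matrix.mul_assoc, hM.1,
      Matrix.mul_one]
  have h3 := congrArg Matrix.transpose h2
  rw [Matrix.transpose_mul, (isOrthProj_of_columns hM.1).transpose_eq, h.proj.transpose_eq,
    ← Matrix.mul_assoc, h1] at h3
  exact h3

end IsExcitedOff

/-! ### Sampled and held signals -/

section Sampled

variable {δ γ : ℝ} (f : ℕ → ℝ)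

lemma intervalIntegrable_exp_mul_sampled (hδ : 0 < δ) (c a b : ℝ) :
    IntervalIntegrable (fun τ => Real.exp (c * τ) * f ⌊τ / δ⌋₊) MeasureTheory.volume a b := by
  have h1 : IntervalIntegrable (fun τ => f ⌊τ / δ⌋₊) MeasureTheory.volume a b := by
    rw [intervalIntegrable_iff]
    refine MeasureTheory.Measure.integrableOn_of_bounded
      (M := ∑ k ∈ Finset.range (⌊max a b / δ⌋₊ + 1), |f k|) (by simp) ?_ ?_
    · exact ((measurable_from_top (f := f)).comp
        (Nat.measurable_floor.comp (measurable_id.div_const δ))).aestronglyMeasurable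
    · refine (MeasureTheory.ae_restrict_iff' measurableSet_uIoc).2
        (Eventually.of_forall fun τ hτ => ?_)
      refine Finset.single_le_sum (f := fun k => |f k|) (fun k _ => abs_nonneg _) ?_
      rw [Finset.mem_range, Nat.lt_succ_iff]
      exact Nat.floor_mono (div_le_div_of_nonneg_right hτ.2 hδ.le)
  exact h1.continuousOn_mul (by fun_prop)

lemma sampledConv_eq (t : ℝ) :
    ∫ τ in (0 : ℝ)..t, Real.exp (-γ * (t - τ)) * f ⌊τ / δ⌋₊
      = Real.exp (-γ * t) * ∫ τ in (0 : ℝ)..t, Real.exp (γ * τ) * f ⌊τ / δ⌋₊ := by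
  rw [← intervalIntegral.integral_const_mul]
  refine intervalIntegral.integral_congr fun τ _ => ?_
  simp only [← mul_assoc, ← Real.exp_add]
  ring_nf

lemma continuous_sampledConv (hδ : 0 < δ) :
    Continuous fun t => ∫ τ in (0 : ℝ)..t, Real.exp (-γ * (t - τ)) * f ⌊τ / δ⌋₊ := by
  simp only [sampledConv_eq]
  exact (by fun_prop : Continuous fun t => Real.exp (-γ * t)).mul
    (intervalIntegral.continuous_primitive (intervalIntegrable_exp_mul_sampled f hδ γ) 0)

/-- Once the samples are constant, their filtered version differs from its limit by an exact
exponential. -/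
lemma exists_sampledConv_eq (hδ : 0 < δ) (hγ : 0 < γ) {u : ℝ} {k₀ : ℕ}
    (hf : ∀ k, k₀ ≤ k → f k = u) :
    ∃ c : ℝ, ∀ t, k₀ * δ ≤ t →
      ∫ τ in (0 : ℝ)..t, Real.exp (-γ * (t - τ)) * f ⌊τ / δ⌋₊ = u / γ + c * Real.exp (-γ * t) := by
  set t₀ : ℝ := k₀ * δ
  refine ⟨(∫ τ in (0 : ℝ)..t₀, Real.exp (γ * τ) * f ⌊τ / δ⌋₊) - Real.exp (γ * t₀) * u / γ,
    fun t ht => ?_⟩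
  have hi := intervalIntegrable_exp_mul_sampled f hδ γ
  rw [sampledConv_eq, ← intervalIntegral.integral_add_adjacent_intervals (hi 0 t₀) (hi t₀ t)]
  have h1 : ∫ τ in t₀..t, Real.exp (γ * τ) * f ⌊τ / δ⌋₊ = ∫ τ in t₀..t, Real.exp (γ * τ) * u := by
    refine intervalIntegral.integral_congr fun τ hτ => ?_
    rw [uIcc_of_le ht] at hτ
    rw [hf _ (Nat.le_floor ((le_div_iff₀ hδ).2 hτ.1))]
  have h2 : ∫ τ in t₀..t, Real.exp (γ * τ) * u
      = Real.exp (γ * t) / γ * u - Real.exp (γ * t₀) / γ * u := by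
    refine intervalIntegral.integral_eq_sub_of_hasDerivAt
      (f := fun τ => Real.exp (γ * τ) / γ * u) (fun s _ => ?_)
      (Continuous.intervalIntegrable (by fun_prop) _ _)
    have := ((((hasDerivAt_id s).const_mul γ).exp).div_const γ).mul_const u
    refine this.congr_deriv ?_
    simp only [id]
    field_simp
  have h3 : Real.exp (-γ * t) * Real.exp (γ * t) = 1 := by rw [← Real.exp_add]; simp
  rw [h1, h2]
  linear_combination (u / γ) * h3

end Sampled

/-! ### Matrix estimates -/

section MatrixBounds

variable {n : ℕ}

lemma isBigO_matrix_of_entries {A : ℝ → Matrix (Fin n) (Fin n) ℝ} {g : ℝ → ℝ} {l : Filter ℝ}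
    (h : ∀ a b, (fun t => A t a b) =O[l] g) : A =O[l] g := by
  have h1 : A = fun t => ∑ a, ∑ b, A t a b • Matrix.single a b (1 : ℝ) := by
    funext t
    conv_lhs => rw [Matrix.matrix_eq_sum_single (A t)]
    simp
  rw [h1]
  refine IsBigO.fun_sum fun a _ => IsBigO.fun_sum fun b _ => ?_
  refine IsBigO.trans (IsBigO.of_bound ‖Matrix.single a b (1 : ℝ)‖
    (Eventually.of_forall fun t => ?_)) (h a b)
  rw [norm_smul, mul_comm]

lemma isBigO_mulVec {A : ℝ → Matrix (Fin n) (Fin n) ℝ} {v : ℝ → Fin n → ℝ} {f g : ℝ → ℝ}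
    {l : Filter ℝ} (hA : A =O[l] f) (hv : v =O[l] g) :
    (fun t => A t *ᵥ v t) =O[l] fun t => f t * g t :=
  (IsBigO.of_bound 1 (Eventually.of_forall fun t => by
    rw [one_mul, norm_mul, norm_norm, norm_norm]; exact norm_mulVec_le _ _)).trans
    (hA.norm_left.mul hv.norm_left)

lemma isBigO_const_mulVec (A : Matrix (Fin n) (Fin n) ℝ) {E : Type*} [Norm E] {v : ℝ → Fin n → ℝ}
    {g : ℝ → E} {l : Filter ℝ} (hv : v =O[l] g) : (fun t => A *ᵥ v t) =O[l] g :=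
  (IsBigO.of_bound ‖A‖ (Eventually.of_forall fun _ => norm_mulVec_le _ _)).trans hv

lemma norm_mulVec_le_sum_entries (A : Matrix (Fin n) (Fin n) ℝ) (v : Fin n → ℝ) :
    ‖A *ᵥ v‖ ≤ (∑ a, ∑ b, |A a b|) * ‖v‖ := by
  have h0 : ∀ a, 0 ≤ ∑ b, |A a b| := fun a => Finset.sum_nonneg fun b _ => abs_nonneg _
  refine (pi_norm_le_iff_of_nonneg (mul_nonneg (Finset.sum_nonneg fun a _ => h0 a)
    (norm_nonneg v))).2 fun a => ?_
  rw [Real.norm_eq_abs]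
  calc |(A *ᵥ v) a| ≤ ∑ b, |A a b * v b| :=
        Finset.abs_sum_le_sum_abs (fun b => A a b * v b) Finset.univ
    _ ≤ ∑ b, |A a b| * ‖v‖ := Finset.sum_le_sum fun b _ => by
        rw [abs_mul]; gcongr; exact norm_le_pi_norm v b
    _ = (∑ b, |A a b|) * ‖v‖ := by rw [Finset.sum_mul]
    _ ≤ _ := mul_le_mul_of_nonneg_right
        (Finset.single_le_sum (f := fun a => ∑ b, |A a b|) (fun a _ => h0 a)
          (Finset.mem_univ a)) (norm_nonneg v)

/-- Solutions of linear equations with uniformly coercive limiting coefficients inherit the decay of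
the right-hand side. -/
lemma isBigO_of_coercive_mulVec {A B : ℝ → Matrix (Fin n) (Fin n) ℝ} {h r : ℝ → Fin n → ℝ}
    {g : ℝ → ℝ} {c : ℝ} (hc : 0 < c)
    (hB : ∀ᶠ t in atTop, ∀ x, c * (x ⬝ᵥ x) ≤ x ⬝ᵥ (B t *ᵥ x))
    (hAB : Tendsto (fun t => A t - B t) atTop (𝓝 0))
    (hAh : ∀ᶠ t in atTop, A t *ᵥ h t = r t) (hr : r =O[atTop] g) : h =O[atTop] g := by
  refine IsBigO.trans ?_ hr
  refine IsBigO.of_bound (2 * n / c) ?_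
  have hsmall : ∀ᶠ t in atTop, ‖A t - B t‖ < c / (2 * (n + 1)) := by
    have h1 := hAB.norm
    rw [norm_zero] at h1
    exact h1.eventually (gt_mem_nhds (by positivity))
  filter_upwards [hB, hsmall, hAh] with t h1 h2 h3
  have h4 := h1 (h t)
  have h5 : h t ⬝ᵥ (B t *ᵥ h t) = h t ⬝ᵥ r t - h t ⬝ᵥ ((A t - B t) *ᵥ h t) := by
    rw [← h3, Matrix.sub_mulVec, dotProduct_sub]; ring
  have h6 := (le_abs_self _).trans (abs_dotProduct_le (h t) (r t))
  have h7 := (neg_le_abs _).trans (abs_dotProduct_le (h t) ((A t - B t) *ᵥ h t))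
  have h8 := norm_mulVec_le (A t - B t) (h t)
  have h9 := sq_norm_le_dotProduct_self (h t)
  have h10 : (n : ℝ) * (‖h t‖ * ‖(A t - B t) *ᵥ h t‖) ≤ c / 2 * ‖h t‖ ^ 2 := by
    have e1 : (n : ℝ) * (c / (2 * (n + 1))) ≤ c / 2 := by
      rw [mul_div_assoc', div_le_div_iff₀ (by positivity) (by positivity)]
      nlinarith
    calc (n : ℝ) * (‖h t‖ * ‖(A t - B t) *ᵥ h t‖)
        ≤ n * (‖h t‖ * (c / (2 * (n + 1)) * ‖h t‖)) := by
          gcongr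
          exact h8.trans (by gcongr)
      _ = n * (c / (2 * (n + 1))) * ‖h t‖ ^ 2 := by ring
      _ ≤ _ := by gcongr
  have h11 : c / 2 * ‖h t‖ ^ 2 ≤ n * (‖h t‖ * ‖r t‖) := by nlinarith
  rcases (norm_nonneg (h t)).eq_or_lt with h0 | h0
  · rw [← h0]; positivity
  · have h12 : c / 2 * ‖h t‖ ≤ n * ‖r t‖ := by nlinarith
    rw [div_mul_eq_mul_div, le_div_iff₀ hc]
    linarith

end MatrixBounds

/-! ### The local learning algorithm -/

section Forget

variable {n : ℕ} {φ : ℝ → Fin n → ℝ} {z : ℝ → ℝ} {β : ℝ}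

lemma hasDerivWithinAt_forgetGram (hφ : ContinuousOn φ (Ici 0)) {t : ℝ} (ht : 0 ≤ t)
    (a b : Fin n) : HasDerivWithinAt (fun s => forgetGram β φ s a b)
      ((-(β • forgetGram β φ t) + vecMulVec (φ t) (φ t)) a b) (Ici 0) t :=
  hasDerivWithinAt_expConv (g := fun τ => φ τ a * φ τ b)
    ((continuousOn_pi.1 hφ a).mul (continuousOn_pi.1 hφ b)) ht

lemma hasDerivWithinAt_forgetCorr (hφ : ContinuousOn φ (Ici 0)) (hz : ContinuousOn z (Ici 0))
    {α : ℝ} {θ0 : Fin n → ℝ} {t : ℝ} (ht : 0 ≤ t) :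
    HasDerivWithinAt (forgetCorr β α θ0 φ z)
      (-(β • forgetCorr β α θ0 φ z t) + z t • φ t) (Ici 0) t := by
  rw [hasDerivWithinAt_pi]
  intro a
  have h1 := hasDerivWithinAt_expConv (β := β) (g := fun τ => z τ * φ τ a)
    (hz.mul (continuousOn_pi.1 hφ a)) ht
  have h2 : HasDerivAt (fun s => α * Real.exp (-β * s) * θ0 a)
      (α * (Real.exp (-β * t) * (-β)) * θ0 a) t := by
    simpa using ((((hasDerivAt_id t).const_mul (-β)).exp).const_mul α).mul_const (θ0 a)
  refine (h1.add h2.hasDerivWithinAt).congr_deriv ?_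
  simp only [forgetCorr, Pi.add_apply, Pi.neg_apply, Pi.smul_apply, smul_eq_mul]
  ring

lemma isBigO_forgetGram (hβ : 0 < β) {C : ℝ} (hC : ∀ t, 0 ≤ t → ‖φ t‖ ≤ C) :
    forgetGram β φ =O[atTop] fun _ => (1 : ℝ) := by
  refine isBigO_matrix_of_entries fun a b => IsBigO.of_bound (C * C / β) ?_
  filter_upwards [eventually_ge_atTop 0] with t ht
  rw [norm_one, mul_one]
  refine abs_integral_exp_conv_le hβ ht fun τ hτ => ?_
  rw [abs_mul]
  have h1 := (norm_le_pi_norm (φ τ) a).trans (hC τ hτ)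
  have h2 := (norm_le_pi_norm (φ τ) b).trans (hC τ hτ)
  exact mul_le_mul h1 h2 (abs_nonneg _) ((norm_nonneg _).trans h1)

lemma isBigO_forgetCorr (hβ : 0 < β) (α : ℝ) (θ0 : Fin n → ℝ) {C : ℝ}
    (hC : ∀ t, 0 ≤ t → ‖φ t‖ ≤ C) {B : ℝ} (hB : ∀ t, 0 ≤ t → |z t| ≤ B) :
    forgetCorr β α θ0 φ z =O[atTop] fun _ => (1 : ℝ) := by
  refine isBigO_pi.2 fun a => IsBigO.of_bound (B * C / β + |α * θ0 a|) ?_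
  filter_upwards [eventually_ge_atTop 0] with t ht
  rw [norm_one, mul_one]
  refine (abs_add_le _ _).trans (add_le_add (abs_integral_exp_conv_le hβ ht fun τ hτ => ?_) ?_)
  · rw [abs_mul]
    exact mul_le_mul (hB τ hτ) ((norm_le_pi_norm (φ τ) a).trans (hC τ hτ)) (abs_nonneg _)
      ((abs_nonneg _).trans (hB τ hτ))
  · have h1 : Real.exp (-β * t) ≤ 1 := Real.exp_le_one_iff.2 (by nlinarith)
    rw [mul_right_comm, abs_mul, abs_of_pos (Real.exp_pos _)]
    exact mul_le_of_le_one_right (abs_nonneg _) h1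

end Forget

section Information

variable {n : ℕ}

/-- The matrix `P Q P + κ (1 - P) + α e^{-βt} P`, whose inverse the signal `Ω` tracks. -/
noncomputable def infoMatrix (β κ α : ℝ) (P Q : ℝ → Matrix (Fin n) (Fin n) ℝ) (t : ℝ) :
    Matrix (Fin n) (Fin n) ℝ :=
  P t * Q t * P t + κ • (1 - P t) + (α * Real.exp (-β * t)) • P t

lemma hasDerivWithinAt_infoMatrix {β κ α : ℝ} {P Q : ℝ → Matrix (Fin n) (Fin n) ℝ}
    {P' F : Matrix (Fin n) (Fin n) ℝ} {s : Set ℝ} {t : ℝ}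
    (hP : ∀ a b, HasDerivWithinAt (fun τ => P τ a b) (P' a b) s t)
    (hQ : ∀ a b, HasDerivWithinAt (fun τ => Q τ a b) ((-(β • Q t) + F) a b) s t) (a b : Fin n) :
    HasDerivWithinAt (fun τ => infoMatrix β κ α P Q τ a b)
      ((-(β • infoMatrix β κ α P Q t) + (P t * F * P t + (κ * β) • (1 - P t)
        + P' * Q t * P t + P t * Q t * P' + (α * Real.exp (-β * t) - κ) • P')) a b) s t := by
  have h1 := hasDerivWithinAt_mul_entry (hasDerivWithinAt_mul_entry hP hQ) hP a b
  have h2 : HasDerivWithinAt (fun τ => κ * ((1 : Matrix (Fin n) (Fin n) ℝ) a b - P τ a b))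
      (κ * (-P' a b)) s t := ((hP a b).const_sub _).const_mul κ
  have hE : HasDerivAt (fun s => α * Real.exp (-β * s)) (α * (Real.exp (-β * t) * (-β))) t := by
    simpa using (((hasDerivAt_id t).const_mul (-β)).exp).const_mul α
  have h3 := hE.hasDerivWithinAt (s := s) |>.mul (hP a b)
  refine ((h1.add h2).add h3).congr_deriv ?_
  have key : -(β • infoMatrix β κ α P Q t) + (P t * F * P t + (κ * β) • (1 - P t)
        + P' * Q t * P t + P t * Q t * P' + (α * Real.exp (-β * t) - κ) • P')
      = ((P' * Q t + P t * (-(β • Q t) + F)) * P t + P t * Q t * P') + κ • (-P')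
        + ((α * (Real.exp (-β * t) * (-β))) • P t + (α * Real.exp (-β * t)) • P') := by
    simp only [infoMatrix, Matrix.mul_add, Matrix.add_mul, Matrix.mul_neg, Matrix.neg_mul,
      Matrix.smul_mul, Matrix.mul_smul]
    module
  rw [key]
  rfl

lemma continuousOn_mul_entry {A B : ℝ → Matrix (Fin n) (Fin n) ℝ} {s : Set ℝ}
    (hA : ∀ a b, ContinuousOn (fun t => A t a b) s)
    (hB : ∀ a b, ContinuousOn (fun t => B t a b) s) (a b : Fin n) :
    ContinuousOn (fun t => (A t * B t) a b) s := by
  simp only [Matrix.mul_apply]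
  exact continuousOn_finsetSum _ fun c _ => (hA a c).mul (hB c b)

end Information

namespace LocalSignals

variable {n : ℕ} {S : LocalSignals n} {β γ δ κ α : ℝ} {θ0 : Fin n → ℝ} {φ : ℝ → Fin n → ℝ}
  {z : ℝ → ℝ} {U : Matrix (Fin n) (Fin n) ℝ} {T : ℝ}

lemma continuousOn_Pdot (hδ : 0 < δ) (hP : ∀ a b, ContinuousOn (fun t => S.P t a b) (Ici 0))
    (a b : Fin n) : ContinuousOn (fun t => S.Pdot γ δ t a b) (Ici 0) := by
  have h1 := (continuous_sampledConv (γ := γ) (fun k => (S.Nhat k * (S.Nhat k)ᵀ) a b)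
    hδ).continuousOn (s := Ici 0)
  have h2 : ContinuousOn (fun t => -(γ * S.P t a b) + γ * (1 : Matrix (Fin n) (Fin n) ℝ) a b
      - γ ^ 2 * ∫ τ in (0 : ℝ)..t, Real.exp (-γ * (t - τ))
        * (S.Nhat ⌊τ / δ⌋₊ * (S.Nhat ⌊τ / δ⌋₊)ᵀ) a b) (Ici 0) :=
    (((continuousOn_const.mul (hP a b)).neg).add continuousOn_const).sub
      (continuousOn_const.mul h1)
  exact h2

namespace IsRun

variable (h : S.IsRun β γ δ κ α θ0 φ z)
include h

lemma Q_eq (hφ : ContinuousOn φ (Ici 0)) {t : ℝ} (ht : 0 ≤ t) : S.Q t = forgetGram β φ t := by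
  ext a b
  refine eq_of_deriv_eq_neg_smul_add (β := β) (f := fun t => S.Q t a b)
    (g := fun t => forgetGram β φ t a b) (h := fun t => φ t a * φ t b) ?_
    (fun t ht => h.Q_deriv t ht a b) (fun t ht => hasDerivWithinAt_forgetGram hφ ht a b) t ht
  simp [h.Q_zero, forgetGram]

lemma φf_eq (hφ : ContinuousOn φ (Ici 0)) (hz : ContinuousOn z (Ici 0)) {t : ℝ} (ht : 0 ≤ t) :
    S.φf t = forgetCorr β α θ0 φ z t := by
  refine eq_of_deriv_eq_neg_smul_add (β := β) (h := fun t => z t • φ t) ?_ h.φf_deriv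
    (fun t ht => hasDerivWithinAt_forgetCorr hφ hz ht) t ht
  ext a
  simp [h.φf_zero, forgetCorr]

/-- The sampled projections are eventually the projection on the non-identifiable subspace. -/
lemma exists_sampled_proj_eq (hX : IsExcitedOff φ U T) (hφ : ContinuousOn φ (Ici 0)) (hβ : 0 < β)
    (hδ : 0 < δ) : ∃ k₀ : ℕ, ∀ k, k₀ ≤ k → S.Nhat k * (S.Nhat k)ᵀ = U := by
  refine ⟨⌈T / δ⌉₊, fun k hk => ?_⟩
  have h1 : T ≤ k * δ := (div_le_iff₀ hδ).1 (Nat.ceil_le.1 hk)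
  have h2 := h.Nhat_basis k
  rw [h.Q_eq hφ (by positivity)] at h2
  exact hX.columns_proj_eq hφ hβ h1 h2

/-- The filtered projection converges at every rate below `γ`: after the samples have settled,
`e^{γt} (P - (1 - U))` is affine in `t`. -/
lemma P_sub_isBigO (hX : IsExcitedOff φ U T) (hφ : ContinuousOn φ (Ici 0)) (hβ : 0 < β)
    (hδ : 0 < δ) (hγ : 0 < γ) {ρ : ℝ} (hρ : ρ < γ) :
    (fun t => S.P t - (1 - U)) =O[atTop] fun t => Real.exp (-ρ * t) := by
  obtain ⟨k₀, hk₀⟩ := h.exists_sampled_proj_eq hX hφ hβ hδ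
  refine isBigO_matrix_of_entries fun a b => ?_
  obtain ⟨c, hc⟩ := exists_sampledConv_eq (fun k => (S.Nhat k * (S.Nhat k)ᵀ) a b) hδ hγ
    (u := U a b) (k₀ := k₀) (fun k hk => by rw [hk₀ k hk])
  set t₀ : ℝ := k₀ * δ with ht₀
  have ht₀0 : 0 ≤ t₀ := by positivity
  let E : ℝ → ℝ := fun t => S.P t a b - ((1 : Matrix (Fin n) (Fin n) ℝ) a b - U a b)
  let F : ℝ → ℝ := fun t => Real.exp (γ * t) * E t + γ ^ 2 * c * t
  have hF : ∀ t, t₀ ≤ t → HasDerivWithinAt F 0 (Ici 0) t := by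
    intro t ht
    have h1 := (h.P_deriv t (ht₀0.trans ht) a b).sub_const
      ((1 : Matrix (Fin n) (Fin n) ℝ) a b - U a b)
    have h2 : HasDerivAt (fun s => Real.exp (γ * s)) (Real.exp (γ * t) * γ) t := by
      simpa using ((hasDerivAt_id t).const_mul γ).exp
    have h3 := (h2.hasDerivWithinAt (s := Ici 0).mul h1).add
      (((hasDerivAt_id t).const_mul (γ ^ 2 * c)).hasDerivWithinAt (s := Ici 0))
    refine h3.congr_deriv ?_
    have h4 : S.Pdot γ δ t a b = -(γ * S.P t a b) + γ * (1 : Matrix (Fin n) (Fin n) ℝ) a b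
        - γ ^ 2 * (U a b / γ + c * Real.exp (-γ * t)) := by
      rw [← hc t ht]; rfl
    have h5 : Real.exp (γ * t) * Real.exp (-γ * t) = 1 := by rw [← Real.exp_add]; simp
    rw [h4]
    have h6 : γ ^ 2 * (U a b / γ) = γ * U a b := by field_simp
    linear_combination (-γ ^ 2 * c) * h5 - Real.exp (γ * t) * h6
  have hconst : ∀ t, t₀ ≤ t → F t = F t₀ := by
    intro t ht
    refine constant_of_has_deriv_right_zero (a := t₀) (b := t) (fun s hs => ?_) (fun s hs => ?_) t
      ⟨ht, le_rfl⟩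
    · exact (hF s hs.1).continuousWithinAt.mono fun u hu => ht₀0.trans hu.1
    · exact (hF s hs.1).mono (Ici_subset_Ici.2 (ht₀0.trans hs.1))
  have hE : E =ᶠ[atTop] fun t => Real.exp (-γ * t) * (F t₀ - γ ^ 2 * c * t) := by
    filter_upwards [eventually_ge_atTop t₀] with t ht
    rw [← hconst t ht]
    have h5 : Real.exp (-γ * t) * Real.exp (γ * t) = 1 := by rw [← Real.exp_add]; simp
    simp only [F]
    linear_combination (-E t) * h5
  refine (show (fun t => (S.P t - (1 - U)) a b) =ᶠ[atTop] _ from hE).trans_isBigO ?_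
  have hlin : (fun t : ℝ => F t₀ - γ ^ 2 * c * t) =O[atTop] fun t => Real.exp ((γ - ρ) * t) := by
    have e1 : (fun t : ℝ => t) =O[atTop] fun t => Real.exp ((γ - ρ) * t) := by
      simpa using (isLittleO_pow_exp_pos_mul_atTop 1 (sub_pos.2 hρ)).isBigO
    have e2 : (fun _ : ℝ => F t₀) =O[atTop] fun t => Real.exp ((γ - ρ) * t) := by
      refine IsBigO.of_bound |F t₀| ?_
      filter_upwards [eventually_ge_atTop 0] with t ht
      rw [Real.norm_eq_abs, Real.norm_eq_abs, abs_of_pos (Real.exp_pos _)]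
      exact le_mul_of_one_le_right (abs_nonneg _)
        (Real.one_le_exp (mul_nonneg (sub_pos.2 hρ).le ht))
    exact e2.sub (e1.const_mul_left _)
  refine ((isBigO_refl (fun t => Real.exp (-γ * t)) atTop).mul hlin).congr_right fun t => ?_
  rw [← Real.exp_add]
  ring_nf

lemma continuousOn_R (hδ : 0 < δ) (hφ : ContinuousOn φ (Ici 0)) (a b : Fin n) :
    ContinuousOn (fun t => S.R β γ δ κ α φ t a b) (Ici 0) := by
  have hP : ∀ a b, ContinuousOn (fun t => S.P t a b) (Ici 0) := fun a b t ht =>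
    (h.P_deriv t ht a b).continuousWithinAt
  have hQ : ∀ a b, ContinuousOn (fun t => S.Q t a b) (Ici 0) := fun a b t ht =>
    (h.Q_deriv t ht a b).continuousWithinAt
  have hPd := continuousOn_Pdot (γ := γ) hδ hP
  have hF : ∀ a b, ContinuousOn (fun t => vecMulVec (φ t) (φ t) a b) (Ici 0) := fun a b =>
    (continuousOn_pi.1 hφ a).mul (continuousOn_pi.1 hφ b)
  have h1 := continuousOn_mul_entry (continuousOn_mul_entry hP hF) hP a b
  have h2 := continuousOn_mul_entry (continuousOn_mul_entry hPd hQ) hP a b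
  have h3 := continuousOn_mul_entry (continuousOn_mul_entry hP hQ) hPd a b
  have h4 : ContinuousOn (fun t => κ * β * ((1 : Matrix (Fin n) (Fin n) ℝ) a b - S.P t a b))
      (Ici 0) := continuousOn_const.mul (continuousOn_const.sub (hP a b))
  have h5 : ContinuousOn (fun t => (α * Real.exp (-β * t) - κ) * S.Pdot γ δ t a b) (Ici 0) :=
    (by fun_prop : Continuous fun t => α * Real.exp (-β * t) - κ).continuousOn.mul (hPd a b)
  exact (((h1.add h4).add h2).add h3).add h5

lemma hasDerivWithinAt_info {t : ℝ} (ht : 0 ≤ t) (a b : Fin n) :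
    HasDerivWithinAt (fun τ => infoMatrix β κ α S.P S.Q τ a b)
      ((-(β • infoMatrix β κ α S.P S.Q t) + S.R β γ δ κ α φ t) a b) (Ici 0) t :=
  hasDerivWithinAt_infoMatrix (h.P_deriv t ht) (h.Q_deriv t ht) a b

/-- The defect `1 - Ω M` solves a homogeneous linear equation, hence vanishes identically. -/
lemma Ω_mul_info (hκ : 0 < κ) (hδ : 0 < δ) (hφ : ContinuousOn φ (Ici 0)) {t : ℝ} (ht : 0 ≤ t) :
    S.Ω t * infoMatrix β κ α S.P S.Q t = 1 := by
  set M := infoMatrix β κ α S.P S.Q with hM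
  set R := S.R β γ δ κ α φ with hR
  have hΩc : ∀ a b, ContinuousOn (fun t => S.Ω t a b) (Ici 0) := fun a b t ht =>
    (h.Ω_deriv t ht a b).continuousWithinAt
  have hΩR := continuousOn_mul_entry hΩc (h.continuousOn_R hδ hφ)
  have hK : ContinuousOn (fun t => ∑ a, ∑ b, |(S.Ω t * R t) a b|) (Ici 0) :=
    continuousOn_finsetSum _ fun a _ => continuousOn_finsetSum _ fun b _ => (hΩR a b).abs
  have hcol : ∀ b, ∀ t, 0 ≤ t → (fun a => (1 - S.Ω t * M t) a b) = 0 := by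
    intro b
    refine eq_zero_of_norm_deriv_le (y' := fun t => -((S.Ω t * R t) *ᵥ
      fun a => (1 - S.Ω t * M t) a b)) hK ?_ (fun t ht => ?_) (fun t _ => ?_)
    · have h1 : S.Ω 0 * M 0 = 1 := by
        simp [hM, infoMatrix, h.P_zero, h.Ω_zero, smul_smul, mul_inv_cancel₀ hκ.ne']
      ext a
      simp [h1]
    · rw [hasDerivWithinAt_pi]
      intro a
      have h1 := (hasDerivWithinAt_mul_entry (h.Ω_deriv t ht)
        (h.hasDerivWithinAt_info ht) a b).const_sub ((1 : Matrix (Fin n) (Fin n) ℝ) a b)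
      refine h1.congr_deriv ?_
      have key : (β • S.Ω t - S.Ω t * R t * S.Ω t) * M t + S.Ω t * (-(β • M t) + R t)
          = S.Ω t * R t * (1 - S.Ω t * M t) := by
        simp only [Matrix.mul_add, Matrix.sub_mul, Matrix.mul_sub, Matrix.mul_neg,
          Matrix.smul_mul, Matrix.mul_smul, Matrix.mul_one, Matrix.mul_assoc]
        abel
      rw [key]
      rfl
    · rw [norm_neg]
      exact norm_mulVec_le_sum_entries _ _
  ext a b
  have := congrFun (hcol b t ht) a
  simp only [Matrix.sub_apply, Pi.zero_apply] at this
  linarith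

/-- `θd` is the solution of a linear system, because the residual `M θd - P φf` decays from zero. -/
lemma info_mulVec_θd (hκ : 0 < κ) (hδ : 0 < δ) (hφ : ContinuousOn φ (Ici 0)) {t : ℝ}
    (ht : 0 ≤ t) : infoMatrix β κ α S.P S.Q t *ᵥ S.θd t = S.P t *ᵥ S.φf t := by
  set M := infoMatrix β κ α S.P S.Q with hM
  set R := S.R β γ δ κ α φ with hR
  refine eq_of_deriv_eq_neg_smul_add (β := β) (f := fun t => M t *ᵥ S.θd t)
    (g := fun t => S.P t *ᵥ S.φf t)
    (h := fun t => z t • (S.P t *ᵥ φ t) + S.Pdot γ δ t *ᵥ S.φf t) ?_ (fun t ht => ?_)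
    (fun t ht => ?_) t ht
  · simp [h.P_zero, h.θd_zero]
  · refine (hasDerivWithinAt_mulVec (h.hasDerivWithinAt_info ht) (h.θd_deriv t ht)).congr_deriv ?_
    have h1 : M t * S.Ω t = 1 := mul_eq_one_comm.1 (h.Ω_mul_info hκ hδ hφ ht)
    change (-(β • M t) + R t) *ᵥ S.θd t + M t *ᵥ (-(S.Ω t *ᵥ (R t *ᵥ S.θd t
      - z t • (S.P t *ᵥ φ t) - S.Pdot γ δ t *ᵥ S.φf t))) = _
    rw [Matrix.mulVec_neg, Matrix.mulVec_mulVec, h1, Matrix.one_mulVec, Matrix.add_mulVec,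
      Matrix.neg_mulVec, Matrix.smul_mulVec]
    abel
  · refine (hasDerivWithinAt_mulVec (h.P_deriv t ht) (h.φf_deriv t ht)).congr_deriv ?_
    rw [Matrix.mulVec_add, Matrix.mulVec_neg, Matrix.mulVec_smul, Matrix.mulVec_smul]
    abel

end IsRun
end LocalSignals

/-! ### The least squares estimate -/

section LeastSquares

variable {n : ℕ} {φ : ℝ → Fin n → ℝ} {z : ℝ → ℝ} {β α : ℝ} {θ0 : Fin n → ℝ}

/-- The Hessian of the least squares cost. -/
noncomputable def normalMatrix (β α : ℝ) (φ : ℝ → Fin n → ℝ) (t : ℝ) : Matrix (Fin n) (Fin n) ℝ :=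
  forgetGram β φ t + (α * Real.exp (-β * t)) • 1

lemma normalMatrix_mulVec (t : ℝ) (x : Fin n → ℝ) :
    normalMatrix β α φ t *ᵥ x = forgetGram β φ t *ᵥ x + (α * Real.exp (-β * t)) • x := by
  rw [normalMatrix, Matrix.add_mulVec, Matrix.smul_mulVec, Matrix.one_mulVec]

lemma normalMatrix_quad_pos (hφ : ContinuousOn φ (Ici 0)) (hα : 0 < α) {t : ℝ} (ht : 0 ≤ t)
    {x : Fin n → ℝ} (hx : x ≠ 0) : 0 < x ⬝ᵥ (normalMatrix β α φ t *ᵥ x) := by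
  rw [normalMatrix_mulVec, dotProduct_add, dotProduct_smul, smul_eq_mul]
  have h1 := forgetGram_quad_nonneg (β := β) hφ ht x
  have h2 : 0 < x ⬝ᵥ x := lt_of_le_of_ne (dotProduct_self_nonneg x) fun h =>
    hx (dotProduct_self_eq_zero.1 h.symm)
  have h3 : 0 < α * Real.exp (-β * t) := by positivity
  nlinarith [mul_pos h3 h2]

lemma euclNorm_sq {ι : Type*} [Fintype ι] (x : ι → ℝ) : euclNorm x ^ 2 = x ⬝ᵥ x := by
  rw [euclNorm, EuclideanSpace.real_norm_sq_eq]
  simp [dotProduct, pow_two]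

/-- The cost is quadratic: its exact second order expansion. -/
lemma cost_add (hφ : ContinuousOn φ (Ici 0)) (hz : ContinuousOn z (Ici 0)) {t : ℝ} (ht : 0 ≤ t)
    (ϑ h : Fin n → ℝ) :
    cost β α θ0 φ z t (ϑ + h) = cost β α θ0 φ z t ϑ
      + h ⬝ᵥ (normalMatrix β α φ t *ᵥ ϑ - forgetCorr β α θ0 φ z t)
      + 1 / 2 * (h ⬝ᵥ (normalMatrix β α φ t *ᵥ h)) := by
  have hsub : uIcc 0 t ⊆ Ici (0 : ℝ) := fun u hu => (le_min le_rfl ht).trans hu.1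
  have hz' : ContinuousOn z (uIcc 0 t) := hz.mono hsub
  have hφx : ∀ x, ContinuousOn (fun τ => φ τ ⬝ᵥ x) (uIcc 0 t) := fun x =>
    (continuousOn_dotProduct_const hφ x).mono hsub
  have he : ContinuousOn (fun τ => Real.exp (-β * (t - τ))) (uIcc 0 t) := by fun_prop
  have i1 : IntervalIntegrable (fun τ => Real.exp (-β * (t - τ)) * (z τ - φ τ ⬝ᵥ ϑ) ^ 2)
      MeasureTheory.volume 0 t := (he.mul ((hz'.sub (hφx ϑ)).pow 2)).intervalIntegrable
  have i2 : IntervalIntegrable (fun τ => Real.exp (-β * (t - τ)) * (z τ * (φ τ ⬝ᵥ h)))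
      MeasureTheory.volume 0 t := (he.mul (hz'.mul (hφx h))).intervalIntegrable
  have i3 : ∀ x y, IntervalIntegrable
      (fun τ => Real.exp (-β * (t - τ)) * ((φ τ ⬝ᵥ x) * (φ τ ⬝ᵥ y)))
      MeasureTheory.volume 0 t := fun x y => (he.mul ((hφx x).mul (hφx y))).intervalIntegrable
  have hint : ∫ τ in (0 : ℝ)..t, Real.exp (-β * (t - τ)) * (z τ - φ τ ⬝ᵥ (ϑ + h)) ^ 2
      = (∫ τ in (0 : ℝ)..t, Real.exp (-β * (t - τ)) * (z τ - φ τ ⬝ᵥ ϑ) ^ 2)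
        - 2 * (∫ τ in (0 : ℝ)..t, Real.exp (-β * (t - τ)) * (z τ * (φ τ ⬝ᵥ h)))
        + 2 * (h ⬝ᵥ (forgetGram β φ t *ᵥ ϑ)) + h ⬝ᵥ (forgetGram β φ t *ᵥ h) := by
    rw [dotProduct_forgetGram hφ ht, dotProduct_forgetGram hφ ht,
      ← intervalIntegral.integral_const_mul, ← intervalIntegral.integral_const_mul,
      ← intervalIntegral.integral_sub i1 (i2.const_mul 2),
      ← intervalIntegral.integral_add (i1.sub (i2.const_mul 2)) ((i3 h ϑ).const_mul 2),
      ← intervalIntegral.integral_add ((i1.sub (i2.const_mul 2)).add ((i3 h ϑ).const_mul 2))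
        (i3 h h)]
    refine intervalIntegral.integral_congr fun τ _ => ?_
    simp only [dotProduct_add]
    ring
  have hcorr : h ⬝ᵥ forgetCorr β α θ0 φ z t
      = (∫ τ in (0 : ℝ)..t, Real.exp (-β * (t - τ)) * (z τ * (φ τ ⬝ᵥ h)))
        + α * Real.exp (-β * t) * (h ⬝ᵥ θ0) := by
    have h1 : ∀ τ, Real.exp (-β * (t - τ)) * (z τ * (φ τ ⬝ᵥ h))
        = ∑ a, h a * (Real.exp (-β * (t - τ)) * (z τ * φ τ a)) := by
      intro τ
      simp only [dotProduct, Finset.mul_sum]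
      exact Finset.sum_congr rfl fun a _ => by ring
    have i4 : ∀ a, IntervalIntegrable
        (fun τ => h a * (Real.exp (-β * (t - τ)) * (z τ * φ τ a))) MeasureTheory.volume 0 t :=
      fun a => (continuousOn_const.mul (he.mul (hz'.mul
        ((continuousOn_pi.1 hφ a).mono hsub)))).intervalIntegrable
    simp only [h1]
    rw [intervalIntegral.integral_finsetSum fun a _ => i4 a]
    simp only [dotProduct, forgetCorr, Finset.mul_sum, ← Finset.sum_add_distrib,
      intervalIntegral.integral_const_mul]
    exact Finset.sum_congr rfl fun a _ => by ring
  have hn : euclNorm (ϑ + h - θ0) ^ 2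
      = euclNorm (ϑ - θ0) ^ 2 + 2 * (h ⬝ᵥ ϑ - h ⬝ᵥ θ0) + h ⬝ᵥ h := by
    simp only [euclNorm_sq, dotProduct_sub, sub_dotProduct, dotProduct_add, add_dotProduct,
      dotProduct_comm ϑ h, dotProduct_comm θ0 h, dotProduct_comm θ0 ϑ]
    ring
  simp only [cost, dotProduct_comm _ (φ _)]
  rw [hint, hn, dotProduct_sub, hcorr, normalMatrix_mulVec, normalMatrix_mulVec, dotProduct_add,
    dotProduct_add, dotProduct_smul, dotProduct_smul, smul_eq_mul, smul_eq_mul]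
  ring

lemma normal_equation_of_forall_cost_le (hφ : ContinuousOn φ (Ici 0))
    (hz : ContinuousOn z (Ici 0)) {t : ℝ} (ht : 0 ≤ t) {x : Fin n → ℝ}
    (hx : ∀ ϑ, cost β α θ0 φ z t x ≤ cost β α θ0 φ z t ϑ) :
    normalMatrix β α φ t *ᵥ x = forgetCorr β α θ0 φ z t := by
  set g := normalMatrix β α φ t *ᵥ x - forgetCorr β α θ0 φ z t with hg
  set b := g ⬝ᵥ (normalMatrix β α φ t *ᵥ g) with hb
  -- a short step against the gradient `g` would decrease the cost
  have hs : ∀ s : ℝ, 0 ≤ -s * (g ⬝ᵥ g) + 1 / 2 * (s ^ 2 * b) := by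
    intro s
    have h1 := hx (x + (-s) • g)
    rw [cost_add hφ hz ht, ← hg, Matrix.mulVec_smul, smul_dotProduct, smul_dotProduct,
      dotProduct_smul, smul_eq_mul, smul_eq_mul, smul_eq_mul, ← hb] at h1
    nlinarith
  refine sub_eq_zero.1 (dotProduct_self_eq_zero.1 ?_)
  change g ⬝ᵥ g = 0
  by_contra hne
  have hpos : 0 < g ⬝ᵥ g := lt_of_le_of_ne (dotProduct_self_nonneg g) (Ne.symm hne)
  have h1 := hs (g ⬝ᵥ g / (|b| + 1))
  have h2 : (0 : ℝ) < |b| + 1 := by positivity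
  set s := g ⬝ᵥ g / (|b| + 1) with hsdef
  have h3 : s * (|b| + 1) = g ⬝ᵥ g := div_mul_cancel₀ _ h2.ne'
  have h4 : 0 < s := div_pos hpos h2
  have h5 : s * b ≤ g ⬝ᵥ g := by
    rw [← h3]; nlinarith [le_abs_self b]
  have h6 : -s * (g ⬝ᵥ g) + 1 / 2 * (s ^ 2 * b) = s * (1 / 2 * (s * b) - g ⬝ᵥ g) := by ring
  rw [h6] at h1
  nlinarith

lemma cost_le_of_normal_equation (hφ : ContinuousOn φ (Ici 0)) (hz : ContinuousOn z (Ici 0))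
    (hα : 0 < α) {t : ℝ} (ht : 0 ≤ t) {x : Fin n → ℝ}
    (hx : normalMatrix β α φ t *ᵥ x = forgetCorr β α θ0 φ z t) (ϑ : Fin n → ℝ) :
    cost β α θ0 φ z t x ≤ cost β α θ0 φ z t ϑ := by
  have h1 := cost_add (β := β) (α := α) (θ0 := θ0) hφ hz ht x (ϑ - x)
  rw [hx, sub_self, dotProduct_zero, add_sub_cancel] at h1
  have h2 : 0 ≤ (ϑ - x) ⬝ᵥ (normalMatrix β α φ t *ᵥ (ϑ - x)) := by
    rcases eq_or_ne (ϑ - x) 0 with h0 | h0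
    · simp [h0]
    · exact (normalMatrix_quad_pos hφ hα ht h0).le
  linarith

end LeastSquares

/-! ### Convergence of the local estimates -/

section LocalConvergence

variable {n : ℕ} {φ : ℝ → Fin n → ℝ} {z : ℝ → ℝ} {β α κ : ℝ} {θ0 θ : Fin n → ℝ}
  {U : Matrix (Fin n) (Fin n) ℝ} {T : ℝ}

/-- The value of the information matrix with `P` replaced by its limit `1 - U`. -/
noncomputable def limitMatrix (β κ α : ℝ) (φ : ℝ → Fin n → ℝ) (U : Matrix (Fin n) (Fin n) ℝ)
    (t : ℝ) : Matrix (Fin n) (Fin n) ℝ :=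
  forgetGram β φ t + κ • U + (α * Real.exp (-β * t)) • (1 - U)

namespace IsExcitedOff

variable (hX : IsExcitedOff φ U T) (hφ : ContinuousOn φ (Ici 0))
include hX hφ

lemma exists_limitMatrix_coercive (hβ : 0 < β) (hκ : 0 < κ) (hα : 0 < α) :
    ∃ c > 0, ∀ᶠ t in atTop, ∀ x, c * (x ⬝ᵥ x) ≤ x ⬝ᵥ (limitMatrix β κ α φ U t *ᵥ x) := by
  obtain ⟨c, hc, hl⟩ := hX.exists_forgetGram_lower hφ hβ
  refine ⟨min c κ, lt_min hc hκ, ?_⟩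
  filter_upwards [eventually_ge_atTop T] with t ht x
  have h1 := hl t ht x
  rw [hX.proj.pythagoras x, limitMatrix, Matrix.add_mulVec, Matrix.add_mulVec, Matrix.smul_mulVec,
    Matrix.smul_mulVec, dotProduct_add, dotProduct_add, dotProduct_smul, dotProduct_smul,
    hX.proj.dotProduct_self, hX.proj.compl.dotProduct_self, smul_eq_mul, smul_eq_mul]
  have h2 := dotProduct_self_nonneg (U *ᵥ x)
  have h3 := dotProduct_self_nonneg ((1 - U) *ᵥ x)
  have h4 : 0 ≤ α * Real.exp (-β * t) * (((1 - U) *ᵥ x) ⬝ᵥ ((1 - U) *ᵥ x)) := by positivity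
  nlinarith [min_le_left c κ, min_le_right c κ]

lemma limitMatrix_mulVec_compl {t : ℝ} (ht : 0 ≤ t) (x : Fin n → ℝ) :
    limitMatrix β κ α φ U t *ᵥ ((1 - U) *ᵥ x) = (1 - U) *ᵥ (normalMatrix β α φ t *ᵥ x) := by
  have h1 : forgetGram β φ t * (1 - U) = forgetGram β φ t := by
    rw [Matrix.mul_sub, hX.forgetGram_mul_proj hφ ht]; simp
  have h2 : (1 - U) * forgetGram β φ t = forgetGram β φ t := by
    rw [Matrix.sub_mul, hX.proj_mul_forgetGram hφ ht]; simp
  rw [normalMatrix_mulVec, Matrix.mulVec_add, Matrix.mulVec_mulVec (M := 1 - U), h2, limitMatrix,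
    Matrix.add_mulVec, Matrix.add_mulVec, Matrix.mulVec_mulVec, h1, Matrix.smul_mulVec,
    Matrix.smul_mulVec, hX.proj.mulVec_compl, hX.proj.compl.mulVec_mulVec, smul_zero, add_zero,
    Matrix.mulVec_smul]

/-- The identifiable part of a solution of the normal equation decays like the right-hand side. -/
lemma compl_mulVec_isBigO (hβ : 0 < β) (hα : 0 < α) {x r : ℝ → Fin n → ℝ} {g : ℝ → ℝ}
    (hx : ∀ t, 0 ≤ t → normalMatrix β α φ t *ᵥ x t = r t) (hr : r =O[atTop] g) :
    (fun t => (1 - U) *ᵥ x t) =O[atTop] g := by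
  obtain ⟨c, hc, hcoer⟩ := hX.exists_limitMatrix_coercive (κ := 1) hφ hβ one_pos hα
  refine isBigO_of_coercive_mulVec (A := limitMatrix β 1 α φ U) hc hcoer (by simp)
    (r := fun t => (1 - U) *ᵥ r t) ?_ (isBigO_const_mulVec _ hr)
  filter_upwards [eventually_ge_atTop 0] with t ht
  rw [hX.limitMatrix_mulVec_compl hφ ht, hx t ht]

omit hX in
lemma normalMatrix_mulVec_sub (hzθ : ∀ t, 0 ≤ t → z t = φ t ⬝ᵥ θ) {x : ℝ → Fin n → ℝ}
    (hx : ∀ t, 0 ≤ t → normalMatrix β α φ t *ᵥ x t = forgetCorr β α θ0 φ z t) {t : ℝ}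
    (ht : 0 ≤ t) : normalMatrix β α φ t *ᵥ (x t - θ) = (α * Real.exp (-β * t)) • (θ0 - θ) := by
  rw [Matrix.mulVec_sub, hx t ht, normalMatrix_mulVec]
  have h1 : forgetGram β φ t *ᵥ θ
      = fun a => ∫ τ in (0 : ℝ)..t, Real.exp (-β * (t - τ)) * (z τ * φ τ a) := by
    ext a
    have h2 := dotProduct_forgetGram (β := β) hφ ht (Pi.single a 1) θ
    rw [single_one_dotProduct] at h2
    rw [h2]
    refine intervalIntegral.integral_congr fun τ hτ => ?_
    rw [uIcc_of_le ht] at hτ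
    simp only [dotProduct_single_one, hzθ τ hτ.1]
    ring
  rw [h1]
  ext a
  simp only [forgetCorr, Pi.sub_apply, Pi.add_apply, Pi.smul_apply, smul_eq_mul]
  ring

/-- Without noise the identifiable part of the least squares error decays at the forgetting rate. -/
lemma compl_mulVec_sub_isBigO (hβ : 0 < β) (hα : 0 < α) (hzθ : ∀ t, 0 ≤ t → z t = φ t ⬝ᵥ θ)
    {x : ℝ → Fin n → ℝ}
    (hx : ∀ t, 0 ≤ t → normalMatrix β α φ t *ᵥ x t = forgetCorr β α θ0 φ z t) :
    (fun t => (1 - U) *ᵥ (x t - θ)) =O[atTop] fun t => Real.exp (-β * t) := by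
  refine hX.compl_mulVec_isBigO (x := fun t => x t - θ) hφ hβ hα
    (fun t ht => normalMatrix_mulVec_sub hφ hzθ hx ht) ?_
  refine IsBigO.of_bound (|α| * ‖θ0 - θ‖) (Eventually.of_forall fun t => ?_)
  rw [norm_smul, norm_mul, Real.norm_eq_abs α]
  exact le_of_eq (by ring)

end IsExcitedOff

lemma tendsto_zero_of_isBigO_exp {E : Type*} [NormedAddCommGroup E] {f : ℝ → E} {ρ : ℝ}
    (hρ : 0 < ρ) (hf : f =O[atTop] fun t => Real.exp (-ρ * t)) : Tendsto f atTop (𝓝 0) := by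
  refine hf.trans_tendsto ?_
  refine Real.tendsto_exp_atBot.comp ?_
  exact tendsto_id.const_mul_atTop_of_neg (neg_neg_of_pos hρ)

namespace LocalSignals.IsRun

variable {S : LocalSignals n} {γ δ : ℝ} (h : S.IsRun β γ δ κ α θ0 φ z)
include h

lemma info_sub_limit_isBigO (hX : IsExcitedOff φ U T) (hφ : ContinuousOn φ (Ici 0)) (hβ : 0 < β)
    (hδ : 0 < δ) (hγ : 0 < γ) {C : ℝ} (hC : ∀ t, 0 ≤ t → ‖φ t‖ ≤ C) {ρ : ℝ} (hρ : ρ < γ) :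
    (fun t => infoMatrix β κ α S.P S.Q t - limitMatrix β κ α φ U t)
      =O[atTop] fun t => Real.exp (-ρ * t) := by
  have hE := h.P_sub_isBigO hX hφ hβ hδ hγ hρ
  have hE1 : (fun t => S.P t - (1 - U)) =O[atTop] fun _ => (1 : ℝ) := by
    simpa using h.P_sub_isBigO hX hφ hβ hδ hγ hγ
  have hQ := isBigO_forgetGram (φ := φ) hβ hC
  have hexp : (fun t => α * Real.exp (-β * t) - κ) =O[atTop] fun _ => (1 : ℝ) := by
    have h1 : (fun t => Real.exp (-β * t)) =O[atTop] fun _ => (1 : ℝ) :=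
      ((tendsto_zero_of_isBigO_exp hβ (isBigO_refl _ _)).isBigO_one ℝ)
    exact (h1.const_mul_left α).sub (isBigO_const_const κ one_ne_zero _)
  have heq : (fun t => infoMatrix β κ α S.P S.Q t - limitMatrix β κ α φ U t) =ᶠ[atTop] fun t =>
      forgetGram β φ t * (S.P t - (1 - U)) + (S.P t - (1 - U)) * forgetGram β φ t
        + (S.P t - (1 - U)) * forgetGram β φ t * (S.P t - (1 - U))
        + (α * Real.exp (-β * t) - κ) • (S.P t - (1 - U)) := by
    filter_upwards [eventually_ge_atTop 0] with t ht
    have h1 := hX.forgetGram_mul_proj (β := β) hφ ht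
    have h2 := hX.proj_mul_forgetGram (β := β) hφ ht
    obtain ⟨E, hE⟩ : ∃ E, S.P t = (1 - U) + E := ⟨S.P t - (1 - U), by abel⟩
    have h3 : E * forgetGram β φ t * U = 0 := by rw [Matrix.mul_assoc, h1, Matrix.mul_zero]
    rw [infoMatrix, limitMatrix, h.Q_eq hφ ht, hE]
    simp only [Matrix.mul_add, Matrix.add_mul, Matrix.sub_mul, Matrix.mul_sub, Matrix.one_mul,
      Matrix.mul_one, h1, h2, h3, Matrix.zero_mul, add_sub_cancel_left]
    module
  refine heq.trans_isBigO ?_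
  refine (((?_ : _ =O[atTop] _).add ?_).add ?_).add ?_
  · simpa using hQ.mul hE
  · simpa using hE.mul hQ
  · simpa using (hE.mul hQ).mul hE1
  · simpa using hexp.smul hE

/-- The filtered local estimate approaches the identifiable part of the least squares estimate at
every rate below `γ`: both solve linear systems whose coefficients agree up to `P - (1 - U)`. -/
theorem P_mulVec_θd_sub_isBigO (hX : IsExcitedOff φ U T) (hφ : ContinuousOn φ (Ici 0))
    (hz : ContinuousOn z (Ici 0)) (hβ : 0 < β) (hκ : 0 < κ) (hα : 0 < α)
    (hδ : 0 < δ) (hγ : 0 < γ) {C : ℝ} (hC : ∀ t, 0 ≤ t → ‖φ t‖ ≤ C) {B : ℝ}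
    (hB : ∀ t, 0 ≤ t → |z t| ≤ B) {x : ℝ → Fin n → ℝ}
    (hx : ∀ t, 0 ≤ t → normalMatrix β α φ t *ᵥ x t = forgetCorr β α θ0 φ z t)
    {ρ : ℝ} (hρ : ρ < γ) :
    (fun t => S.P t *ᵥ S.θd t - (1 - U) *ᵥ x t) =O[atTop] fun t => Real.exp (-ρ * t) := by
  have hcorr := isBigO_forgetCorr (φ := φ) (z := z) hβ α θ0 hC hB
  have hx1 : (fun t => (1 - U) *ᵥ x t) =O[atTop] fun _ => (1 : ℝ) :=
    hX.compl_mulVec_isBigO hφ hβ hα hx hcorr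
  have hdiff : ∀ ρ, ρ < γ → (fun t => S.θd t - (1 - U) *ᵥ x t)
      =O[atTop] fun t => Real.exp (-ρ * t) := by
    intro ρ hρ
    obtain ⟨c, hc, hcoer⟩ := hX.exists_limitMatrix_coercive hφ hβ hκ hα
    have hE := h.P_sub_isBigO hX hφ hβ hδ hγ hρ
    have hM := h.info_sub_limit_isBigO hX hφ hβ hδ hγ hC hρ
    refine isBigO_of_coercive_mulVec (A := infoMatrix β κ α S.P S.Q) hc hcoer
      (tendsto_zero_of_isBigO_exp (half_pos hγ)
        (h.info_sub_limit_isBigO hX hφ hβ hδ hγ hC (half_lt_self hγ)))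
      (r := fun t => (S.P t - (1 - U)) *ᵥ forgetCorr β α θ0 φ z t
        - (infoMatrix β κ α S.P S.Q t - limitMatrix β κ α φ U t) *ᵥ ((1 - U) *ᵥ x t)) ?_ ?_
    · filter_upwards [eventually_ge_atTop 0] with t ht
      rw [Matrix.mulVec_sub, h.info_mulVec_θd hκ hδ hφ ht, h.φf_eq hφ hz ht,
        Matrix.sub_mulVec (infoMatrix β κ α S.P S.Q t), hX.limitMatrix_mulVec_compl hφ ht,
        hx t ht, Matrix.sub_mulVec (S.P t)]
      abel
    · refine IsBigO.sub ?_ ?_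
      · simpa using isBigO_mulVec hE hcorr
      · simpa using isBigO_mulVec hM hx1
  have hθd : S.θd =O[atTop] fun _ => (1 : ℝ) := by
    have h1 := hdiff 0 hγ
    simp only [neg_zero, zero_mul, Real.exp_zero] at h1
    simpa using h1.add hx1
  have heq : (fun t => S.P t *ᵥ S.θd t - (1 - U) *ᵥ x t) = fun t =>
      (S.P t - (1 - U)) *ᵥ S.θd t + (1 - U) *ᵥ (S.θd t - (1 - U) *ᵥ x t) := by
    funext t
    rw [Matrix.mulVec_sub, hX.proj.compl.mulVec_mulVec, Matrix.sub_mulVec (S.P t)]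
    abel
  rw [heq]
  refine IsBigO.add ?_ (isBigO_const_mulVec _ (hdiff ρ hρ))
  simpa using isBigO_mulVec (h.P_sub_isBigO hX hφ hβ hδ hγ hρ) hθd

end LocalSignals.IsRun
end LocalConvergence

/-! ### Existence of the local signals -/

section Existence

variable {n : ℕ}

lemma exists_columnsOrthonormalBasis (V : Submodule ℝ (Fin n → ℝ)) :
    ∃ (r : ℕ) (M : Matrix (Fin n) (Fin r) ℝ), ColumnsOrthonormalBasis M V := by
  let e := WithLp.linearEquiv 2 ℝ (Fin n → ℝ)
  let V' : Submodule ℝ (EuclideanSpace ℝ (Fin n)) := V.comap e.toLinearMap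
  let b := stdOrthonormalBasis ℝ V'
  let M : Matrix (Fin n) (Fin (Module.finrank ℝ V')) ℝ :=
    Matrix.of fun a j => (b j : EuclideanSpace ℝ (Fin n)) a
  have hM : ∀ v, M *ᵥ v = e (∑ j, v j • (b j : EuclideanSpace ℝ (Fin n))) := by
    intro v
    ext a
    rw [map_sum, Finset.sum_apply]
    simp only [Matrix.mulVec, dotProduct]
    refine Finset.sum_congr rfl fun j _ => ?_
    simp [M, e, mul_comm]
  refine ⟨_, M, ?_, le_antisymm ?_ ?_⟩
  · ext i j
    have h1 := b.inner_eq_ite i j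
    rw [Submodule.coe_inner, EuclideanSpace.inner_eq_star_dotProduct] at h1
    rw [Matrix.mul_apply, Matrix.one_apply, ← h1]
    exact Finset.sum_congr rfl fun a _ => mul_comm _ _
  · rintro _ ⟨v, rfl⟩
    rw [Matrix.mulVecLin_apply, hM]
    have : ∑ j, v j • (b j : EuclideanSpace ℝ (Fin n)) ∈ V' :=
      Submodule.sum_mem _ fun j _ => V'.smul_mem _ (b j).2
    exact this
  · intro x hx
    have hx' : WithLp.toLp 2 x ∈ V' := hx
    refine ⟨b.repr ⟨_, hx'⟩, ?_⟩
    have h1 := congrArg (fun y : V' => (y : EuclideanSpace ℝ (Fin n))) (b.sum_repr ⟨_, hx'⟩)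
    simp only [Submodule.coe_sum, Submodule.coe_smul] at h1
    rw [Matrix.mulVecLin_apply, hM, h1]
    rfl

lemma hasDerivWithinAt_matrix_of_entries {A : ℝ → Matrix (Fin n) (Fin n) ℝ}
    {A' : Matrix (Fin n) (Fin n) ℝ} {s : Set ℝ} {t : ℝ}
    (h : ∀ a b, HasDerivWithinAt (fun τ => A τ a b) (A' a b) s t) : HasDerivWithinAt A A' s t := by
  have h1 : A = fun t => ∑ a, ∑ b, A t a b • Matrix.single a b (1 : ℝ) := by
    funext t
    conv_lhs => rw [Matrix.matrix_eq_sum_single (A t)]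
    simp
  have h2 : A' = ∑ a, ∑ b, A' a b • Matrix.single a b (1 : ℝ) := by
    conv_lhs => rw [Matrix.matrix_eq_sum_single A']
    simp
  rw [h1, h2]
  exact HasDerivWithinAt.fun_sum fun a _ => HasDerivWithinAt.fun_sum fun b _ =>
    (h a b).smul_const _

lemma continuousOn_matrix_of_entries {A : ℝ → Matrix (Fin n) (Fin n) ℝ} {s : Set ℝ}
    (h : ∀ a b, ContinuousOn (fun τ => A τ a b) s) : ContinuousOn A s := by
  have h1 : A = fun t => ∑ a, ∑ b, A t a b • Matrix.single a b (1 : ℝ) := by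
    funext t
    conv_lhs => rw [Matrix.matrix_eq_sum_single (A t)]
    simp
  rw [h1]
  exact continuousOn_finsetSum _ fun a _ => continuousOn_finsetSum _ fun b _ =>
    (h a b).smul continuousOn_const

lemma hasDerivWithinAt_inv_entry {A : ℝ → Matrix (Fin n) (Fin n) ℝ}
    {A' : Matrix (Fin n) (Fin n) ℝ} {s : Set ℝ} {t : ℝ}
    (h : ∀ a b, HasDerivWithinAt (fun τ => A τ a b) (A' a b) s t) (hu : IsUnit (A t))
    (a b : Fin n) :
    HasDerivWithinAt (fun τ => (A τ)⁻¹ a b) ((-((A t)⁻¹ * A' * (A t)⁻¹)) a b) s t := by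
  have : CompleteSpace (Matrix (Fin n) (Fin n) ℝ) := FiniteDimensional.complete ℝ _
  obtain ⟨u, hu⟩ := hu
  have h1 := hasFDerivAt_ringInverse (𝕜 := ℝ) u
  rw [hu] at h1
  have h2 := h1.comp_hasDerivWithinAt t (hasDerivWithinAt_matrix_of_entries h)
  have hinv : (↑u⁻¹ : Matrix (Fin n) (Fin n) ℝ) = (A t)⁻¹ := by
    rw [← hu, Matrix.coe_units_inv]
  let L : Matrix (Fin n) (Fin n) ℝ →L[ℝ] ℝ :=
    LinearMap.toContinuousLinearMap (Matrix.entryLinearMap ℝ ℝ a b)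
  have h3 := L.hasFDerivAt.comp_hasDerivWithinAt t h2
  have h4 : (fun τ => (A τ)⁻¹ a b) = L ∘ Ring.inverse ∘ A := by
    funext τ
    simp [L, Matrix.nonsing_inv_eq_ringInverse]
  rw [h4]
  refine h3.congr_deriv ?_
  rw [hinv]
  rfl

lemma isUnit_of_quad_pos {A : Matrix (Fin n) (Fin n) ℝ} (h : ∀ x, x ≠ 0 → 0 < x ⬝ᵥ (A *ᵥ x)) :
    IsUnit A := by
  refine Matrix.mulVec_injective_iff_isUnit.1 fun x y hxy => ?_
  by_contra hne
  have h1 := h (x - y) (sub_ne_zero.2 hne)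
  rw [Matrix.mulVec_sub, hxy, sub_self, dotProduct_zero] at h1
  exact lt_irrefl _ h1

/-- The explicit solution `P` of the projection filter with `P 0 = 0`, driven by the sample-and-hold
signal that takes the value `W k` on `[k δ, (k + 1) δ)`. -/
noncomputable def filteredProj (γ δ : ℝ) (W : ℕ → Matrix (Fin n) (Fin n) ℝ) (t : ℝ) :
    Matrix (Fin n) (Fin n) ℝ :=
  Matrix.of fun a b => ∫ s in (0 : ℝ)..t, Real.exp (-γ * (t - s)) *
    (γ * (1 : Matrix (Fin n) (Fin n) ℝ) a b
      - γ ^ 2 * ∫ τ in (0 : ℝ)..s, Real.exp (-γ * (s - τ)) * W ⌊τ / δ⌋₊ a b)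

section FilteredProj

variable {γ δ : ℝ} {W : ℕ → Matrix (Fin n) (Fin n) ℝ}

lemma filteredProj_transpose (hW : ∀ k, IsOrthProj (W k)) (t : ℝ) :
    (filteredProj γ δ W t)ᵀ = filteredProj γ δ W t := by
  have h1 : ∀ k a b, W k b a = W k a b := fun k a b => congrFun (congrFun (hW k).transpose_eq a) b
  have h2 : ∀ a b, (1 : Matrix (Fin n) (Fin n) ℝ) b a = (1 : Matrix (Fin n) (Fin n) ℝ) a b :=
    fun a b => congrFun (congrFun Matrix.transpose_one a) b
  ext a b
  simp only [filteredProj, Matrix.transpose_apply, Matrix.of_apply, h1 _ a b, h2 a b]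

lemma hasDerivWithinAt_filteredProj (hδ : 0 < δ) {t : ℝ} (ht : 0 ≤ t) (a b : Fin n) :
    HasDerivWithinAt (fun s => filteredProj γ δ W s a b)
      (-(γ * filteredProj γ δ W t a b) + (γ * (1 : Matrix (Fin n) (Fin n) ℝ) a b
        - γ ^ 2 * ∫ τ in (0 : ℝ)..t, Real.exp (-γ * (t - τ)) * W ⌊τ / δ⌋₊ a b)) (Ici 0) t :=
  hasDerivWithinAt_expConv (continuous_const.sub (continuous_const.mul
    (continuous_sampledConv (fun k => W k a b) hδ))).continuousOn ht

/-- The filtered projection lies between `0` and `1 - e^{-γt}`. -/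
lemma filteredProj_quad_bounds (hδ : 0 < δ) (hγ : 0 < γ) (hW : ∀ k, IsOrthProj (W k)) {t : ℝ}
    (ht : 0 ≤ t) (x : Fin n → ℝ) :
    0 ≤ x ⬝ᵥ (filteredProj γ δ W t *ᵥ x) ∧
      x ⬝ᵥ (filteredProj γ δ W t *ᵥ x) ≤ (1 - Real.exp (-γ * t)) * (x ⬝ᵥ x) := by
  let I : ℝ → Matrix (Fin n) (Fin n) ℝ := fun s => Matrix.of fun a b =>
    ∫ τ in (0 : ℝ)..s, Real.exp (-γ * (s - τ)) * W ⌊τ / δ⌋₊ a b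
  have hsamp : ∀ (f : ℕ → ℝ) s, IntervalIntegrable
      (fun τ => Real.exp (-γ * (s - τ)) * f ⌊τ / δ⌋₊) MeasureTheory.volume 0 s := by
    intro f s
    refine ((intervalIntegrable_exp_mul_sampled f hδ γ 0 s).const_mul
      (Real.exp (-γ * s))).congr fun τ _ => ?_
    simp only [← mul_assoc, ← Real.exp_add]
    ring_nf
  have hI : ∀ s, x ⬝ᵥ (I s *ᵥ x)
      = ∫ τ in (0 : ℝ)..s, Real.exp (-γ * (s - τ)) * (x ⬝ᵥ (W ⌊τ / δ⌋₊ *ᵥ x)) := by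
    intro s
    have h1 := dotProduct_integral_mulVec
      (A := fun τ => Real.exp (-γ * (s - τ)) • W ⌊τ / δ⌋₊) (s := 0) (t := s)
      (fun a b => hsamp (fun k => W k a b) s) x x
    refine h1.trans (intervalIntegral.integral_congr fun τ _ => ?_)
    simp only [Matrix.smul_mulVec, dotProduct_smul, smul_eq_mul]
  have hIb : ∀ s, 0 ≤ s → 0 ≤ γ * (x ⬝ᵥ (I s *ᵥ x)) ∧ γ * (x ⬝ᵥ (I s *ᵥ x)) ≤ x ⬝ᵥ x := by
    intro s hs
    rw [hI]
    constructor
    · exact mul_nonneg hγ.le (intervalIntegral.integral_nonneg hs fun τ _ =>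
        mul_nonneg (Real.exp_pos _).le ((hW _).quad_nonneg x))
    · have h1 : ∫ τ in (0 : ℝ)..s, Real.exp (-γ * (s - τ)) * (x ⬝ᵥ (W ⌊τ / δ⌋₊ *ᵥ x))
          ≤ ∫ τ in (0 : ℝ)..s, Real.exp (-γ * (s - τ)) * (x ⬝ᵥ x) :=
        intervalIntegral.integral_mono_on hs (hsamp (fun k => x ⬝ᵥ (W k *ᵥ x)) s)
          (Continuous.intervalIntegrable (by fun_prop) _ _) fun τ _ =>
            mul_le_mul_of_nonneg_left ((hW _).quad_le x) (Real.exp_pos _).le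
      rw [intervalIntegral.integral_mul_const, integral_exp_conv hγ] at h1
      have h2 := mul_le_mul_of_nonneg_left h1 hγ.le
      have h3 : γ * ((1 - Real.exp (-γ * s)) / γ * (x ⬝ᵥ x))
          = (1 - Real.exp (-γ * s)) * (x ⬝ᵥ x) := by field_simp
      nlinarith [dotProduct_self_nonneg x, Real.exp_pos (-γ * s)]
  have hIc : ∀ a b, Continuous fun s => I s a b := fun a b =>
    continuous_sampledConv (fun k => W k a b) hδ
  have hIxc : Continuous fun s => x ⬝ᵥ (I s *ᵥ x) := by
    simp only [dotProduct, Matrix.mulVec]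
    exact continuous_finsetSum _ fun a _ => continuous_const.mul
      (continuous_finsetSum _ fun b _ => (hIc a b).mul continuous_const)
  have hp : x ⬝ᵥ (filteredProj γ δ W t *ᵥ x) = ∫ s in (0 : ℝ)..t,
      Real.exp (-γ * (t - s)) * (γ * (x ⬝ᵥ x - γ * (x ⬝ᵥ (I s *ᵥ x)))) := by
    have h1 := dotProduct_integral_mulVec (A := fun s => Real.exp (-γ * (t - s)) •
      (γ • (1 : Matrix (Fin n) (Fin n) ℝ) - γ ^ 2 • I s)) (s := 0) (t := t)
      (fun a b => Continuous.intervalIntegrable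
        ((by fun_prop : Continuous fun s => Real.exp (-γ * (t - s))).mul
          (continuous_const.sub (continuous_const.mul (hIc a b)))) _ _) x x
    refine h1.trans (intervalIntegral.integral_congr fun s _ => ?_)
    simp only [Matrix.smul_mulVec, dotProduct_smul, smul_eq_mul, Matrix.sub_mulVec, dotProduct_sub,
      Matrix.one_mulVec]
    ring
  rw [hp]
  constructor
  · refine intervalIntegral.integral_nonneg ht fun s hs => mul_nonneg (Real.exp_pos _).le
      (mul_nonneg hγ.le ?_)
    linarith [(hIb s hs.1).2]
  · have h1 : ∫ s in (0 : ℝ)..t, Real.exp (-γ * (t - s)) * (γ * (x ⬝ᵥ x - γ * (x ⬝ᵥ (I s *ᵥ x))))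
        ≤ ∫ s in (0 : ℝ)..t, Real.exp (-γ * (t - s)) * (γ * (x ⬝ᵥ x)) := by
      refine intervalIntegral.integral_mono_on ht (Continuous.intervalIntegrable (by fun_prop) _ _)
        (Continuous.intervalIntegrable (by fun_prop) _ _) fun s hs =>
          mul_le_mul_of_nonneg_left ?_ (Real.exp_pos _).le
      nlinarith [(hIb s hs.1).1]
    rw [intervalIntegral.integral_mul_const, integral_exp_conv hγ] at h1
    refine h1.trans (le_of_eq ?_)
    field_simp

end FilteredProj

variable {φ : ℝ → Fin n → ℝ} {z : ℝ → ℝ} {β γ δ κ α : ℝ} {θ0 : Fin n → ℝ}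

/-- A node runs for all times: `Q`, `P` and `φf` are explicit integrals, and `Ω` is the inverse of the
positive definite information matrix. -/
theorem exists_localRun (hφ : ContinuousOn φ (Ici 0)) (hz : ContinuousOn z (Ici 0))
    (hγ : 0 < γ) (hδ : 0 < δ) (hκ : 0 < κ) (hα : 0 < α) :
    ∃ S : LocalSignals n, S.IsRun β γ δ κ α θ0 φ z := by
  choose rk Nhat hN using fun k : ℕ =>
    exists_columnsOrthonormalBasis (LinearMap.ker (forgetGram β φ (k * δ)).mulVecLin)
  have hW : ∀ k, IsOrthProj (Nhat k * (Nhat k)ᵀ) := fun k => isOrthProj_of_columns (hN k).1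
  let P := filteredProj γ δ fun k => Nhat k * (Nhat k)ᵀ
  let M := infoMatrix β κ α P (forgetGram β φ)
  have hPt : ∀ t, (P t)ᵀ = P t := filteredProj_transpose hW
  have hMu : ∀ t, 0 ≤ t → IsUnit (M t) := by
    intro t ht
    refine isUnit_of_quad_pos fun x hx => ?_
    obtain ⟨hp0, hp1⟩ := filteredProj_quad_bounds hδ hγ hW ht x
    have h1 : x ⬝ᵥ ((P t * forgetGram β φ t * P t) *ᵥ x)
        = (P t *ᵥ x) ⬝ᵥ (forgetGram β φ t *ᵥ (P t *ᵥ x)) := by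
      rw [← Matrix.mulVec_mulVec, ← Matrix.mulVec_mulVec, Matrix.dotProduct_mulVec,
        ← Matrix.mulVec_transpose, hPt]
    have h2 := forgetGram_quad_nonneg (β := β) hφ ht (P t *ᵥ x)
    have hx2 : 0 < x ⬝ᵥ x := lt_of_le_of_ne (dotProduct_self_nonneg x) fun h =>
      hx (dotProduct_self_eq_zero.1 h.symm)
    simp only [M, infoMatrix, Matrix.add_mulVec, Matrix.smul_mulVec, dotProduct_add,
      dotProduct_smul, smul_eq_mul, h1, Matrix.sub_mulVec, Matrix.one_mulVec, dotProduct_sub]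
    have h3 : 0 < κ * (Real.exp (-γ * t) * (x ⬝ᵥ x)) := by positivity
    have h4 : κ * (Real.exp (-γ * t) * (x ⬝ᵥ x)) ≤ κ * (x ⬝ᵥ x - x ⬝ᵥ (P t *ᵥ x)) :=
      mul_le_mul_of_nonneg_left (by linarith) hκ.le
    have h5 : 0 ≤ α * Real.exp (-β * t) * (x ⬝ᵥ (P t *ᵥ x)) :=
      mul_nonneg (by positivity) hp0
    linarith
  let S : LocalSignals n :=
    { rk := rk
      Nhat := Nhat
      Q := forgetGram β φ
      P := P
      φf := forgetCorr β α θ0 φ z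
      Ω := fun t => (M t)⁻¹
      θd := fun t => (M t)⁻¹ *ᵥ (P t *ᵥ forgetCorr β α θ0 φ z t) }
  have hP : ∀ t, 0 ≤ t → ∀ a b, HasDerivWithinAt (fun s => P s a b)
      (S.Pdot γ δ t a b) (Ici 0) t := by
    intro t ht a b
    refine (hasDerivWithinAt_filteredProj (W := fun k => Nhat k * (Nhat k)ᵀ) hδ ht
      a b).congr_deriv ?_
    rw [← add_sub_assoc]
    rfl
  have hP0 : P 0 = 0 := by
    ext a b
    simp [P, filteredProj]
  have hQ0 : forgetGram β φ 0 = 0 := by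
    ext a b
    simp [forgetGram]
  have hM0 : M 0 = κ • 1 := by
    simp [M, infoMatrix, hP0]
  have hΩ : ∀ t, 0 ≤ t → ∀ a b, HasDerivWithinAt (fun s => (M s)⁻¹ a b)
      ((β • (M t)⁻¹ - (M t)⁻¹ * S.R β γ δ κ α φ t * (M t)⁻¹) a b) (Ici 0) t := by
    intro t ht a b
    have h1 := hasDerivWithinAt_inv_entry (hasDerivWithinAt_infoMatrix (β := β) (κ := κ) (α := α)
      (hP t ht) (hasDerivWithinAt_forgetGram (β := β) hφ ht)) (hMu t ht) a b
    refine h1.congr_deriv ?_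
    have h2 : (M t)⁻¹ * M t = 1 :=
      Matrix.nonsing_inv_mul _ ((Matrix.isUnit_iff_isUnit_det _).1 (hMu t ht))
    have key : -((M t)⁻¹ * (-(β • M t) + S.R β γ δ κ α φ t) * (M t)⁻¹)
        = β • (M t)⁻¹ - (M t)⁻¹ * S.R β γ δ κ α φ t * (M t)⁻¹ := by
      rw [Matrix.mul_add, Matrix.mul_neg, Matrix.mul_smul, h2, Matrix.add_mul, Matrix.neg_mul,
        Matrix.smul_mul, Matrix.one_mul]
      abel
    rw [← key]
    rfl
  refine ⟨S, hQ0, fun t ht a b => hasDerivWithinAt_forgetGram hφ ht a b, hN, hP0, hP, ?_,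
    fun t ht => hasDerivWithinAt_forgetCorr hφ hz ht, ?_, hΩ, ?_, fun t ht => ?_⟩
  · ext a
    simp [S, forgetCorr]
  · change (M 0)⁻¹ = κ⁻¹ • 1
    rw [hM0]
    refine Matrix.inv_eq_left_inv ?_
    rw [Matrix.smul_mul, Matrix.one_mul, smul_smul, inv_mul_cancel₀ hκ.ne', one_smul]
  · simp [S, hP0]
  · refine (hasDerivWithinAt_mulVec (hΩ t ht) (hasDerivWithinAt_mulVec (hP t ht)
      (hasDerivWithinAt_forgetCorr hφ hz ht))).congr_deriv ?_
    change _ = -((M t)⁻¹ *ᵥ (S.R β γ δ κ α φ t *ᵥ ((M t)⁻¹ *ᵥ (P t *ᵥ forgetCorr β α θ0 φ z t))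
      - z t • (P t *ᵥ φ t) - S.Pdot γ δ t *ᵥ forgetCorr β α θ0 φ z t))
    simp only [Matrix.sub_mulVec, Matrix.smul_mulVec, Matrix.mulVec_add, Matrix.mulVec_sub,
      Matrix.mulVec_neg, Matrix.mulVec_smul, ← Matrix.mulVec_mulVec]
    abel

/-- The least squares estimate exists at all times. -/
lemma exists_normal_solution (hφ : ContinuousOn φ (Ici 0)) (hα : 0 < α) :
    ∃ x : ℝ → Fin n → ℝ, ∀ t, 0 ≤ t →
      normalMatrix β α φ t *ᵥ x t = forgetCorr β α θ0 φ z t := by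
  refine ⟨fun t => (normalMatrix β α φ t)⁻¹ *ᵥ forgetCorr β α θ0 φ z t, fun t ht => ?_⟩
  have hu : IsUnit (normalMatrix β α φ t) :=
    isUnit_of_quad_pos fun x hx => normalMatrix_quad_pos hφ hα ht hx
  rw [Matrix.mulVec_mulVec, Matrix.mul_nonsing_inv _ ((Matrix.isUnit_iff_isUnit_det _).1 hu),
    Matrix.one_mulVec]

lemma continuousOn_mulVec {A : ℝ → Matrix (Fin n) (Fin n) ℝ} {v : ℝ → Fin n → ℝ} {s : Set ℝ}
    (hA : ∀ a b, ContinuousOn (fun t => A t a b) s) (hv : ContinuousOn v s) :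
    ContinuousOn (fun t => A t *ᵥ v t) s := by
  refine continuousOn_pi.2 fun a => ?_
  simp only [Matrix.mulVec, dotProduct]
  exact continuousOn_finsetSum _ fun b _ => (hA a b).mul (continuousOn_pi.1 hv b)

lemma continuousOn_normal_solution (hφ : ContinuousOn φ (Ici 0)) (hz : ContinuousOn z (Ici 0))
    (hα : 0 < α) {x : ℝ → Fin n → ℝ}
    (hx : ∀ t, 0 ≤ t → normalMatrix β α φ t *ᵥ x t = forgetCorr β α θ0 φ z t) :
    ContinuousOn x (Ici 0) := by
  have hu : ∀ t, 0 ≤ t → IsUnit (normalMatrix β α φ t) := fun t ht =>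
    isUnit_of_quad_pos fun x hx => normalMatrix_quad_pos hφ hα ht hx
  have h1 : ∀ a b, ContinuousOn (fun t => (normalMatrix β α φ t)⁻¹ a b) (Ici 0) := by
    intro a b t ht
    have hE : HasDerivAt (fun s => α * Real.exp (-β * s)) (α * (Real.exp (-β * t) * (-β))) t := by
      simpa using (((hasDerivAt_id t).const_mul (-β)).exp).const_mul α
    exact (hasDerivWithinAt_inv_entry (A := normalMatrix β α φ)
      (A' := (-(β • forgetGram β φ t) + vecMulVec (φ t) (φ t))
        + (α * (Real.exp (-β * t) * (-β))) • 1)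
      (fun a b => (hasDerivWithinAt_forgetGram hφ ht a b).add
        (hE.hasDerivWithinAt.mul_const _)) (hu t ht) a b).continuousWithinAt
  have h2 : ContinuousOn (forgetCorr β α θ0 φ z) (Ici 0) := fun t ht =>
    (hasDerivWithinAt_forgetCorr hφ hz ht).continuousWithinAt
  refine (continuousOn_mulVec h1 h2).congr fun t ht => ?_
  change x t = (normalMatrix β α φ t)⁻¹ *ᵥ forgetCorr β α θ0 φ z t
  rw [← hx t ht, Matrix.mulVec_mulVec,
    Matrix.nonsing_inv_mul _ ((Matrix.isUnit_iff_isUnit_det _).1 (hu t ht)), Matrix.one_mulVec]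

end Existence

/-! ### The distributed algorithm and the reference system -/

lemma exists_bound_of_isBigO {E : Type*} [NormedAddCommGroup E] {f : ℝ → E} {ρ : ℝ}
    (hf : ContinuousOn f (Ici 0)) (h : f =O[atTop] fun t => Real.exp (-ρ * t)) :
    ∃ C > 0, ∀ t, 0 ≤ t → ‖f t‖ ≤ C * Real.exp (-ρ * t) := by
  obtain ⟨C, hC, hb⟩ := h.exists_pos
  obtain ⟨t₁, ht₁⟩ := eventually_atTop.1 hb.bound
  obtain ⟨K, hK⟩ := (isCompact_Icc (a := (0 : ℝ)) (b := t₁)).exists_bound_of_continuousOn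
    (f := fun t => Real.exp (ρ * t) • ‖f t‖)
    ((by fun_prop : Continuous fun t => Real.exp (ρ * t)).continuousOn.smul
      (hf.norm.mono fun u hu => hu.1))
  refine ⟨max C K, lt_max_of_lt_left hC, fun t ht => ?_⟩
  rcases le_total t₁ t with h1 | h1
  · have h2 := ht₁ t h1
    rw [Real.norm_eq_abs, abs_of_pos (Real.exp_pos _)] at h2
    exact h2.trans (by gcongr; exact le_max_left _ _)
  · have h2 := hK t ⟨ht, h1⟩
    rw [norm_smul, norm_norm, Real.norm_eq_abs, abs_of_pos (Real.exp_pos _)] at h2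
    have h3 : Real.exp (ρ * t) * Real.exp (-ρ * t) = 1 := by rw [← Real.exp_add]; simp
    calc ‖f t‖ = (Real.exp (ρ * t) * ‖f t‖) * Real.exp (-ρ * t) := by
          linear_combination (-‖f t‖) * h3
      _ ≤ max C K * Real.exp (-ρ * t) := by gcongr; exact h2.trans (le_max_right _ _)

section SmulLeft

variable {E F : Type*} [NormedAddCommGroup E] [NormedSpace ℝ E] [NormedAddCommGroup F]
  {v : ℝ → E} {g : ℝ → F} {l : Filter ℝ}

lemma isBigO_smul (h : v =O[l] g) (c : ℝ) : (fun t => c • v t) =O[l] g := h.const_smul_left c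

lemma isLittleO_smul (h : v =o[l] g) (c : ℝ) : (fun t => c • v t) =o[l] g := h.const_smul_left c

end SmulLeft

section Stacked

variable {N n : ℕ} {G : CommGraph N} {U : Fin N → Matrix (Fin n) (Fin n) ℝ} {k : ℝ}
  {ηu : Fin N → ℝ}

lemma isBigO_laplacian_sum {v : Fin N → ℝ → Fin n → ℝ} {g : ℝ → ℝ} {l : Filter ℝ}
    (hv : ∀ j, v j =O[l] g) (i : Fin N) :
    (fun t => ∑ j, G.laplacian i j • v j t) =O[l] g :=
  IsBigO.fun_sum fun j _ => isBigO_smul (hv j) _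

lemma isLittleO_mulVec {A : ℝ → Matrix (Fin n) (Fin n) ℝ} {v : ℝ → Fin n → ℝ}
    {E : Type*} [NormedAddCommGroup E] {x : ℝ → E} {l : Filter ℝ} (hA : Tendsto A l (𝓝 0))
    (hv : v =O[l] x) : (fun t => A t *ᵥ v t) =o[l] x := by
  have h1 : A =o[l] fun _ => (1 : ℝ) := (isLittleO_one_iff ℝ).2 hA
  have h2 := h1.norm_left.mul_isBigO (hv.norm_left.norm_right)
  refine IsLittleO.of_norm_right ?_
  simp only [one_mul] at h2
  exact (IsBigO.of_bound 1 (Eventually.of_forall fun t => by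
    rw [one_mul, norm_mul, norm_norm, norm_norm]; exact norm_mulVec_le _ _)).trans_isLittleO h2

/-- The right-hand side of the differential equations of the non-identifiable estimates, as a
function of the projections `P`, the identifiable estimates `p` and the state. -/
def networkField (G : CommGraph N) (ηd ηu : Fin N → ℝ) (P : Fin N → Matrix (Fin n) (Fin n) ℝ)
    (p x : Fin N → Fin n → ℝ) (i : Fin N) : Fin n → ℝ :=
  -(ηd i • (P i *ᵥ x i)) - ηu i • ((1 - P i) *ᵥ
    ∑ j, G.a i j • ((p i + (1 - P i) *ᵥ x i) - (p j + (1 - P j) *ᵥ x j)))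

lemma networkField_sub (ηd ηu : Fin N → ℝ) (P : Fin N → Matrix (Fin n) (Fin n) ℝ)
    (p x y : Fin N → Fin n → ℝ) :
    networkField G ηd ηu P p x - networkField G ηd ηu P p y
      = networkField G ηd ηu P 0 (x - y) := by
  funext i
  have h1 : ∑ j, G.a i j • (((0 : Fin N → Fin n → ℝ) i + (1 - P i) *ᵥ (x - y) i)
        - ((0 : Fin N → Fin n → ℝ) j + (1 - P j) *ᵥ (x - y) j))
      = ∑ j, G.a i j • ((p i + (1 - P i) *ᵥ x i) - (p j + (1 - P j) *ᵥ x j))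
        - ∑ j, G.a i j • ((p i + (1 - P i) *ᵥ y i) - (p j + (1 - P j) *ᵥ y j)) := by
    rw [← Finset.sum_sub_distrib]
    refine Finset.sum_congr rfl fun j _ => ?_
    rw [← smul_sub]
    congr 1
    simp only [Pi.zero_apply, Pi.sub_apply, Matrix.mulVec_sub]
    abel
  simp only [networkField, Pi.sub_apply] at h1 ⊢
  rw [h1]
  simp only [Matrix.mulVec_sub, smul_sub]
  abel

lemma exists_networkField_bound (G : CommGraph N) (ηd ηu : Fin N → ℝ) {C : ℝ} (hC : 0 ≤ C) :
    ∃ K, 0 ≤ K ∧ ∀ (P : Fin N → Matrix (Fin n) (Fin n) ℝ) (p x : Fin N → Fin n → ℝ),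
      (∀ i, ‖P i‖ ≤ C) → (∀ i, ‖1 - P i‖ ≤ C) →
        ‖networkField G ηd ηu P p x‖ ≤ K * (‖p‖ + ‖x‖) := by
  let K : Fin N → ℝ := fun i => |ηd i| * C + |ηu i| * (C * ∑ j, G.a i j * (2 * (1 + C)))
  have hK : ∀ i, 0 ≤ K i := fun i => add_nonneg (by positivity) (mul_nonneg (abs_nonneg _)
    (mul_nonneg hC (Finset.sum_nonneg fun j _ =>
      mul_nonneg (G.weight_nonneg i j) (by positivity))))
  refine ⟨∑ i, K i, Finset.sum_nonneg fun i _ => hK i, fun P p x hP hP' => ?_⟩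
  refine (pi_norm_le_iff_of_nonneg (mul_nonneg (Finset.sum_nonneg fun i _ => hK i)
    (by positivity))).2 fun i => ?_
  have hest : ∀ j, ‖p j + (1 - P j) *ᵥ x j‖ ≤ (1 + C) * (‖p‖ + ‖x‖) := by
    intro j
    have h1 : ‖(1 - P j) *ᵥ x j‖ ≤ C * ‖x‖ := (norm_mulVec_le _ _).trans
      (mul_le_mul (hP' j) (norm_le_pi_norm x j) (norm_nonneg _) hC)
    have h2 := norm_add_le (p j) ((1 - P j) *ᵥ x j)
    have h3 := norm_le_pi_norm p j
    nlinarith [norm_nonneg p, norm_nonneg x, mul_nonneg hC (norm_nonneg p)]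
  have hsum : ‖∑ j, G.a i j • ((p i + (1 - P i) *ᵥ x i) - (p j + (1 - P j) *ᵥ x j))‖
      ≤ (∑ j, G.a i j * (2 * (1 + C))) * (‖p‖ + ‖x‖) := by
    rw [Finset.sum_mul]
    refine norm_sum_le_of_le _ fun j _ => ?_
    rw [norm_smul, Real.norm_eq_abs, abs_of_nonneg (G.weight_nonneg i j), mul_assoc]
    refine mul_le_mul_of_nonneg_left ?_ (G.weight_nonneg i j)
    have h1 := norm_sub_le (p i + (1 - P i) *ᵥ x i) (p j + (1 - P j) *ᵥ x j)
    linarith [hest i, hest j]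
  have h4 : ‖networkField G ηd ηu P p x i‖ ≤ K i * (‖p‖ + ‖x‖) := by
    refine (norm_sub_le _ _).trans ?_
    rw [norm_neg, norm_smul, norm_smul, Real.norm_eq_abs, Real.norm_eq_abs, add_mul]
    refine add_le_add ?_ ?_
    · rw [mul_assoc]
      refine mul_le_mul_of_nonneg_left ((norm_mulVec_le _ _).trans ?_) (abs_nonneg _)
      refine mul_le_mul (hP i) ?_ (norm_nonneg _) hC
      linarith [norm_le_pi_norm x i, norm_nonneg p]
    · rw [mul_assoc, mul_assoc]
      exact mul_le_mul_of_nonneg_left ((norm_mulVec_le _ _).trans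
        (mul_le_mul (hP' i) hsum (norm_nonneg _) hC)) (abs_nonneg _)
  exact h4.trans (mul_le_mul_of_nonneg_right
    (Finset.single_le_sum (f := K) (fun i _ => hK i) (Finset.mem_univ i)) (by positivity))

lemma exists_networkField_solution (G : CommGraph N) (ηd ηu : Fin N → ℝ)
    {P : Fin N → ℝ → Matrix (Fin n) (Fin n) ℝ} {p : Fin N → ℝ → Fin n → ℝ}
    (hPc : ∀ i a b, ContinuousOn (fun t => P i t a b) (Ici 0))
    (hpc : ∀ i, ContinuousOn (p i) (Ici 0)) (hP : ∀ i, P i =O[atTop] fun _ => (1 : ℝ))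
    (hp : ∀ i, p i =O[atTop] fun _ => (1 : ℝ)) (x₀ : Fin N → Fin n → ℝ) :
    ∃ x : ℝ → Fin N → Fin n → ℝ, x 0 = x₀ ∧ ∀ t, 0 ≤ t → HasDerivWithinAt x
      (networkField G ηd ηu (fun i => P i t) (fun i => p i t) (x t)) (Ici 0) t := by
  have hb : ∀ {E : Type} [NormedAddCommGroup E] (f : Fin N → ℝ → E),
      (∀ i, ContinuousOn (f i) (Ici 0)) → (∀ i, f i =O[atTop] fun _ => (1 : ℝ)) →
        ∃ C, 0 ≤ C ∧ ∀ i t, 0 ≤ t → ‖f i t‖ ≤ C := by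
    intro E _ f hfc hf
    have h1 := fun i => exists_bound_of_isBigO (ρ := 0) (hfc i) (by simpa using hf i)
    choose c hc hcb using h1
    refine ⟨∑ i, c i, Finset.sum_nonneg fun i _ => (hc i).le, fun i t ht => ?_⟩
    have h2 := hcb i t ht
    simp only [neg_zero, zero_mul, Real.exp_zero, mul_one] at h2
    exact h2.trans (Finset.single_le_sum (f := c) (fun i _ => (hc i).le) (Finset.mem_univ i))
  obtain ⟨C₁, hC₁, hPb⟩ := hb P (fun i => continuousOn_matrix_of_entries (hPc i)) hP
  obtain ⟨C₂, hC₂, hpb⟩ := hb p hpc hp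
  set C := ‖(1 : Matrix (Fin n) (Fin n) ℝ)‖ + C₁
  have hC : 0 ≤ C := by positivity
  obtain ⟨K, hK, hKb⟩ := exists_networkField_bound (n := n) G ηd ηu hC
  have hP1 : ∀ t, 0 ≤ t → ∀ i, ‖P i t‖ ≤ C := fun t ht i =>
    (hPb i t ht).trans (le_add_of_nonneg_left (norm_nonneg _))
  have hP2 : ∀ t, 0 ≤ t → ∀ i, ‖1 - P i t‖ ≤ C := fun t ht i =>
    (norm_sub_le _ _).trans (add_le_add le_rfl (hPb i t ht))
  refine exists_solution_of_lipschitz _ (K + K * C₂) (fun x hx => ?_) (fun t ht x y => ?_)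
    (fun t ht => ?_) x₀
  · have hxi : ∀ i, ContinuousOn (fun t => x t i) (Ici 0) := fun i =>
      ((continuous_apply i).comp hx).continuousOn
    have hP' : ∀ i a b, ContinuousOn (fun t => (1 - P i t) a b) (Ici 0) := fun i a b =>
      continuousOn_const.sub (hPc i a b)
    have hest : ∀ i, ContinuousOn (fun t => p i t + (1 - P i t) *ᵥ x t i) (Ici 0) := fun i =>
      (hpc i).add (continuousOn_mulVec (hP' i) (hxi i))
    refine continuousOn_pi.2 fun i => ?_
    exact ((continuousOn_mulVec (hPc i) (hxi i)).const_smul (ηd i)).neg.sub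
      ((continuousOn_mulVec (hP' i) (continuousOn_finsetSum _ fun j _ =>
        ((hest i).sub (hest j)).const_smul (G.a i j))).const_smul (ηu i))
  · rw [networkField_sub]
    have h1 := hKb (fun i => P i t) 0 (x - y) (hP1 t ht) (hP2 t ht)
    rw [norm_zero, zero_add] at h1
    exact h1.trans (mul_le_mul_of_nonneg_right (le_add_of_nonneg_right (by positivity))
      (norm_nonneg _))
  · have h1 := hKb (fun i => P i t) (fun i => p i t) 0 (hP1 t ht) (hP2 t ht)
    have h2 : ‖fun i => p i t‖ ≤ C₂ := (pi_norm_le_iff_of_nonneg hC₂).2 fun i => hpb i t ht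
    rw [norm_zero, add_zero] at h1
    have h3 := mul_le_mul_of_nonneg_left h2 hK
    linarith

/-- The non-identifiable estimates stay bounded. -/
lemma HasConsensusRate.networkField_bounded (hcons : HasConsensusRate G U k) (hk : 0 < k)
    {ηd : Fin N → ℝ} (hηd : ∀ i, 0 < ηd i) (hηu : ∀ i, 0 < ηu i)
    {P : Fin N → ℝ → Matrix (Fin n) (Fin n) ℝ} {p : Fin N → ℝ → Fin n → ℝ}
    (hP : ∀ i, Tendsto (fun t => P i t - (1 - U i)) atTop (𝓝 0))
    (hp : ∀ i, p i =O[atTop] fun _ => (1 : ℝ)) {x : ℝ → Fin N → Fin n → ℝ}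
    (hx : ∀ i t, 0 ≤ t → HasDerivWithinAt (fun s => x s i)
      (networkField G ηd ηu (fun i => P i t) (fun i => p i t) (x t) i) (Ici 0) t) :
    x =O[atTop] fun _ => (1 : ℝ) := by
  let E : Fin N → ℝ → Matrix (Fin n) (Fin n) ℝ := fun i t => P i t - (1 - U i)
  have hxi : ∀ i, (fun t => x t i) =O[atTop] x := fun i =>
    IsBigO.of_bound 1 (Eventually.of_forall fun t => by
      rw [one_mul]; exact norm_le_pi_norm (x t) i)
  have hE1 : ∀ i, E i =O[atTop] fun _ => (1 : ℝ) := fun i => (hP i).isBigO_one ℝ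
  have hsp := fun i => isBigO_laplacian_sum (G := G) hp i
  have hmain := hcons ηu ηd 0 hηu (fun i => mul_pos hk (hηu i)) hηd x
    (fun t i => -(ηu i • ((U i - E i t) *ᵥ ∑ j, G.laplacian i j • p j t)))
    (fun t i => -(ηd i • (E i t *ᵥ x t i))
      + ηu i • (U i *ᵥ ∑ j, G.laplacian i j • (E j t *ᵥ x t j))
      + ηu i • (E i t *ᵥ ∑ j, G.laplacian i j • ((U j - E j t) *ᵥ x t j)))
    (fun i t ht => (hx i t ht).congr_deriv ?_) ?_ ?_
  · simpa using hmain
  · simp only [networkField, ← G.sum_laplacian_smul (fun j => p j t + (1 - P j t) *ᵥ x t j)]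
    have h1 : ∀ j, P j t = (1 - U j) + E j t := fun j => by simp only [E]; abel
    have h2 : ∀ j, 1 - P j t = U j - E j t := fun j => by simp only [E]; abel
    simp only [h2]
    rw [h1 i]
    simp only [smul_add, smul_sub, Finset.sum_add_distrib, Finset.sum_sub_distrib,
      Matrix.sub_mulVec, Matrix.add_mulVec, Matrix.mulVec_add, Matrix.mulVec_sub,
      Matrix.one_mulVec]
    abel
  · simp only [neg_zero, zero_mul, Real.exp_zero]
    refine isBigO_pi.2 fun i => IsBigO.neg_left (isBigO_smul ?_ _)
    simp only [Matrix.sub_mulVec]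
    refine (isBigO_const_mulVec _ (hsp i)).sub ?_
    simpa using isBigO_mulVec (hE1 i) (hsp i)
  · refine isLittleO_pi.2 fun i => ?_
    have h1 : ∀ j, (fun t => E j t *ᵥ x t j) =o[atTop] x := fun j =>
      isLittleO_mulVec (hP j) (hxi j)
    refine (((isLittleO_smul (h1 i) _).neg_left).add (isLittleO_smul ?_ _)).add
      (isLittleO_smul (isLittleO_mulVec (hP i) ?_) _)
    · refine (IsBigO.of_bound ‖U i‖ (Eventually.of_forall fun _ =>
        norm_mulVec_le _ _)).trans_isLittleO ?_
      exact IsLittleO.fun_sum fun j _ => isLittleO_smul (h1 j) _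
    · refine IsBigO.fun_sum fun j _ => isBigO_smul ?_ _
      simp only [Matrix.sub_mulVec]
      exact (isBigO_const_mulVec _ (hxi j)).sub (h1 j).isBigO

/-- The non-identifiable part of the reference state decays with its forcing. -/
lemma HasConsensusRate.reference_decay (hcons : HasConsensusRate G U k)
    (hUp : ∀ i, IsOrthProj (U i)) (hηu : ∀ i, 0 < ηu i) {ρ : ℝ} (hρ : ∀ i, ρ < k * ηu i)
    {s : Fin N → ℝ → Fin n → ℝ} (hs : ∀ i, s i =O[atTop] fun t => Real.exp (-ρ * t))
    {f : Fin N → ℝ → Fin n → ℝ} (hf : ∀ i, f i =O[atTop] fun t => Real.exp (-ρ * t))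
    {y : Fin N → ℝ → Fin n → ℝ} (hy : ∀ i t, U i *ᵥ y i t = y i t)
    (hyd : ∀ i t, 0 ≤ t → HasDerivWithinAt (y i)
      (-(ηu i • (U i *ᵥ ∑ j, G.laplacian i j • (s j t + y j t))) + f i t) (Ici 0) t) (i : Fin N) :
    y i =O[atTop] fun t => Real.exp (-ρ * t) := by
  -- on the ranges of the projections the damping is void, so any factor above `ρ` will do
  have hmain := hcons ηu (fun _ => ρ + 1) ρ hηu hρ (fun _ => lt_add_one ρ) (fun t i => y i t)
    (fun t i => -(ηu i • (U i *ᵥ ∑ j, G.laplacian i j • s j t)) + f i t) (fun _ _ => 0)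
    (fun i t ht => (hyd i t ht).congr_deriv ?_) ?_ (isLittleO_zero _ _)
  · exact (isBigO_pi.1 hmain) i
  · have h1 : (1 - U i) *ᵥ y i t = 0 := by rw [← hy i t]; exact (hUp i).compl_mulVec _
    simp only [h1, hy, smul_add, Finset.sum_add_distrib, Matrix.mulVec_add, smul_zero]
    abel
  · exact isBigO_pi.2 fun i => (IsBigO.neg_left (isBigO_smul
      (isBigO_const_mulVec _ (isBigO_laplacian_sum hs i)) _)).add (hf i)

/-- The estimates track the reference system: the tracking error obeys the consensus dynamics with a
forcing that decays like `P - (1 - U)`. -/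
lemma HasConsensusRate.tracking_decay (hcons : HasConsensusRate G U k)
    (hUp : ∀ i, IsOrthProj (U i)) {ηd : Fin N → ℝ} (hηu : ∀ i, 0 < ηu i) {ρ : ℝ}
    (hρ : ∀ i, ρ < k * ηu i) {P : Fin N → ℝ → Matrix (Fin n) (Fin n) ℝ}
    {p xs u : Fin N → ℝ → Fin n → ℝ} {θ : Fin n → ℝ}
    (hP : ∀ i, (fun t => P i t - (1 - U i)) =O[atTop] fun t => Real.exp (-ρ * t))
    (hP1 : ∀ i, P i =O[atTop] fun _ => (1 : ℝ))
    (hp : ∀ i, (fun t => p i t - (1 - U i) *ᵥ xs i t) =O[atTop] fun t => Real.exp (-ρ * t))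
    (hp1 : ∀ i, p i =O[atTop] fun _ => (1 : ℝ)) {x : ℝ → Fin N → Fin n → ℝ}
    (hx1 : x =O[atTop] fun _ => (1 : ℝ))
    (hx : ∀ i t, 0 ≤ t → HasDerivWithinAt (fun s => x s i)
      (networkField G ηd ηu (fun i => P i t) (fun i => p i t) (x t) i) (Ici 0) t)
    (hu : ∀ i t, U i *ᵥ u i t = u i t)
    (hud : ∀ i t, 0 ≤ t → HasDerivWithinAt (u i)
      (-(ηu i • (U i *ᵥ ∑ j, G.laplacian i j • ((1 - U j) *ᵥ (xs j t - θ) + u j t)))) (Ici 0) t)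
    (i : Fin N) :
    (fun t => (p i t + (1 - P i t) *ᵥ x t i) - θ - ((1 - U i) *ᵥ (xs i t - θ) + u i t))
      =O[atTop] fun t => Real.exp (-ρ * t) := by
  let E : Fin N → ℝ → Matrix (Fin n) (Fin n) ℝ := fun i t => P i t - (1 - U i)
  have hxi : ∀ i, (fun t => x t i) =O[atTop] fun _ => (1 : ℝ) := isBigO_pi.1 hx1
  let est : Fin N → ℝ → Fin n → ℝ := fun i t => p i t + (1 - P i t) *ᵥ x t i
  have hest : ∀ i, est i =O[atTop] fun _ => (1 : ℝ) := fun i => by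
    refine (hp1 i).add ?_
    simp only [Matrix.sub_mulVec, Matrix.one_mulVec]
    refine (hxi i).sub ?_
    simpa using isBigO_mulVec (hP1 i) (hxi i)
  let s : Fin N → ℝ → Fin n → ℝ := fun i t => (p i t - (1 - U i) *ᵥ xs i t) - E i t *ᵥ x t i
  have hs : ∀ i, s i =O[atTop] fun t => Real.exp (-ρ * t) := fun i =>
    (hp i).sub (by simpa using isBigO_mulVec (hP i) (hxi i))
  let y : Fin N → ℝ → Fin n → ℝ := fun i t => U i *ᵥ (x t i - θ) - u i t
  have hsplit : ∀ i t, est i t - θ - ((1 - U i) *ᵥ (xs i t - θ) + u i t) = s i t + y i t := by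
    intro i t
    simp only [est, s, y, E, Matrix.sub_mulVec, Matrix.mulVec_sub, Matrix.one_mulVec]
    abel
  have hy : ∀ i t, U i *ᵥ y i t = y i t := fun i t => by
    simp only [y]
    rw [Matrix.mulVec_sub, (hUp i).mulVec_mulVec, hu]
  let f : Fin N → ℝ → Fin n → ℝ := fun i t => -(ηd i • (U i *ᵥ (E i t *ᵥ x t i)))
    + ηu i • (U i *ᵥ (E i t *ᵥ ∑ j, G.laplacian i j • est j t))
  have hf : ∀ i, f i =O[atTop] fun t => Real.exp (-ρ * t) := fun i => by
    refine (IsBigO.neg_left (isBigO_smul (isBigO_const_mulVec _ ?_) _)).add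
      (isBigO_smul (isBigO_const_mulVec _ ?_) _)
    · simpa using isBigO_mulVec (hP i) (hxi i)
    · simpa using isBigO_mulVec (hP i) (isBigO_laplacian_sum (G := G) hest i)
  have hyd : ∀ i t, 0 ≤ t → HasDerivWithinAt (y i)
      (-(ηu i • (U i *ᵥ ∑ j, G.laplacian i j • (s j t + y j t))) + f i t) (Ici 0) t := by
    intro i t ht
    have h1 := (hasDerivWithinAt_const_mulVec (U i) ((hx i t ht).sub_const θ)).sub (hud i t ht)
    refine h1.congr_deriv ?_
    have hθ : ∑ j, G.laplacian i j • θ = 0 := by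
      rw [G.sum_laplacian_smul fun _ => θ]; simp
    have hPE : P i t = (1 - U i) + E i t := by simp only [E]; abel
    have hPE' : 1 - P i t = U i - E i t := by simp only [E]; abel
    have hsum : ∑ j, G.laplacian i j • (s j t + y j t)
        = ∑ j, G.laplacian i j • est j t
          - ∑ j, G.laplacian i j • ((1 - U j) *ᵥ (xs j t - θ) + u j t) := by
      simp only [← hsplit, smul_sub, Finset.sum_sub_distrib, hθ, sub_zero]
    have hnf : networkField G ηd ηu (fun i => P i t) (fun i => p i t) (x t) i
        = -(ηd i • (((1 - U i) + E i t) *ᵥ x t i))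
          - ηu i • ((U i - E i t) *ᵥ ∑ j, G.laplacian i j • est j t) := by
      rw [← hPE, ← hPE', G.sum_laplacian_smul]
      rfl
    rw [hnf, hsum]
    simp only [f, Matrix.mulVec_sub, Matrix.mulVec_neg, Matrix.mulVec_smul, Matrix.add_mulVec,
      Matrix.sub_mulVec (U i), Matrix.mulVec_add, (hUp i).mulVec_compl, (hUp i).mulVec_mulVec,
      zero_add, smul_sub]
    abel
  have h1 := (hs i).add (hcons.reference_decay hUp hηu hρ hs hf hy hyd i)
  exact h1.congr_left fun t => (hsplit i t).symm

end Stacked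

/-- Continuous bounded data whose regressors are excited off the ranges of the projections `U i`. -/
structure IsAdmissible {N n : ℕ} (φ : Fin N → ℝ → Fin n → ℝ) (z : Fin N → ℝ → ℝ)
    (U : Fin N → Matrix (Fin n) (Fin n) ℝ) (T : Fin N → ℝ) : Prop where
  excited : ∀ i, IsExcitedOff (φ i) (U i) (T i)
  φ_cont : ∀ i, ContinuousOn (φ i) (Ici 0)
  z_cont : ∀ i, ContinuousOn (z i) (Ici 0)
  φ_bdd : ∀ i, ∃ C, ∀ t, 0 ≤ t → ‖φ i t‖ ≤ C
  z_bdd : ∀ i, ∃ B, ∀ t, 0 ≤ t → |z i t| ≤ B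

lemma isBigO_exp_of_le {ρ ρ' : ℝ} (h : ρ ≤ ρ') :
    (fun t => Real.exp (-ρ' * t)) =O[atTop] fun t => Real.exp (-ρ * t) := by
  refine IsBigO.of_bound 1 ?_
  filter_upwards [eventually_ge_atTop 0] with t ht
  rw [one_mul, Real.norm_eq_abs, Real.norm_eq_abs, abs_of_pos (Real.exp_pos _),
    abs_of_pos (Real.exp_pos _)]
  exact Real.exp_le_exp.2 (by nlinarith)

lemma exists_euclNorm_bound {N n : ℕ} {F : ℝ → Fin N × Fin n → ℝ} {ρ : ℝ}
    (hF : ∀ i, ContinuousOn (fun t a => F t (i, a)) (Ici 0))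
    (h : ∀ i, (fun t a => F t (i, a)) =O[atTop] fun t => Real.exp (-ρ * t)) :
    ∃ C > 0, ∀ t, 0 ≤ t → euclNorm (F t) ≤ C * Real.exp (-ρ * t) := by
  have h1 : ContinuousOn F (Ici 0) := continuousOn_pi.2 fun p =>
    continuousOn_pi.1 (hF p.1) p.2
  have h2 : F =O[atTop] fun t => Real.exp (-ρ * t) := isBigO_pi.2 fun p =>
    isBigO_pi.1 (h p.1) p.2
  let L := (EuclideanSpace.equiv (Fin N × Fin n) ℝ).symm.toContinuousLinearMap
  exact exists_bound_of_isBigO (f := fun t => L (F t)) (L.continuous.comp_continuousOn h1)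
    ((L.isBigO_comp F atTop).trans h2)

lemma norm_le_euclNorm {n : ℕ} (x : Fin n → ℝ) : ‖x‖ ≤ euclNorm x := by
  refine (pow_le_pow_iff_left₀ (norm_nonneg _) (norm_nonneg _) two_ne_zero).1 ?_
  change ‖x‖ ^ 2 ≤ euclNorm x ^ 2
  rw [euclNorm_sq]
  exact sq_norm_le_dotProduct_self x

section Main

variable {N n : ℕ} {G : CommGraph N} {D : Design N n} {φ : Fin N → ℝ → Fin n → ℝ}
  {z : Fin N → ℝ → ℝ} {θ : Fin n → ℝ} {U : Fin N → Matrix (Fin n) (Fin n) ℝ} {T : Fin N → ℝ}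
  {γ ηu : Fin N → ℝ} {k : ℝ}

namespace IsAdmissible

variable (hA : IsAdmissible φ z U T)
include hA

section Local

variable {i : Fin N} {L : LocalSignals n} (hγ : ∀ i, 0 < γ i)
  (hL : L.IsRun (D.β i) (γ i) (D.δ i) (D.κ i) (D.α i) (D.θ0 i) (φ i) (z i))
include hγ hL

lemma P_sub_isBigO {ρ : ℝ} (hρ : ρ < γ i) :
    (fun t => L.P t - (1 - U i)) =O[atTop] fun t => Real.exp (-ρ * t) :=
  hL.P_sub_isBigO (hA.excited i) (hA.φ_cont i) (D.β_pos i) (D.δ_pos i) (hγ i) hρ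

lemma P_isBigO_one : L.P =O[atTop] fun _ => (1 : ℝ) := by
  have h1 := hA.P_sub_isBigO (D := D) hγ hL (hγ i)
  simp only [neg_zero, zero_mul, Real.exp_zero] at h1
  simpa using h1.add (isBigO_const_const (1 - U i) one_ne_zero atTop)

lemma estimate_sub_isBigO {xs : ℝ → Fin n → ℝ} (hxs : ∀ t, 0 ≤ t →
      normalMatrix (D.β i) (D.α i) (φ i) t *ᵥ xs t
        = forgetCorr (D.β i) (D.α i) (D.θ0 i) (φ i) (z i) t) {ρ : ℝ} (hρ : ρ < γ i) :
    (fun t => L.P t *ᵥ L.θd t - (1 - U i) *ᵥ xs t) =O[atTop] fun t => Real.exp (-ρ * t) := by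
  obtain ⟨C, hC⟩ := hA.φ_bdd i
  obtain ⟨B, hB⟩ := hA.z_bdd i
  exact hL.P_mulVec_θd_sub_isBigO (hA.excited i) (hA.φ_cont i) (hA.z_cont i) (D.β_pos i)
    (D.κ_pos i) (D.α_pos i) (D.δ_pos i) (hγ i) hC hB hxs hρ

omit hγ hL in
lemma reference_isBigO_one {xs : ℝ → Fin n → ℝ} (hxs : ∀ t, 0 ≤ t →
      normalMatrix (D.β i) (D.α i) (φ i) t *ᵥ xs t
        = forgetCorr (D.β i) (D.α i) (D.θ0 i) (φ i) (z i) t) :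
    (fun t => (1 - U i) *ᵥ xs t) =O[atTop] fun _ => (1 : ℝ) := by
  obtain ⟨C, hC⟩ := hA.φ_bdd i
  obtain ⟨B, hB⟩ := hA.z_bdd i
  exact (hA.excited i).compl_mulVec_isBigO (hA.φ_cont i) (D.β_pos i) (D.α_pos i) hxs
    (isBigO_forgetCorr (D.β_pos i) _ _ hC hB)

lemma estimate_isBigO_one : (fun t => L.P t *ᵥ L.θd t) =O[atTop] fun _ => (1 : ℝ) := by
  obtain ⟨xs, hxs⟩ := exists_normal_solution (z := z i) (β := D.β i) (θ0 := D.θ0 i)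
    (hA.φ_cont i) (D.α_pos i)
  have h1 := hA.estimate_sub_isBigO (D := D) hγ hL hxs (hγ i)
  simp only [neg_zero, zero_mul, Real.exp_zero] at h1
  simpa using h1.add (hA.reference_isBigO_one hxs)

end Local

theorem exists_run (G : CommGraph N) (D : Design N n) (hγ : ∀ i, 0 < γ i) (ηu : Fin N → ℝ) :
    ∃ S : NetworkSignals N n, S.IsRun G D γ ηu φ z := by
  choose L hL using fun i => exists_localRun (β := D.β i) (θ0 := D.θ0 i) (hA.φ_cont i)
    (hA.z_cont i) (hγ i) (D.δ_pos i) (D.κ_pos i) (D.α_pos i)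
  have hPc : ∀ i a b, ContinuousOn (fun t => (L i).P t a b) (Ici 0) := fun i a b t ht =>
    ((hL i).P_deriv t ht a b).continuousWithinAt
  obtain ⟨x, hx0, hx⟩ := exists_networkField_solution G D.ηd ηu
    (P := fun i => (L i).P) (p := fun i t => (L i).P t *ᵥ (L i).θd t) hPc
    (fun i => continuousOn_mulVec (hPc i) fun t ht =>
      ((hL i).θd_deriv t ht).continuousWithinAt)
    (fun i => hA.P_isBigO_one hγ (hL i)) (fun i => hA.estimate_isBigO_one hγ (hL i)) D.θ0
  refine ⟨⟨L, fun i t => x t i⟩, hL, fun i => congrFun hx0 i, fun i t ht => ?_⟩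
  exact hasDerivWithinAt_pi.1 (hx t ht) i

section Reference

variable {q : Fin N → ℕ} {Nd : (i : Fin N) → Matrix (Fin n) (Fin (n - q i)) ℝ}
  {Nu : (i : Fin N) → Matrix (Fin n) (Fin (q i)) ℝ}

theorem exists_trajectory (G : CommGraph N) (D : Design N n) (ηu : Fin N → ℝ) (θ : Fin n → ℝ)
    (hNd : ∀ i, Nd i * (Nd i)ᵀ = 1 - U i) :
    ∃ X : RefSignals N n q, X.IsTrajectory G D ηu φ z Nd Nu θ := by
  choose xs hxs using fun i => exists_normal_solution (z := z i) (β := D.β i) (θ0 := D.θ0 i)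
    (hA.φ_cont i) (D.α_pos i)
  let d : ℝ → Fin N → Fin n → ℝ := fun t i => (1 - U i) *ᵥ (xs i t - θ)
  have hdc : ContinuousOn d (Ici 0) := continuousOn_pi.2 fun i =>
    continuousOn_mulVec (fun _ _ => continuousOn_const) ((continuousOn_normal_solution
      (hA.φ_cont i) (hA.z_cont i) (D.α_pos i) (hxs i)).sub continuousOn_const)
  have hd1 : d =O[atTop] fun t => Real.exp (-0 * t) := by
    simp only [neg_zero, zero_mul, Real.exp_zero]
    refine isBigO_pi.2 fun i => ?_
    simp only [d, Matrix.mulVec_sub]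
    exact (hA.reference_isBigO_one (hxs i)).sub (isBigO_const_const _ one_ne_zero _)
  obtain ⟨B, hB, hdB⟩ := exists_bound_of_isBigO hdc hd1
  let m : ((i : Fin N) → Fin (q i) → ℝ) →ₗ[ℝ] (Fin N → Fin n → ℝ) :=
    LinearMap.pi fun i => (Nu i).mulVecLin ∘ₗ LinearMap.proj i
  let h : (Fin N → Fin n → ℝ) →ₗ[ℝ] ((i : Fin N) → Fin (q i) → ℝ) :=
    LinearMap.pi fun i => -(ηu i • ((Nu i)ᵀ.mulVecLin ∘ₗ
      ∑ j, G.laplacian i j • LinearMap.proj j))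
  let m' := LinearMap.toContinuousLinearMap m
  let h' := LinearMap.toContinuousLinearMap h
  obtain ⟨u, hu0, hu⟩ := exists_solution_of_lipschitz (fun t u => h' (d t + m' u))
    (‖h'‖ * ‖m'‖ + ‖h'‖ * B)
    (fun x hx => h'.continuous.comp_continuousOn
      (hdc.add (m'.continuous.comp hx).continuousOn))
    (fun t ht x y => by
      rw [← map_sub, add_sub_add_left_eq_sub, ← map_sub]
      calc ‖h' (m' (x - y))‖ ≤ ‖h'‖ * (‖m'‖ * ‖x - y‖) :=
            (h'.le_opNorm _).trans (by gcongr; exact m'.le_opNorm _)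
        _ = ‖h'‖ * ‖m'‖ * ‖x - y‖ := by ring
        _ ≤ _ := by gcongr; exact le_add_of_nonneg_right (by positivity))
    (fun t ht => by
      have h1 := hdB t ht
      simp only [neg_zero, zero_mul, Real.exp_zero, mul_one] at h1
      rw [map_zero, add_zero]
      calc ‖h' (d t)‖ ≤ ‖h'‖ * B := (h'.le_opNorm _).trans (by gcongr)
        _ ≤ _ := le_add_of_nonneg_left (by positivity)) 0
  refine ⟨⟨xs, fun i t => u t i⟩, fun i t ht => ?_, fun i => congrFun hu0 i, fun i t ht => ?_⟩
  · exact cost_le_of_normal_equation (hA.φ_cont i) (hA.z_cont i) (D.α_pos i) ht (hxs i t ht)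
  · refine (hasDerivWithinAt_pi.1 (hu t ht) i).congr_deriv ?_
    have h1 : ∀ j, RefSignals.block ⟨xs, fun i t => u t i⟩ Nd Nu θ j t
        = (d t + m (u t)) j := by
      intro j
      simp only [RefSignals.block, RefSignals.DPart, Matrix.mulVec_mulVec, hNd]
      rfl
    have h2 : ∀ v, h v i = -(ηu i • ((Nu i)ᵀ *ᵥ ∑ j, G.laplacian i j • v j)) := by
      intro v
      simp only [h, LinearMap.pi_apply, LinearMap.neg_apply, LinearMap.smul_apply,
        LinearMap.comp_apply, LinearMap.sum_apply, LinearMap.proj_apply, Matrix.mulVecLin_apply]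
    simp only [h1]
    exact h2 _

omit hA in
lemma block_eq (X : RefSignals N n q) (hNd : ∀ i, Nd i * (Nd i)ᵀ = 1 - U i) (i : Fin N)
    (t : ℝ) : X.block Nd Nu θ i t = (1 - U i) *ᵥ (X.θs i t - θ) + Nu i *ᵥ X.U i t := by
  simp only [RefSignals.block, RefSignals.DPart, Matrix.mulVec_mulVec, hNd]

variable {X : RefSignals N n q} (hNd : ∀ i, Nd i * (Nd i)ᵀ = 1 - U i)
  (hNu : ∀ i, Nu i * (Nu i)ᵀ = U i) (hNu' : ∀ i, (Nu i)ᵀ * Nu i = 1)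
  (hX : X.IsTrajectory G D ηu φ z Nd Nu θ)

omit hA in
include hNd hNu hX in
lemma hasDerivWithinAt_reference (i : Fin N) {t : ℝ} (ht : 0 ≤ t) :
    HasDerivWithinAt (fun t => Nu i *ᵥ X.U i t)
      (-(ηu i • (U i *ᵥ ∑ j, G.laplacian i j •
        ((1 - U j) *ᵥ (X.θs j t - θ) + Nu j *ᵥ X.U j t)))) (Ici 0) t := by
  refine (hasDerivWithinAt_const_mulVec (Nu i) (hX.U_deriv i t ht)).congr_deriv ?_
  simp only [block_eq X hNd]
  rw [Matrix.mulVec_neg, Matrix.mulVec_smul, Matrix.mulVec_mulVec, hNu]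

omit hA in
include hNu hNu' in
lemma proj_mulVec_reference (X : RefSignals N n q) (i : Fin N) (t : ℝ) :
    U i *ᵥ (Nu i *ᵥ X.U i t) = Nu i *ᵥ X.U i t := by
  rw [← hNu, Matrix.mulVec_mulVec, Matrix.mul_assoc, hNu', Matrix.mul_one]

include hX in
lemma normal_equation (i : Fin N) (t : ℝ) (ht : 0 ≤ t) :
    normalMatrix (D.β i) (D.α i) (φ i) t *ᵥ X.θs i t
      = forgetCorr (D.β i) (D.α i) (D.θ0 i) (φ i) (z i) t :=
  normal_equation_of_forall_cost_le (hA.φ_cont i) (hA.z_cont i) ht (hX.θs_min i t ht)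

variable {S : NetworkSignals N n} (hS : S.IsRun G D γ ηu φ z)

omit hA in
include hS in
lemma continuousOn_est (i : Fin N) : ContinuousOn (S.est i) (Ici 0) := by
  have hPc : ∀ a b, ContinuousOn (fun t => (S.loc i).P t a b) (Ici 0) := fun a b t ht =>
    ((hS.loc_run i).P_deriv t ht a b).continuousWithinAt
  exact (continuousOn_mulVec hPc fun t ht =>
    ((hS.loc_run i).θd_deriv t ht).continuousWithinAt).add
    (continuousOn_mulVec (fun a b => continuousOn_const.sub (hPc a b)) fun t ht =>
      (hS.θu_deriv i t ht).continuousWithinAt)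

include hNd hX in
lemma continuousOn_block (i : Fin N) : ContinuousOn (X.block Nd Nu θ i) (Ici 0) := by
  have h1 : ContinuousOn (X.θs i) (Ici 0) := continuousOn_normal_solution (hA.φ_cont i)
    (hA.z_cont i) (D.α_pos i) (hA.normal_equation hX i)
  have h2 : ContinuousOn (fun t => Nu i *ᵥ X.U i t) (Ici 0) := fun t ht =>
    (hasDerivWithinAt_const_mulVec (Nu i) (hX.U_deriv i t ht)).continuousWithinAt
  refine ((continuousOn_mulVec (A := fun _ => 1 - U i) (fun _ _ => continuousOn_const)
    (h1.sub (continuousOn_const (c := θ)))).add h2).congr fun t _ => ?_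
  exact block_eq X hNd i t

include hNd hNu hNu' hX hS in
/-- Every run approaches the reference trajectory at all rates below the filter gains and below a
fixed multiple of the consensus gains. -/
theorem est_sub_block_isBigO (hcons : HasConsensusRate G U k) (hk : 0 < k) (hγ : ∀ i, 0 < γ i)
    (hηu : ∀ i, 0 < ηu i) {ρ : ℝ} (hργ : ∀ i, ρ < γ i) (hρη : ∀ i, ρ < k * ηu i) (i : Fin N) :
    (fun t => S.est i t - θ - X.block Nd Nu θ i t) =O[atTop] fun t => Real.exp (-ρ * t) := by
  have hUp : ∀ i, IsOrthProj (U i) := fun i => (hA.excited i).proj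
  have hx : ∀ i t, 0 ≤ t → HasDerivWithinAt (fun s => (fun t i => S.θu i t) s i)
      (networkField G D.ηd ηu (fun i => (S.loc i).P t)
        (fun i => (S.loc i).P t *ᵥ (S.loc i).θd t) (fun i => S.θu i t) i) (Ici 0) t :=
    fun i t ht => hS.θu_deriv i t ht
  have hx1 := hcons.networkField_bounded hk D.ηd_pos hηu
    (P := fun i => (S.loc i).P) (p := fun i t => (S.loc i).P t *ᵥ (S.loc i).θd t)
    (fun i => tendsto_zero_of_isBigO_exp (half_pos (hγ i))
      (hA.P_sub_isBigO hγ (hS.loc_run i) (half_lt_self (hγ i))))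
    (fun i => hA.estimate_isBigO_one hγ (hS.loc_run i)) hx
  have h := hcons.tracking_decay hUp hηu hρη (xs := X.θs) (θ := θ)
    (u := fun i t => Nu i *ᵥ X.U i t)
    (fun i => hA.P_sub_isBigO hγ (hS.loc_run i) (hργ i))
    (fun i => hA.P_isBigO_one hγ (hS.loc_run i))
    (fun i => hA.estimate_sub_isBigO hγ (hS.loc_run i) (hA.normal_equation hX i) (hργ i))
    (fun i => hA.estimate_isBigO_one hγ (hS.loc_run i)) hx1 hx
    (proj_mulVec_reference hNu hNu' X) (fun i t ht => hasDerivWithinAt_reference hNd hNu hX i ht) i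
  refine h.congr_left fun t => ?_
  rw [block_eq X hNd]
  rfl

include hNd hNu hNu' hX in
/-- Without noise the reference trajectory vanishes at all rates up to the forgetting factors and
below a fixed multiple of the consensus gains. -/
theorem block_isBigO (hcons : HasConsensusRate G U k) (hηu : ∀ i, 0 < ηu i)
    (hzθ : ∀ i t, 0 ≤ t → z i t = φ i t ⬝ᵥ θ) {ρ : ℝ} (hρβ : ∀ i, ρ ≤ D.β i)
    (hρη : ∀ i, ρ < k * ηu i) (i : Fin N) :
    X.block Nd Nu θ i =O[atTop] fun t => Real.exp (-ρ * t) := by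
  have hd : ∀ i, (fun t => (1 - U i) *ᵥ (X.θs i t - θ)) =O[atTop] fun t => Real.exp (-ρ * t) :=
    fun i => ((hA.excited i).compl_mulVec_sub_isBigO (hA.φ_cont i) (D.β_pos i) (D.α_pos i)
      (hzθ i) (hA.normal_equation hX i)).trans (isBigO_exp_of_le (hρβ i))
  have hu := hcons.reference_decay (fun i => (hA.excited i).proj) hηu hρη hd
    (f := fun _ _ => 0) (fun i => isBigO_zero _ _) (proj_mulVec_reference hNu hNu' X)
    (fun i t ht => (hasDerivWithinAt_reference hNd hNu hX i ht).congr_deriv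
      (add_zero _).symm) i
  exact ((hd i).add hu).congr_left fun t => (block_eq X hNd i t).symm

end Reference
end IsAdmissible
end Main

end

end DefExc

theorem theorem3 {N n : ℕ} (G : DefExc.CommGraph N) (hG : G.StronglyConnected)
    -- regressors, parameter and noise
    (φ : Fin N → ℝ → Fin n → ℝ) (θ : Fin n → ℝ) (ε : Fin N → ℝ → ℝ)
    (hφ_smooth : ∀ i, ContDiffOn ℝ ∞ (φ i) (Ici 0))
    (hφ_bdd : ∀ i, ∃ M : ℝ, ∀ t, 0 ≤ t → DefExc.euclNorm (φ i t) ≤ M)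
    (z : Fin N → ℝ → ℝ) (hz : ∀ i, z i = DefExc.measurement (φ i) θ (ε i))
    (hz_cont : ∀ i, ContinuousOn (z i) (Ici 0))
    (hε_bdd : ∀ i, ∃ B : ℝ, ∀ t, 0 ≤ t → |ε i t| ≤ B)
    -- deficient excitation of every node, and the complementary condition
    (q : Fin N → ℕ) (T : Fin N → ℝ) (Φa Φb : Fin N → Matrix (Fin n) (Fin n) ℝ)
    (hDE : ∀ i, DefExc.IsDeficientlyExciting (φ i) (q i) (T i) (Φa i) (Φb i))
    (hcompl : (∑ i, Φa i).PosDef)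
    -- bases of the identifiable and of the non-identifiable subspaces
    (Nd : (i : Fin N) → Matrix (Fin n) (Fin (n - q i)) ℝ)
    (Nu : (i : Fin N) → Matrix (Fin n) (Fin (q i)) ℝ)
    (hNd : ∀ i, DefExc.ColumnsOrthonormalBasis (Nd i) (LinearMap.range (Φa i).mulVecLin))
    (hNu : ∀ i, DefExc.ColumnsOrthonormalBasis (Nu i) (LinearMap.ker (Φb i).mulVecLin))
    -- design parameters other than the gains `γ` and `ηu`
    (D : DefExc.Design N n) :
    -- well-posedness of the algorithm and of the reference system
    (∀ γ ηu : Fin N → ℝ, (∀ i, 0 < γ i) → (∀ i, 0 < ηu i) →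
      (∃ S : DefExc.NetworkSignals N n, S.IsRun G D γ ηu φ z) ∧
      (∃ X : DefExc.RefSignals N n q, X.IsTrajectory G D ηu φ z Nd Nu θ)) ∧
    -- exponential convergence to the reference trajectory, for all positive gains
    (∀ γ ηu : Fin N → ℝ, (∀ i, 0 < γ i) → (∀ i, 0 < ηu i) →
      ∀ (S : DefExc.NetworkSignals N n) (X : DefExc.RefSignals N n q),
        S.IsRun G D γ ηu φ z → X.IsTrajectory G D ηu φ z Nd Nu θ →
        ∃ ρa > 0, ∃ ρb > 0, ∀ t, 0 ≤ t →
          DefExc.euclNorm (S.err θ t - X.out Nd Nu θ t) ≤ ρa * Real.exp (-ρb * t)) ∧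
    -- any prescribed rate is reached once all gains are large enough
    (∀ ρb > 0, ∃ g > 0, ∀ γ ηu : Fin N → ℝ, (∀ i, g ≤ γ i) → (∀ i, g ≤ ηu i) →
      ∀ (S : DefExc.NetworkSignals N n) (X : DefExc.RefSignals N n q),
        S.IsRun G D γ ηu φ z → X.IsTrajectory G D ηu φ z Nd Nu θ →
        ∃ ρa > 0, ∀ t, 0 ≤ t →
          DefExc.euclNorm (S.err θ t - X.out Nd Nu θ t) ≤ ρa * Real.exp (-ρb * t)) ∧
    -- the noise-free case
    ((∀ i t, 0 ≤ t → ε i t = 0) →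
      (∀ γ ηu : Fin N → ℝ, (∀ i, 0 < γ i) → (∀ i, 0 < ηu i) →
        ∀ S : DefExc.NetworkSignals N n, S.IsRun G D γ ηu φ z →
          ∃ ρc > 0, ∃ ρd > 0, ∀ t, 0 ≤ t →
            DefExc.euclNorm (S.err θ t) ≤ ρc * Real.exp (-ρd * t)) ∧
      (∃ g > 0, ∀ γ ηu : Fin N → ℝ, (∀ i, g ≤ γ i) → (∀ i, g ≤ ηu i) →
        ∀ S : DefExc.NetworkSignals N n, S.IsRun G D γ ηu φ z →
          ∀ ρd : ℝ, (∀ i, ρd < D.β i / 2) →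
            ∃ ρc > 0, ∀ t, 0 ≤ t →
              DefExc.euclNorm (S.err θ t) ≤ ρc * Real.exp (-ρd * t))) := by
  have hφ : ∀ i, ContinuousOn (φ i) (Ici 0) := fun i => (hφ_smooth i).continuousOn
  have hφb : ∀ i, ∃ C, ∀ t, 0 ≤ t → ‖φ i t‖ ≤ C := fun i => by
    obtain ⟨M, hM⟩ := hφ_bdd i
    exact ⟨M, fun t ht => (DefExc.norm_le_euclNorm _).trans (hM t ht)⟩
  have hA : DefExc.IsAdmissible φ z (fun i => Nu i * (Nu i)ᵀ) T := by
    refine ⟨fun i => (hDE i).isExcitedOff (hφ i) (hNu i), hφ, hz_cont, hφb, fun i => ?_⟩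
    obtain ⟨C, hC⟩ := hφb i
    obtain ⟨B, hB⟩ := hε_bdd i
    refine ⟨n * (C * ‖θ‖) + B, fun t ht => ?_⟩
    rw [hz i, DefExc.measurement]
    refine (abs_add_le _ _).trans (add_le_add ((DefExc.abs_dotProduct_le _ _).trans ?_) (hB t ht))
    gcongr
    exact hC t ht
  have hNdU : ∀ i, Nd i * (Nd i)ᵀ = 1 - Nu i * (Nu i)ᵀ := fun i =>
    (hDE i).identifiable_proj_eq (hNd i) (hNu i)
  -- complementarity: the non-identifiable subspaces have no common nonzero vector
  have hinter : ∀ x, (∀ i, (Nu i * (Nu i)ᵀ) *ᵥ x = x) → x = 0 := by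
    intro x hx
    by_contra hne
    have h1 := hcompl.dotProduct_mulVec_pos hne
    rw [Matrix.sum_mulVec,
      Finset.sum_eq_zero fun i _ => ((hDE i).proj_fixed_iff (hNu i) x).1 (hx i),
      dotProduct_zero] at h1
    exact lt_irrefl _ h1
  obtain ⟨k, hk, hcons⟩ := hG.exists_hasConsensusRate (fun i => (hA.excited i).proj) hinter
  have htrack : ∀ γ ηu : Fin N → ℝ, (∀ i, 0 < γ i) → (∀ i, 0 < ηu i) → ∀ ρ : ℝ, (∀ i, ρ < γ i) →
      (∀ i, ρ < k * ηu i) → ∀ (S : DefExc.NetworkSignals N n) (X : DefExc.RefSignals N n q),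
        S.IsRun G D γ ηu φ z → X.IsTrajectory G D ηu φ z Nd Nu θ →
        ∃ ρa > 0, ∀ t, 0 ≤ t →
          DefExc.euclNorm (S.err θ t - X.out Nd Nu θ t) ≤ ρa * Real.exp (-ρ * t) := by
    intro γ ηu hγ hηu ρ hργ hρη S X hS hX
    refine DefExc.exists_euclNorm_bound (fun i => ?_) fun i =>
      hA.est_sub_block_isBigO hNdU (fun _ => rfl) (fun i => (hNu i).1) hX hS hcons hk hγ hηu
        hργ hρη i
    exact ((DefExc.IsAdmissible.continuousOn_est hS i).sub continuousOn_const).sub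
      (hA.continuousOn_block hNdU hX i)
  have hfree : (∀ i t, 0 ≤ t → ε i t = 0) → ∀ γ ηu : Fin N → ℝ, (∀ i, 0 < γ i) →
      (∀ i, 0 < ηu i) → ∀ ρ : ℝ, (∀ i, ρ < γ i) → (∀ i, ρ < k * ηu i) → (∀ i, ρ ≤ D.β i) →
      ∀ S : DefExc.NetworkSignals N n, S.IsRun G D γ ηu φ z →
        ∃ ρc > 0, ∀ t, 0 ≤ t → DefExc.euclNorm (S.err θ t) ≤ ρc * Real.exp (-ρ * t) := by
    intro hε γ ηu hγ hηu ρ hργ hρη hρβ S hS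
    obtain ⟨X, hX⟩ := hA.exists_trajectory G D ηu θ hNdU
    refine DefExc.exists_euclNorm_bound (fun i =>
      (DefExc.IsAdmissible.continuousOn_est hS i).sub continuousOn_const) fun i => ?_
    have h1 := hA.est_sub_block_isBigO hNdU (fun _ => rfl) (fun i => (hNu i).1) hX hS hcons hk hγ
      hηu hργ hρη i
    have h2 := hA.block_isBigO hNdU (fun _ => rfl) (fun i => (hNu i).1) hX hcons hηu
      (fun i t ht => by rw [hz i, DefExc.measurement, hε i t ht, add_zero]) hρβ hρη i
    exact (h1.add h2).congr_left fun t => sub_add_cancel _ _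
  refine ⟨fun γ ηu hγ _ => ⟨hA.exists_run G D hγ ηu, hA.exists_trajectory G D ηu θ hNdU⟩,
    fun γ ηu hγ hηu S X hS hX => ?_, fun ρb hρb => ?_, fun hε => ⟨fun γ ηu hγ hηu S hS => ?_, ?_⟩⟩
  · obtain ⟨ρ, hρ, hlt⟩ := DefExc.exists_gt_forall_lt (f := fun i => min (γ i) (k * ηu i))
      fun i => lt_min (hγ i) (mul_pos hk (hηu i))
    obtain ⟨ρa, hρa, h⟩ := htrack γ ηu hγ hηu ρ (fun i => (lt_min_iff.1 (hlt i)).1)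
      (fun i => (lt_min_iff.1 (hlt i)).2) S X hS hX
    exact ⟨ρa, hρa, ρ, hρ, h⟩
  · refine ⟨ρb + ρb / k + 1, by positivity, fun γ ηu hγ hηu => ?_⟩
    have h1 : 0 < ρb / k := by positivity
    have h2 : k * (ρb / k) = ρb := mul_div_cancel₀ _ hk.ne'
    exact htrack γ ηu (fun i => by linarith [hγ i]) (fun i => by linarith [hηu i]) ρb
      (fun i => by linarith [hγ i]) fun i => by nlinarith [hηu i]
  · obtain ⟨ρ, hρ, hlt⟩ := DefExc.exists_gt_forall_lt
      (f := fun i => min (min (γ i) (k * ηu i)) (D.β i))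
      fun i => lt_min (lt_min (hγ i) (mul_pos hk (hηu i))) (D.β_pos i)
    obtain ⟨ρc, hρc, h⟩ := hfree hε γ ηu hγ hηu ρ
      (fun i => (lt_min_iff.1 (lt_min_iff.1 (hlt i)).1).1)
      (fun i => (lt_min_iff.1 (lt_min_iff.1 (hlt i)).1).2)
      (fun i => (lt_min_iff.1 (hlt i)).2.le) S hS
    exact ⟨ρc, hρc, ρ, hρ, h⟩
  · set b := ∑ i, D.β i
    have hb0 : 0 ≤ b := Finset.sum_nonneg fun i _ => (D.β_pos i).le
    have hb : ∀ i, D.β i ≤ b := fun i =>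
      Finset.single_le_sum (f := D.β) (fun j _ => (D.β_pos j).le) (Finset.mem_univ i)
    have h1 : 0 ≤ b / k := by positivity
    have h2 : k * (b / k) = b := mul_div_cancel₀ _ hk.ne'
    refine ⟨b + b / k + 1, by positivity, fun γ ηu hγ hηu S hS ρd hρd => ?_⟩
    exact hfree hε γ ηu (fun i => by linarith [hγ i]) (fun i => by linarith [hηu i]) ρd
      (fun i => by linarith [hγ i, hρd i, hb i, D.β_pos i])
      (fun i => by nlinarith [hηu i, hρd i, hb i, D.β_pos i])
      (fun i => by linarith [hρd i, D.β_pos i]) S hS
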